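/- An instance of Min Stable Cut is a finite simple graph $G=(V,E)$ with edge weights $w:E\to\mathbb{N}$. The weighted degree of $v\in V$ is $d_w(v)=\sum_{uv\in E}w(uv)$. A cut is a partition of $V$ into two (possibly empty) sides $V_0,V_1$; its weight is the sum of $w(uv)$ over the edges $uv$ with one endpoint on each side. A cut is stable if for every $v\in V$ the total weight of the edges incident on $v$ that cross the cut is at least $d_w(v)/2$. Theorem. There are a deterministic algorithm and a constant $c$ such that the following holds. Given a graph $G=(V,E)$ with $n$ vertices and edge weights $w:E\to\mathbb{N}$ of maximum $W$ (written in binary), a tree decomposition of $G$ with $N$ nodes and width $\mathrm{tw}$, and a rational error $\varepsilon>0$ (given by numerator and denominator in binary, with $L$ bits in total), the algorithm returns, in time at most $$c\cdot\max\left(1,\frac{\mathrm{tw}}{\varepsilon}\right)^{c\cdot\mathrm{tw}}\cdot\left(n+N+\log W+L\right)^{c},$$ a cut such that (i) for every $v\in V$, the total weight of the edges incident on $v$ that cross the cut is at least $(1-\varepsilon)\frac{d_w(v)}{2}$; (ii) the weight of the cut is at most the weight of every stable cut, that is, at most the minimum weight of a stable cut. (For a tree decomposition with polynomially many nodes, and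 an error written with polynomially many bits, the time is $(\mathrm{tw}/\varepsilon)^{O(\mathrm{tw})}(n+\log W)^{O(1)}$. Here $\log W$ is rounded down and read as $0$ for $W=0$; the width, i.e. the maximum bag size minus one, is read as $0$ for the graph without vertices. Time is the number of steps of a machine that works on pointer structures with binary numbers, in which a pointer operation costs one step and an arithmetic operation costs the bit length of its operands; up to a polynomial this is the running time of a Turing machine.) -/

import Mathlib

/-! ### Edge-weighted graphs and cuts

A graph with vertex set `V` carries weights `w : Sym2 V → ℕ`; only the values of `w` on edges are
ever used. A cut, that is, a partition of `V` into two (possibly empty) sides `V₀`, `V₁`, is a map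
`side : V → Bool`. -/

namespace MinStableCut

section Graph

variable {V : Type} [Fintype V]

open Classical in
/-- The weighted degree `d_w(v)`: the total weight of the edges incident on `v`. -/
noncomputable def weightedDegree (G : SimpleGraph V) (w : Sym2 V → ℕ) (v : V) : ℕ :=
  ∑ u : V, if G.Adj v u then w s(v, u) else 0

open Classical in
/-- The total weight of the edges incident on `v` that cross the cut. -/
noncomputable def crossWeight (G : SimpleGraph V) (w : Sym2 V → ℕ) (side : V → Bool) (v : V) : ℕ :=
  ∑ u : V, if G.Adj v u ∧ side u ≠ side v then w s(v, u) else 0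

open Classical in
/-- The weight of a cut: the sum of `w(uv)` over the edges `uv` with `u ∈ V₀` and `v ∈ V₁`. -/
noncomputable def cutWeight (G : SimpleGraph V) (w : Sym2 V → ℕ) (side : V → Bool) : ℕ :=
  ∑ u : V, ∑ v : V, if G.Adj u v ∧ side u = false ∧ side v = true then w s(u, v) else 0

/-- A cut is stable if, for every vertex, at least half of its weighted degree crosses the cut. -/
def IsStable (G : SimpleGraph V) (w : Sym2 V → ℕ) (side : V → Bool) : Prop :=
  ∀ v : V, (weightedDegree G w v : ℚ) / 2 ≤ (crossWeight G w side v : ℚ)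

open Classical in
/-- The maximum weight `W` of an edge (`0` if there are no edges). -/
noncomputable def maxWeight (G : SimpleGraph V) (w : Sym2 V → ℕ) : ℕ :=
  (Finset.univ.filter (fun e : Sym2 V => e ∈ G.edgeSet)).sup w

/-- A tree decomposition of `G` whose tree has the node set `Fin N`. -/
structure TreeDecomposition (G : SimpleGraph V) (N : ℕ) where
  tree : SimpleGraph (Fin N)
  isTree : tree.IsTree
  bag : Fin N → Finset V
  exists_mem_bag : ∀ v : V, ∃ i, v ∈ bag i
  exists_edge_bag : ∀ u v : V, G.Adj u v → ∃ i, u ∈ bag i ∧ v ∈ bag i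
  connected : ∀ v : V, (tree.induce {i | v ∈ bag i}).Connected

/-- The width: the maximum size of a bag, minus one (and `0` if all bags are empty, which happens
only for the graph without vertices). -/
def TreeDecomposition.width {G : SimpleGraph V} {N : ℕ} (D : TreeDecomposition G N) : ℕ :=
  (Finset.univ.sup fun i => (D.bag i).card) - 1

end Graph

/-! ### The machine model

A deterministic machine working on immutable binary trees whose leaves are natural numbers written
in binary: the one-variable WHILE language over trees, with arithmetic at logarithmic cost.
Trees are accessed through pointers, so that forming a pair, taking a component or copying a
reference is one step; an arithmetic operation costs the total bit length of its operands, as on the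
logarithmic-cost RAM. Running times agree with those of multitape Turing machines up to a
polynomial. -/

/-- The data of the machine. -/
inductive Val : Type
  | num : ℕ → Val
  | pair : Val → Val → Val

/-- The programs of the machine. Each program maps the current datum to a new one. -/
inductive Prog : Type
  /-- leave the datum as it is -/
  | id : Prog
  /-- a fixed number -/
  | const : ℕ → Prog
  /-- first component of a pair -/
  | fst : Prog
  /-- second component of a pair -/
  | snd : Prog
  /-- `1` on a pair, `0` on a number -/
  | isPair : Prog
  /-- sum of a pair of numbers -/
  | add : Prog
  /-- truncated difference of a pair of numbers -/
  | sub : Prog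
  /-- product of a pair of numbers -/
  | mul : Prog
  /-- rounded-down quotient of a pair of numbers -/
  | div : Prog
  /-- run both programs on the datum and pair the results -/
  | pair : Prog → Prog → Prog
  /-- `seq p q` runs `p` and then `q` -/
  | seq : Prog → Prog → Prog
  /-- `cond b p q` runs `p` on the datum if `b` yields a nonzero number on it, and `q` if `b` yields
  zero -/
  | cond : Prog → Prog → Prog → Prog
  /-- `loop b p` runs `p` as long as `b` yields a nonzero number on the datum -/
  | loop : Prog → Prog → Prog

/-- `Run p x y t`: on the datum `x`, the program `p` halts with result `y` after exactly `t` steps.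
There is no such `y` and `t` if `p` runs forever or meets an operation that is not defined on its
argument. -/
inductive Run : Prog → Val → Val → ℕ → Prop
  | id (x : Val) : Run Prog.id x x 1
  | const (k : ℕ) (x : Val) : Run (Prog.const k) x (Val.num k) 1
  | fst (x y : Val) : Run Prog.fst (Val.pair x y) x 1
  | snd (x y : Val) : Run Prog.snd (Val.pair x y) y 1
  | isPair_num (k : ℕ) : Run Prog.isPair (Val.num k) (Val.num 0) 1
  | isPair_pair (x y : Val) : Run Prog.isPair (Val.pair x y) (Val.num 1) 1
  | add (a b : ℕ) :
      Run Prog.add (Val.pair (Val.num a) (Val.num b)) (Val.num (a + b)) (a.size + b.size + 1)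
  | sub (a b : ℕ) :
      Run Prog.sub (Val.pair (Val.num a) (Val.num b)) (Val.num (a - b)) (a.size + b.size + 1)
  | mul (a b : ℕ) :
      Run Prog.mul (Val.pair (Val.num a) (Val.num b)) (Val.num (a * b)) (a.size + b.size + 1)
  | div (a b : ℕ) :
      Run Prog.div (Val.pair (Val.num a) (Val.num b)) (Val.num (a / b)) (a.size + b.size + 1)
  | pair {p q : Prog} {x y z : Val} {s t : ℕ} :
      Run p x y s → Run q x z t → Run (Prog.pair p q) x (Val.pair y z) (s + t + 1)
  | seq {p q : Prog} {x y z : Val} {s t : ℕ} :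
      Run p x y s → Run q y z t → Run (Prog.seq p q) x z (s + t + 1)
  | cond_true {b p q : Prog} {x y : Val} {k s t : ℕ} :
      Run b x (Val.num (k + 1)) s → Run p x y t → Run (Prog.cond b p q) x y (s + t + 1)
  | cond_false {b p q : Prog} {x y : Val} {s t : ℕ} :
      Run b x (Val.num 0) s → Run q x y t → Run (Prog.cond b p q) x y (s + t + 1)
  | loop_stop {b p : Prog} {x : Val} {s : ℕ} :
      Run b x (Val.num 0) s → Run (Prog.loop b p) x x (s + 1)
  | loop_step {b p : Prog} {x y z : Val} {k s t r : ℕ} :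
      Run b x (Val.num (k + 1)) s → Run p x y t → Run (Prog.loop b p) y z r →
      Run (Prog.loop b p) x z (s + t + r + 1)

/-! ### Input and output of the algorithm -/

/-- Lists are nested pairs that end in the number `0`. -/
def Val.ofList : List Val → Val
  | [] => Val.num 0
  | x :: l => Val.pair x (Val.ofList l)

open Classical in
/-- Adjacency lists with weights: for each vertex `v` the list of all `(u, w(vu))` with `vu` an
edge. -/
noncomputable def encodeGraph {n : ℕ} (G : SimpleGraph (Fin n)) (w : Sym2 (Fin n) → ℕ) : Val :=
  Val.ofList ((List.finRange n).map fun v =>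
    Val.ofList (((List.finRange n).filter fun u : Fin n => G.Adj v u).map fun u : Fin n =>
      Val.pair (Val.num (u : ℕ)) (Val.num (w s(v, u)))))

open Classical in
/-- For each node of the tree, the list of its neighbours and the list of the vertices in its
bag. -/
noncomputable def encodeDecomposition {n N : ℕ} {G : SimpleGraph (Fin n)}
    (D : TreeDecomposition G N) : Val :=
  Val.ofList ((List.finRange N).map fun i => Val.pair
    (Val.ofList (((List.finRange N).filter fun j : Fin N => D.tree.Adj i j).map fun j : Fin N => Val.num j))
    (Val.ofList (((List.finRange n).filter fun v : Fin n => v ∈ D.bag i).map fun v : Fin n => Val.num v)))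

/-- The input: the numbers of vertices and of nodes, the weighted graph, the tree decomposition, and
the numerator and denominator of the (positive) error `ε`. -/
noncomputable def encodeInput {n N : ℕ} (G : SimpleGraph (Fin n)) (w : Sym2 (Fin n) → ℕ)
    (D : TreeDecomposition G N) (ε : ℚ) : Val :=
  Val.ofList [Val.num n, Val.num N, encodeGraph G w, encodeDecomposition D,
    Val.num ε.num.toNat, Val.num ε.den]

/-- The output: for each vertex, in order, the number `0` or `1` of its side. -/
def encodeCut {n : ℕ} (side : Fin n → Bool) : Val :=
  Val.ofList ((List.finRange n).map fun v => Val.num (side v).toNat)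

/-- The number of bits of a positive rational, written as a numerator and a denominator. -/
def bitLength (ε : ℚ) : ℕ := ε.num.toNat.size + ε.den.size

end MinStableCut


/-!
For a set `F` of nodes of the tree decomposition, a cut inside `F` matters to the rest of the graph
only through its restriction to the boundary of `F`, the vertices with bags both in `F` and outside,
and through the fraction of the weighted degree inside `F` that crosses it at each boundary vertex.
The dynamic program records these fractions on a scale with `q` steps and keeps a cheapest cut for
each key. Storing fractions instead of weights makes the number of keys independent of the weights,
and the weighted average that merges two disjoint sets, rounded down, loses at most one step.

The total loss is therefore at most one step per level of a merging scheme that builds the set of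
all nodes from single nodes. In a depth-first ordering, a heavy-path decomposition yields a scheme
of depth `O(log² N)` whose sets are differences of two intervals and have at most `2 (tw + 1)`
boundary vertices. Hence only `O(N⁴)` sets are needed and `q = O(log² N / ε)` suffices, with
`N⁴ (2 q + 2) ^ O(tw)` keys, where `(log N) ^ O(tw)` is at most `tw ^ O(tw)` times a polynomial
in `N`. A stable cut survives rounding, so the result is no heavier than any of them.
-/

namespace MinStableCut

/-! ### Polynomial bounds -/

/-- Domination by a polynomial: `X` grows at most polynomially in the measure `m`. The summand `2`
makes a single exponent absorb all coefficients. -/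
def PolyBounded {α : Type*} (m X : α → ℕ) : Prop := ∃ c, ∀ a, X a ≤ (m a + 2) ^ c

namespace PolyBounded

variable {α β : Type*} {m X Y : α → ℕ}

theorem mono (hY : PolyBounded m Y) (h : ∀ a, X a ≤ Y a) : PolyBounded m X :=
  hY.imp fun _ hc a => (h a).trans (hc a)

theorem refl (m : α → ℕ) : PolyBounded m m := ⟨1, fun a => by simp⟩

theorem of_le (h : ∀ a, X a ≤ m a) : PolyBounded m X := (refl m).mono h

theorem const (m : α → ℕ) (k : ℕ) : PolyBounded m fun _ => k :=
  ⟨k, fun _ => Nat.lt_two_pow_self.le.trans (Nat.pow_le_pow_left (by omega) k)⟩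

theorem add (hX : PolyBounded m X) (hY : PolyBounded m Y) : PolyBounded m fun a => X a + Y a := by
  obtain ⟨c, hc⟩ := hX
  obtain ⟨d, hd⟩ := hY
  refine ⟨c + d + 1, fun a => ?_⟩
  have hcd : (m a + 2) ^ c ≤ (m a + 2) ^ (c + d) := Nat.pow_le_pow_right (by omega) (by omega)
  have hdc : (m a + 2) ^ d ≤ (m a + 2) ^ (c + d) := Nat.pow_le_pow_right (by omega) (by omega)
  calc X a + Y a ≤ (m a + 2) ^ (c + d) * 2 := by linarith [hc a, hd a]
    _ ≤ (m a + 2) ^ (c + d) * (m a + 2) := Nat.mul_le_mul_left _ (by omega)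
    _ = (m a + 2) ^ (c + d + 1) := (pow_succ _ _).symm

theorem mul (hX : PolyBounded m X) (hY : PolyBounded m Y) : PolyBounded m fun a => X a * Y a := by
  obtain ⟨c, hc⟩ := hX
  obtain ⟨d, hd⟩ := hY
  exact ⟨c + d, fun a => (Nat.mul_le_mul (hc a) (hd a)).trans_eq (pow_add _ _ _).symm⟩

theorem pow (hX : PolyBounded m X) (k : ℕ) : PolyBounded m fun a => X a ^ k := by
  obtain ⟨c, hc⟩ := hX
  exact ⟨c * k, fun a => (Nat.pow_le_pow_left (hc a) k).trans_eq (pow_mul _ _ _).symm⟩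

theorem comp {m' Z : β → ℕ} {f : α → β} (hZ : PolyBounded m' Z)
    (hm : PolyBounded m fun a => m' (f a)) : PolyBounded m fun a => Z (f a) := by
  obtain ⟨c, hc⟩ := hZ
  exact ((hm.add (const m 2)).pow c).mono fun a => hc (f a)

theorem trans {m' : α → ℕ} (hX : PolyBounded m X) (hm : PolyBounded m' m) : PolyBounded m' X :=
  hX.comp (f := fun a => a) hm

end PolyBounded

/-! ### Encodings -/

theorem natSize_le_self (k : ℕ) : k.size ≤ k := Nat.size_le.2 Nat.lt_two_pow_self

theorem natSize_mul_le (a b : ℕ) : (a * b).size ≤ a.size + b.size := by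
  rw [Nat.size_le, pow_add]
  exact Nat.mul_lt_mul'' (Nat.lt_size_self a) (Nat.lt_size_self b)

theorem natSize_add_le (a b : ℕ) : (a + b).size ≤ a.size + b.size := by
  rcases Nat.eq_zero_or_pos a with rfl | ha
  · simp
  rcases Nat.eq_zero_or_pos b with rfl | hb
  · simp
  have two_le : ∀ c : ℕ, 0 < c → 2 ≤ 2 ^ c.size := fun c hc =>
    Nat.le_self_pow (Nat.size_pos.2 hc).ne' 2
  rw [Nat.size_le, pow_add]
  nlinarith [two_le a ha, two_le b hb, Nat.lt_size_self a, Nat.lt_size_self b]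

/-- The number of nodes of a tree plus the number of bits of its leaves. -/
def Val.size : Val → ℕ
  | num k => k.size + 1
  | pair x y => x.size + y.size + 1

/-- Types whose elements are written as data of the machine. No injectivity is asked for: two
values with the same encoding are the same datum to the machine. -/
class Encoding (α : Type*) where
  /-- The datum that represents an element. -/
  encode : α → Val

open Encoding (encode)

/-- The size of the encoding, the standard measure for running times. -/
def encodeSize {α : Type*} [Encoding α] (a : α) : ℕ := (encode a).size

section Encoding

variable {α β : Type*} [Encoding α] [Encoding β]

instance : Encoding ℕ := ⟨Val.num⟩
instance : Encoding Bool := ⟨fun b => Val.num b.toNat⟩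
instance : Encoding (α × β) := ⟨fun p => Val.pair (encode p.1) (encode p.2)⟩
instance : Encoding (List α) := ⟨fun l => Val.ofList (l.map encode)⟩
instance (P : α → Prop) : Encoding {a // P a} := ⟨fun a => encode a.1⟩

theorem encode_nat (k : ℕ) : encode k = Val.num k := rfl
theorem encode_bool (b : Bool) : encode b = Val.num b.toNat := rfl

theorem encodeSize_nat (k : ℕ) : encodeSize k = k.size + 1 := rfl
theorem encodeSize_pair (a : α) (b : β) :
    encodeSize (a, b) = encodeSize a + encodeSize b + 1 := rfl
theorem encodeSize_prod (p : α × β) : encodeSize p = encodeSize p.1 + encodeSize p.2 + 1 := rfl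
theorem encodeSize_nil : encodeSize ([] : List α) = 1 := rfl
theorem encodeSize_cons (a : α) (l : List α) :
    encodeSize (a :: l) = encodeSize a + encodeSize l + 1 := rfl

theorem encodeSize_pos (a : α) : 0 < encodeSize a := by
  unfold encodeSize
  cases encode a <;> simp [Val.size]

theorem encodeSize_nat_mono : Monotone (encodeSize : ℕ → ℕ) := fun _ _ h =>
  Nat.succ_le_succ (Nat.size_le_size h)

theorem encodeSize_nat_le (k : ℕ) : encodeSize k ≤ k + 1 := Nat.succ_le_succ (natSize_le_self k)

theorem encodeSize_append (l l' : List α) :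
    encodeSize (l ++ l') + 1 = encodeSize l + encodeSize l' := by
  induction l with
  | nil => rw [List.nil_append, encodeSize_nil, add_comm]
  | cons a l ih => simp only [List.cons_append, encodeSize_cons]; omega

theorem encodeSize_reverse (l : List α) : encodeSize l.reverse = encodeSize l := by
  induction l with
  | nil => rfl
  | cons a l ih =>
    have := encodeSize_append l.reverse [a]
    simp only [List.reverse_cons, encodeSize_cons, encodeSize_nil] at this ⊢
    omega

theorem encodeSize_take_le (l : List α) (j : ℕ) : encodeSize (l.take j) ≤ encodeSize l := by
  have h := encodeSize_append (l.take j) (l.drop j)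
  rw [List.take_append_drop] at h
  have := encodeSize_pos (l.drop j)
  omega

theorem encodeSize_flatten_le (l : List (List α)) : encodeSize l.flatten ≤ encodeSize l := by
  induction l with
  | nil => exact le_rfl
  | cons x l ih =>
    have := encodeSize_append x l.flatten
    simp only [List.flatten_cons, encodeSize_cons]
    omega

theorem encodeSize_sum_le (l : List ℕ) : encodeSize l.sum ≤ encodeSize l := by
  induction l with
  | nil => exact le_rfl
  | cons a l ih =>
    have := natSize_add_le a l.sum
    simp only [List.sum_cons, encodeSize_cons, encodeSize_nat] at *
    omega

theorem length_lt_encodeSize (l : List α) : l.length < encodeSize l := by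
  induction l with
  | nil => exact Nat.one_pos
  | cons a l ih => simp only [List.length_cons, encodeSize_cons]; omega

theorem encodeSize_lt_of_mem {l : List α} {a : α} (h : a ∈ l) : encodeSize a < encodeSize l := by
  induction h with
  | head => rw [encodeSize_cons]; omega
  | tail _ _ ih => rw [encodeSize_cons]; omega

theorem encodeSize_getD_le (l : List α) (i : ℕ) (d : α) :
    encodeSize (l.getD i d) ≤ encodeSize l + encodeSize d := by
  rcases lt_or_ge i l.length with h | h
  · rw [List.getD_eq_getElem _ _ h]
    exact (encodeSize_lt_of_mem (List.getElem_mem h)).le.trans (Nat.le_add_right _ _)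
  · rw [List.getD_eq_default _ _ h]
    exact Nat.le_add_left _ _

theorem encodeSize_list_le {l : List α} {k B : ℕ} (hl : l.length ≤ k)
    (h : ∀ a ∈ l, encodeSize a ≤ B) : encodeSize l ≤ k * (B + 1) + 1 := by
  induction l generalizing k with
  | nil => rw [encodeSize_nil]; omega
  | cons a l ih =>
    obtain ⟨k, rfl⟩ : ∃ k', k = k' + 1 := ⟨k - 1, by simp at hl; omega⟩
    have ha := h a List.mem_cons_self
    have htail := ih (Nat.le_of_succ_le_succ hl) fun b hb => h b (List.mem_cons_of_mem _ hb)
    rw [encodeSize_cons, add_mul]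
    omega

theorem encodeSize_range_le (k : ℕ) : encodeSize (List.range k) ≤ k * (k + 2) + 1 :=
  encodeSize_list_le List.length_range.le fun a ha =>
    (encodeSize_nat_le a).trans (Nat.succ_le_succ (List.mem_range.1 ha).le)

end Encoding

/-! ### Functions computable in polynomial time -/

/-- Computability in time polynomial in the measure `m`, with an output of polynomial size. -/
def PolyTime {α β : Type*} [Encoding α] [Encoding β] (m : α → ℕ) (f : α → β) : Prop :=
  ∃ (p : Prog) (T : α → ℕ), PolyBounded m T ∧ PolyBounded m (fun a => encodeSize (f a)) ∧
    ∀ a, ∃ t ≤ T a, Run p (encode a) (encode (f a)) t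

/-- The measure of an environment `a : α` extended by one further value. A function of several
variables is treated as a function on nested pairs, each new variable being pushed on the right. -/
def extMeasure {α β : Type*} [Encoding β] (m : α → ℕ) (p : α × β) : ℕ := m p.1 + encodeSize p.2

/-- Measures in which the size of the argument itself is polynomially bounded. -/
class SizeMeasure {α : Type*} [Encoding α] (m : α → ℕ) : Prop where
  polyBounded_encodeSize : PolyBounded m fun a => encodeSize a

section Measure

variable {α β : Type*} [Encoding β] {m : α → ℕ}

theorem PolyBounded.lift {X : α → ℕ} (h : PolyBounded m X) :
    PolyBounded (extMeasure (β := β) m) fun p => X p.1 :=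
  h.comp (.of_le fun _ => Nat.le_add_right _ _)

variable [Encoding α]

instance : SizeMeasure (encodeSize (α := α)) := ⟨.refl _⟩

instance [hm : SizeMeasure m] : SizeMeasure (extMeasure (β := β) m) where
  polyBounded_encodeSize :=
    (hm.polyBounded_encodeSize.lift.add (.of_le (X := fun p : α × β => encodeSize p.2) fun _ =>
      Nat.le_add_left _ _)).add (.const _ 1)

instance [hm : SizeMeasure m] (P : α → Prop) :
    SizeMeasure (m ∘ (Subtype.val : {a // P a} → α)) where
  polyBounded_encodeSize := hm.polyBounded_encodeSize.comp (.refl _)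

end Measure

namespace PolyTime

variable {α β γ : Type*} [Encoding α] [Encoding β] [Encoding γ] {m : α → ℕ}

theorem polyBounded {f : α → β} (hf : PolyTime m f) : PolyBounded m fun a => encodeSize (f a) := by
  obtain ⟨p, T, -, h, -⟩ := hf
  exact h

theorem of_encode_eq [hm : SizeMeasure m] {f : α → β} (h : ∀ a, encode (f a) = encode a) :
    PolyTime m f :=
  ⟨Prog.id, fun _ => 1, .const m 1, hm.polyBounded_encodeSize.mono fun a => by simp [encodeSize, h],
    fun a => ⟨1, le_rfl, by rw [h]; exact Run.id _⟩⟩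

theorem id [SizeMeasure m] : PolyTime m fun a => a := of_encode_eq fun _ => rfl

theorem congr {f g : α → β} (hf : PolyTime m f) (h : ∀ a, g a = f a) : PolyTime m g := by
  rwa [show g = f from funext h]

theorem congr_encode {f : α → β} {g : α → γ} (hf : PolyTime m f)
    (h : ∀ a, encode (g a) = encode (f a)) : PolyTime m g := by
  obtain ⟨p, T, hT, hsize, hrun⟩ := hf
  exact ⟨p, T, hT, hsize.mono fun a => by simp [encodeSize, h], fun a => by rw [h]; exact hrun a⟩

theorem mono_measure {m' : α → ℕ} {f : α → β} (hf : PolyTime m f) (h : PolyBounded m' m) :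
    PolyTime m' f := by
  obtain ⟨p, T, hT, hsize, hrun⟩ := hf
  exact ⟨p, T, hT.trans h, hsize.trans h, hrun⟩

theorem comp_of_polyBounded {m' : β → ℕ} {g : β → γ} {f : α → β} (hg : PolyTime m' g)
    (hf : PolyTime m f) (hm : PolyBounded m fun a => m' (f a)) : PolyTime m fun a => g (f a) := by
  obtain ⟨p, T, hT, hsize, hp⟩ := hg
  obtain ⟨q, U, hU, -, hq⟩ := hf
  refine ⟨q.seq p, fun a => U a + T (f a) + 1, (hU.add (hT.comp hm)).add (.const m 1),
    hsize.comp hm, fun a => ?_⟩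
  obtain ⟨t, ht, hrun_p⟩ := hp (f a)
  obtain ⟨u, hu, hrun_q⟩ := hq a
  exact ⟨u + t + 1, by beta_reduce; omega, Run.seq hrun_q hrun_p⟩

theorem comp {g : β → γ} {f : α → β} (hg : PolyTime encodeSize g) (hf : PolyTime m f) :
    PolyTime m fun a => g (f a) :=
  hg.comp_of_polyBounded hf hf.polyBounded

theorem restrict {f : α → β} (hf : PolyTime m f) (P : α → Prop) :
    PolyTime (m ∘ (Subtype.val : {a // P a} → α)) fun a => f a.1 := by
  obtain ⟨p, T, hT, hsize, hrun⟩ := hf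
  exact ⟨p, fun a => T a.1, hT.comp (.refl _), hsize.comp (.refl _), fun a => hrun a.1⟩

theorem const_nat (k : ℕ) : PolyTime m fun _ => k :=
  ⟨Prog.const k, fun _ => 1, .const m 1, .const m (encodeSize k),
    fun _ => ⟨1, le_rfl, Run.const _ _⟩⟩

theorem nil : PolyTime m fun _ => ([] : List β) := (const_nat 0).congr_encode fun _ => rfl

theorem pair {f : α → β} {g : α → γ} (hf : PolyTime m f) (hg : PolyTime m g) :
    PolyTime m fun a => (f a, g a) := by
  obtain ⟨p, T, hT, hsize_f, hp⟩ := hf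
  obtain ⟨q, U, hU, hsize_g, hq⟩ := hg
  refine ⟨p.pair q, fun a => T a + U a + 1, (hT.add hU).add (.const m 1),
    (hsize_f.add hsize_g).add (.const m 1), fun a => ?_⟩
  obtain ⟨t, ht, hrun_p⟩ := hp a
  obtain ⟨u, hu, hrun_q⟩ := hq a
  exact ⟨t + u + 1, by beta_reduce; omega, Run.pair hrun_p hrun_q⟩

theorem fst {f : α → β × γ} (hf : PolyTime m f) : PolyTime m fun a => (f a).1 :=
  comp ⟨Prog.fst, fun _ => 1, .const _ 1, .of_le fun p => by rw [encodeSize_prod p]; omega,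
    fun _ => ⟨1, le_rfl, Run.fst _ _⟩⟩ hf

theorem snd {f : α → β × γ} (hf : PolyTime m f) : PolyTime m fun a => (f a).2 :=
  comp ⟨Prog.snd, fun _ => 1, .const _ 1, .of_le fun p => by rw [encodeSize_prod p]; omega,
    fun _ => ⟨1, le_rfl, Run.snd _ _⟩⟩ hf

theorem lift {f : α → β} (hf : PolyTime m f) : PolyTime (extMeasure m) fun p : α × γ => f p.1 := by
  obtain ⟨p, T, hT, hsize, hp⟩ := hf
  refine ⟨Prog.fst.seq p, fun a => T a.1 + 2, hT.lift.add (.const _ 2), hsize.lift, fun a => ?_⟩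
  obtain ⟨t, ht, hrun⟩ := hp a.1
  exact ⟨1 + t + 1, by beta_reduce; omega, Run.seq (Run.fst _ _) hrun⟩

theorem last : PolyTime (extMeasure m) fun p : α × γ => p.2 :=
  ⟨Prog.snd, fun _ => 1, .const _ 1, .of_le fun _ => Nat.le_add_left _ _,
    fun _ => ⟨1, le_rfl, Run.snd _ _⟩⟩

theorem cons {f : α → β} {g : α → List β} (hf : PolyTime m f) (hg : PolyTime m g) :
    PolyTime m fun a => f a :: g a := (hf.pair hg).congr_encode fun _ => rfl

/-! #### Arithmetic and tests -/

theorem of_arith {op : ℕ → ℕ → ℕ} (p : Prog)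
    (hrun : ∀ a b, Run p (Val.pair (Val.num a) (Val.num b)) (Val.num (op a b))
      (a.size + b.size + 1))
    (hsize : ∀ a b, (op a b).size ≤ a.size + b.size) {f g : α → ℕ} (hf : PolyTime m f)
    (hg : PolyTime m g) : PolyTime m fun a => op (f a) (g a) := by
  have hop : PolyTime encodeSize fun p : ℕ × ℕ => op p.1 p.2 := by
    refine ⟨p, fun p => p.1.size + p.2.size + 1, .of_le fun p => ?_, .of_le fun p => ?_,
      fun p => ⟨_, le_rfl, hrun _ _⟩⟩
    · rw [encodeSize_prod, encodeSize_nat, encodeSize_nat]; omega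
    · have := hsize p.1 p.2
      beta_reduce
      rw [encodeSize_prod, encodeSize_nat, encodeSize_nat, encodeSize_nat]; omega
  exact hop.comp (hf.pair hg)

section Nat

variable {f g : α → ℕ}

theorem add (hf : PolyTime m f) (hg : PolyTime m g) : PolyTime m fun a => f a + g a :=
  of_arith Prog.add Run.add natSize_add_le hf hg

theorem sub (hf : PolyTime m f) (hg : PolyTime m g) : PolyTime m fun a => f a - g a :=
  of_arith Prog.sub Run.sub
    (fun a b => (Nat.size_le_size (Nat.sub_le a b)).trans (Nat.le_add_right _ _)) hf hg

theorem mul (hf : PolyTime m f) (hg : PolyTime m g) : PolyTime m fun a => f a * g a :=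
  of_arith Prog.mul Run.mul natSize_mul_le hf hg

theorem div (hf : PolyTime m f) (hg : PolyTime m g) : PolyTime m fun a => f a / g a :=
  of_arith Prog.div Run.div
    (fun a b => (Nat.size_le_size (Nat.div_le_self a b)).trans (Nat.le_add_right _ _)) hf hg

end Nat

section Bool

variable {f g : α → Bool}

theorem toNat (hf : PolyTime m f) : PolyTime m fun a => (f a).toNat := hf.congr_encode fun _ => rfl

theorem not (hf : PolyTime m f) : PolyTime m fun a => !f a :=
  ((const_nat 1).sub hf.toNat).congr_encode fun a => by cases f a <;> rfl

theorem and (hf : PolyTime m f) (hg : PolyTime m g) : PolyTime m fun a => f a && g a :=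
  (hf.toNat.mul hg.toNat).congr_encode fun a => by cases f a <;> cases g a <;> rfl

theorem or (hf : PolyTime m f) (hg : PolyTime m g) : PolyTime m fun a => f a || g a :=
  (hf.not.and hg.not).not.congr fun a => by simp

theorem beq (hf : PolyTime m f) (hg : PolyTime m g) : PolyTime m fun a => f a == g a :=
  ((hf.and hg).or (hf.not.and hg.not)).congr fun a => by cases f a <;> cases g a <;> rfl

end Bool

section Nat

variable {f g : α → ℕ}

theorem le (hf : PolyTime m f) (hg : PolyTime m g) : PolyTime m fun a => decide (f a ≤ g a) :=
  ((const_nat 1).sub (hf.sub hg)).congr_encode fun a => by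
    rw [encode_bool, encode_nat]
    by_cases h : f a ≤ g a
    · simp [h]
    · have : 1 - (f a - g a) = 0 := by omega
      simp [h, this]

theorem lt (hf : PolyTime m f) (hg : PolyTime m g) : PolyTime m fun a => decide (f a < g a) :=
  ((hf.add (const_nat 1)).le hg).congr fun _ => rfl

theorem eq (hf : PolyTime m f) (hg : PolyTime m g) : PolyTime m fun a => decide (f a = g a) :=
  ((hf.le hg).and (hg.le hf)).congr fun a => by
    rw [← Bool.decide_and]; exact decide_eq_decide.2 le_antisymm_iff

end Nat

theorem ite_subtype {b : α → Bool} {f : {a // b a = true} → β} {g : {a // b a = false} → β}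
    {r : α → β} (hb : PolyTime m b) (hf : PolyTime (m ∘ Subtype.val) f)
    (hg : PolyTime (m ∘ Subtype.val) g) (hrf : ∀ a (h : b a = true), r a = f ⟨a, h⟩)
    (hrg : ∀ a (h : b a = false), r a = g ⟨a, h⟩) : PolyTime m r := by
  obtain ⟨pb, Tb, hTb, -, hb⟩ := hb
  obtain ⟨pf, Tf, ⟨cf, hTf⟩, ⟨df, hsize_f⟩, hf⟩ := hf
  obtain ⟨pg, Tg, ⟨cg, hTg⟩, ⟨dg, hsize_g⟩, hg⟩ := hg
  have hm : PolyBounded m fun a => m a + 2 := (PolyBounded.refl m).add (.const m 2)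
  refine ⟨pb.cond pf pg, fun a => Tb a + ((m a + 2) ^ cf + (m a + 2) ^ cg) + 1,
    (hTb.add ((hm.pow cf).add (hm.pow cg))).add (.const m 1),
    ((hm.pow df).add (hm.pow dg)).mono fun a => ?_, fun a => ?_⟩
  · cases hba : b a
    · exact hrg a hba ▸ (hsize_g ⟨a, hba⟩).trans (Nat.le_add_left _ _)
    · exact hrf a hba ▸ (hsize_f ⟨a, hba⟩).trans (Nat.le_add_right _ _)
  · obtain ⟨s, hs, hrun_b⟩ := hb a
    cases hba : b a
    · obtain ⟨t, ht, hrun⟩ := hg ⟨a, hba⟩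
      have : Tg ⟨a, hba⟩ ≤ (m a + 2) ^ cg := hTg ⟨a, hba⟩
      rw [hba] at hrun_b
      exact ⟨s + t + 1, by beta_reduce; omega, hrg a hba ▸ Run.cond_false hrun_b hrun⟩
    · obtain ⟨t, ht, hrun⟩ := hf ⟨a, hba⟩
      have : Tf ⟨a, hba⟩ ≤ (m a + 2) ^ cf := hTf ⟨a, hba⟩
      rw [hba] at hrun_b
      exact ⟨s + t + 1, by beta_reduce; omega, hrf a hba ▸ Run.cond_true hrun_b hrun⟩

theorem ite {P : α → Prop} [∀ a, Decidable (P a)] {f g : α → β}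
    (hP : PolyTime m fun a => decide (P a)) (hf : PolyTime m f) (hg : PolyTime m g) :
    PolyTime m fun a => if P a then f a else g a :=
  ite_subtype hP (hf.restrict _) (hg.restrict _) (fun _ h => if_pos (of_decide_eq_true h))
    fun _ h => if_neg (of_decide_eq_false h)

end PolyTime

end MinStableCut

namespace MinStableCut

open Encoding (encode)

/-! ### Loops and list operations -/

section Fold

variable {α γ σ : Type*} [Encoding α] [Encoding γ] [Encoding σ]

/-- The test of a fold loop, whose state consists of an environment, an accumulator and the
remaining list: is the list nonempty? -/
def foldTest : Prog := (Prog.snd.seq Prog.snd).seq Prog.isPair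

/-- The body of a fold loop: `p` is applied to the environment, the accumulator and the head of the
remaining list. -/
def foldBody (p : Prog) : Prog :=
  Prog.fst.pair ((((Prog.fst.pair (Prog.snd.seq Prog.fst)).pair
    ((Prog.snd.seq Prog.snd).seq Prog.fst)).seq p).pair ((Prog.snd.seq Prog.snd).seq Prog.snd))

theorem run_foldTest_nil (a : α) (s : σ) :
    Run foldTest (encode (a, s, ([] : List γ))) (Val.num 0) 5 :=
  Run.seq (Run.seq (Run.snd _ _) (Run.snd _ _)) (Run.isPair_num _)

theorem run_foldTest_cons (a : α) (s : σ) (c : γ) (l : List γ) :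
    Run foldTest (encode (a, s, c :: l)) (Val.num 1) 5 :=
  Run.seq (Run.seq (Run.snd _ _) (Run.snd _ _)) (Run.isPair_pair _ _)

theorem run_foldBody {p : Prog} {a : α} {s s' : σ} {c : γ} {t : ℕ}
    (h : Run p (encode ((a, s), c)) (encode s') t) (l : List γ) :
    Run (foldBody p) (encode (a, s, c :: l)) (encode (a, s', l)) (t + 20) := by
  have hargs := Run.pair (Run.pair (Run.fst _ _) (Run.seq (Run.snd _ _) (Run.fst _ _)))
    (Run.seq (Run.seq (Run.snd (encode a) (encode (s, c :: l))) (Run.snd _ _)) (Run.fst _ _))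
  have hrun : Run (foldBody p) (encode (a, s, c :: l)) (encode (a, s', l)) _ :=
    Run.pair (Run.fst _ _) (Run.pair (Run.seq hargs h)
      (Run.seq (Run.seq (Run.snd _ _) (Run.snd _ _)) (Run.snd _ _)))
  rwa [show 1 + (1 + (1 + 1 + 1) + 1 + (1 + 1 + 1 + 1 + 1) + 1 + t + 1 + (1 + 1 + 1 + 1 + 1) + 1)
    + 1 = t + 20 by omega] at hrun

theorem Run.loop_foldl {p : Prog} {a : α} {f : σ → γ → σ} {B : ℕ} (l : List γ) (s : σ)
    (hp : ∀ j (hj : j < l.length), ∃ t ≤ B, Run p (encode ((a, (l.take j).foldl f s), l[j]))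
      (encode (f ((l.take j).foldl f s) l[j])) t) :
    ∃ t ≤ (l.length + 1) * (B + 26), Run (Prog.loop foldTest (foldBody p)) (encode (a, s, l))
      (encode (a, l.foldl f s, ([] : List γ))) t := by
  induction l generalizing s with
  | nil => exact ⟨6, by rw [List.length_nil]; omega, Run.loop_stop (run_foldTest_nil a s)⟩
  | cons c l ih =>
    obtain ⟨t, ht, hrun⟩ := hp 0 (Nat.succ_pos _)
    obtain ⟨u, hu, hloop⟩ := ih (f s c) fun j hj => hp (j + 1) (Nat.succ_lt_succ hj)
    refine ⟨5 + (t + 20) + u + 1, ?_,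
      Run.loop_step (run_foldTest_cons a s c l) (run_foldBody hrun l) hloop⟩
    rw [List.length_cons, add_mul (l.length + 1) 1]
    omega

end Fold

/-- The body of the loop for `List.range`, which moves from `(k + 1, l)` to `(k, k :: l)`. -/
def rangeBody : Prog :=
  ((Prog.fst.pair (Prog.const 1)).seq Prog.sub).pair
    (((Prog.fst.pair (Prog.const 1)).seq Prog.sub).pair Prog.snd)

theorem Run.loop_range (k : ℕ) (l : List ℕ) :
    ∃ t ≤ (k + 1) * (2 * k + 20), Run (Prog.loop Prog.fst rangeBody) (encode (k, l))
      (encode (0, List.range k ++ l)) t := by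
  induction k generalizing l with
  | zero => exact ⟨2, by omega, Run.loop_stop (Run.fst _ _)⟩
  | succ k ih =>
    obtain ⟨t, ht, hloop⟩ := ih (k :: l)
    have hpred := Run.seq (Run.pair (Run.fst (Val.num (k + 1)) (encode l)) (Run.const 1 _))
      (Run.sub (k + 1) 1)
    have hrun := Run.loop_step (Run.fst (Val.num (k + 1)) (encode l))
      (Run.pair hpred (Run.pair hpred (Run.snd _ _))) hloop
    rw [List.range_succ, List.append_assoc, List.singleton_append]
    refine ⟨_, ?_, hrun⟩
    have hsize := natSize_le_self (k + 1)
    have : (k + 1 + 1) * (2 * (k + 1) + 20) = (k + 1) * (2 * k + 20) + 4 * k + 24 := by ring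
    rw [Nat.size_one]
    omega

-- The counter reaches `1` exactly when the element of index `i` is met.
theorem foldl_countdown {γ : Type*} (l : List γ) (i : ℕ) (d : γ) :
    l.foldl (fun (s : ℕ × γ) c => (s.1 - 1, if s.1 = 1 then c else s.2)) (i + 1, d) =
      (i + 1 - l.length, l.getD i d) := by
  induction l using List.reverseRecOn with
  | nil => rfl
  | append_singleton l c ih =>
    rw [List.foldl_append, ih]
    simp only [List.foldl_cons, List.foldl_nil, List.length_append, List.length_singleton,
      List.getD_eq_getElem?_getD]
    refine Prod.ext (Nat.sub_sub _ _ _) ?_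
    rcases lt_trichotomy i l.length with h | rfl | h
    · rw [if_neg (by omega), List.getElem?_append_left h]
    · rw [if_pos (by omega), List.getElem?_concat_length, Option.getD_some]
    · rw [if_neg (by omega), List.getElem?_eq_none h.le,
        List.getElem?_eq_none (by simpa using h)]

namespace PolyTime

variable {α β γ σ : Type*} [Encoding α] [Encoding β] [Encoding γ] [Encoding σ] {m : α → ℕ}

theorem foldl [SizeMeasure m] {l : α → List γ} {init : α → σ} {f : α → σ → γ → σ} {B : α → ℕ}
    (hl : PolyTime m l) (hinit : PolyTime m init)
    (hf : PolyTime (extMeasure (extMeasure m)) fun q : (α × σ) × γ => f q.1.1 q.1.2 q.2)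
    (hB : PolyBounded m B)
    (hle : ∀ a, ∀ j ≤ (l a).length, encodeSize (((l a).take j).foldl (f a) (init a)) ≤ B a) :
    PolyTime m fun a => (l a).foldl (f a) (init a) := by
  obtain ⟨p, T, ⟨c, hT⟩, -, hp⟩ := hf
  obtain ⟨q, U, hU, -, hq⟩ := id.pair (hinit.pair hl)
  let S : α → ℕ := fun a => (m a + B a + encodeSize (l a) + 2) ^ c
  have hS : PolyBounded m S := ((((PolyBounded.refl m).add hB).add hl.polyBounded).add
    (.const m 2)).pow c
  refine ⟨(q.seq (Prog.loop foldTest (foldBody p))).seq (Prog.snd.seq Prog.fst),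
    fun a => U a + encodeSize (l a) * (S a + 26) + 5,
    (hU.add (hl.polyBounded.mul (hS.add (.const m 26)))).add (.const m 5),
    hB.mono fun a => by simpa using hle a _ le_rfl, fun a => ?_⟩
  obtain ⟨u, hu, hrun_q⟩ := hq a
  obtain ⟨t, ht, hloop⟩ : ∃ t ≤ ((l a).length + 1) * (S a + 26),
      Run (Prog.loop foldTest (foldBody p)) (encode (a, init a, l a))
        (encode (a, (l a).foldl (f a) (init a), ([] : List γ))) t := by
    refine Run.loop_foldl (l a) (init a) fun j hj => ?_
    obtain ⟨t, ht, hrun⟩ := hp ((a, ((l a).take j).foldl (f a) (init a)), (l a)[j])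
    refine ⟨t, (ht.trans (hT _)).trans (Nat.pow_le_pow_left ?_ c), hrun⟩
    have hacc := hle a j hj.le
    have helem := encodeSize_lt_of_mem (List.getElem_mem hj)
    simp only [extMeasure]
    omega
  have hlen : ((l a).length + 1) * (S a + 26) ≤ encodeSize (l a) * (S a + 26) :=
    Nat.mul_le_mul_right _ (length_lt_encodeSize (l a))
  exact ⟨_, by beta_reduce; omega,
    Run.seq (Run.seq hrun_q hloop) (Run.seq (Run.snd _ _) (Run.fst _ _))⟩

theorem range {k : α → ℕ} (hk : PolyTime m k) (hb : PolyBounded m k) :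
    PolyTime m fun a => List.range (k a) := by
  obtain ⟨p, T, hT, -, hp⟩ := hk
  refine ⟨((p.pair (Prog.const 0)).seq (Prog.loop Prog.fst rangeBody)).seq Prog.snd,
    fun a => T a + (k a + 1) * (2 * k a + 20) + 5,
    (hT.add ((hb.add (.const m 1)).mul (((PolyBounded.const m 2).mul hb).add (.const m 20)))).add
      (.const m 5),
    ((hb.mul (hb.add (.const m 2))).add (.const m 1)).mono fun a => encodeSize_range_le _,
    fun a => ?_⟩
  obtain ⟨s, hs, hrun⟩ := hp a
  obtain ⟨t, ht, hloop⟩ := Run.loop_range (k a) []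
  rw [List.append_nil] at hloop
  exact ⟨_, by beta_reduce; omega,
    Run.seq (Run.seq (Run.pair hrun (Run.const 0 _)) hloop) (Run.snd _ _)⟩

theorem iterate [SizeMeasure m] {k : α → ℕ} {init : α → σ} {f : α → σ → σ} {B : α → ℕ}
    (hk : PolyTime m k) (hkb : PolyBounded m k) (hinit : PolyTime m init)
    (hf : PolyTime (extMeasure m) fun q : α × σ => f q.1 q.2) (hB : PolyBounded m B)
    (hle : ∀ a, ∀ j ≤ k a, encodeSize ((f a)^[j] (init a)) ≤ B a) :
    PolyTime m fun a => (f a)^[k a] (init a) := by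
  refine (foldl (f := fun a s _ => f a s) (range hk hkb) hinit hf.lift hB fun a j hj => ?_).congr
    fun a => by rw [List.foldl_const, List.length_range]
  rw [List.length_range] at hj
  rw [List.foldl_const, List.length_take, List.length_range, min_eq_left hj]
  exact hle a j hj

theorem reverse {l : α → List β} (hl : PolyTime m l) : PolyTime m fun a => (l a).reverse := by
  have hrev : PolyTime encodeSize fun l : List β => l.foldl (fun s c => c :: s) [] :=
    foldl (f := fun _ s c => c :: s) id nil (last.cons last.lift) (.refl _) fun l j _ => by
      simp only [List.foldl_flip_cons_eq_append', List.append_nil, encodeSize_reverse]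
      exact encodeSize_take_le l j
  exact (hrev.comp hl).congr fun a => by simp

theorem append {l l' : α → List β} (hl : PolyTime m l) (hl' : PolyTime m l') :
    PolyTime m fun a => l a ++ l' a := by
  have hrev : PolyTime encodeSize fun p : List β × List β => p.1.foldl (fun s c => c :: s) p.2 :=
    foldl (f := fun _ s c => c :: s) id.fst id.snd (last.cons last.lift) (.refl _) fun p j _ => by
      have happ := encodeSize_append (p.1.take j).reverse p.2
      have htake := encodeSize_take_le p.1 j
      rw [List.foldl_flip_cons_eq_append', encodeSize_prod]
      rw [encodeSize_reverse] at happ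
      omega
  exact (hrev.comp (hl.reverse.pair hl')).congr fun a => by simp

theorem map [SizeMeasure m] {l : α → List γ} {f : α → γ → β} (hl : PolyTime m l)
    (hf : PolyTime (extMeasure m) fun q : α × γ => f q.1 q.2) :
    PolyTime m fun a => (l a).map (f a) := by
  obtain ⟨c, hc⟩ := hf.polyBounded
  have hrev : PolyTime m fun a => (l a).foldl (fun s x => f a x :: s) [] := by
    refine foldl (f := fun a s x => f a x :: s)
      (B := fun a => encodeSize (l a) * ((m a + encodeSize (l a) + 2) ^ c + 1) + 1) hl nil ?_ ?_
      fun a j _ => ?_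
    · refine cons (hf.comp_of_polyBounded (f := fun q : (α × List β) × γ => (q.1.1, q.2))
        (id.lift.lift.pair last) (.of_le fun q => ?_)) last.lift
      simp only [extMeasure]
      omega
    · exact (hl.polyBounded.mul (((((PolyBounded.refl m).add hl.polyBounded).add
        (.const m 2)).pow c).add (.const m 1))).add (.const m 1)
    · rw [List.foldl_flip_cons_eq_append, List.append_nil, encodeSize_reverse]
      refine encodeSize_list_le ?_ fun y hy => ?_
      · rw [List.length_map]
        exact (List.length_take_le' _ _).trans (length_lt_encodeSize _).le
      · obtain ⟨x, hx, rfl⟩ := List.mem_map.1 hy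
        have hsize := encodeSize_lt_of_mem (List.mem_of_mem_take hx)
        exact (hc (a, x)).trans (Nat.pow_le_pow_left (by simp only [extMeasure]; omega) _)
  exact hrev.reverse.congr fun a => by simp

theorem flatten {l : α → List (List β)} (hl : PolyTime m l) :
    PolyTime m fun a => (l a).flatten := by
  have hflatten : PolyTime encodeSize fun l : List (List β) => l.foldl (fun s c => s ++ c) [] :=
    foldl (f := fun _ s c => s ++ c) id nil (last.lift.append last) (.refl _) fun l j _ => by
      rw [List.foldl_append_eq_append (f := fun c => c), List.nil_append, List.map_id']
      exact (encodeSize_flatten_le _).trans (encodeSize_take_le l j)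
  exact (hflatten.comp hl).congr fun a => by simp [List.foldl_append_eq_append (f := fun c => c)]

theorem flatMap [SizeMeasure m] {l : α → List γ} {f : α → γ → List β} (hl : PolyTime m l)
    (hf : PolyTime (extMeasure m) fun q : α × γ => f q.1 q.2) :
    PolyTime m fun a => (l a).flatMap (f a) :=
  (map hl hf).flatten

theorem filter [SizeMeasure m] {l : α → List γ} {f : α → γ → Bool} (hl : PolyTime m l)
    (hf : PolyTime (extMeasure m) fun q : α × γ => f q.1 q.2) :
    PolyTime m fun a => (l a).filter (f a) := by
  refine (flatMap (f := fun a c => if f a c then [c] else []) hl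
    (ite (hf.congr fun _ => Bool.decide_eq_true) (last.cons nil) nil)).congr fun a => ?_
  induction l a with
  | nil => rfl
  | cons c l ih => by_cases h : f a c <;> simp [h, ih]

theorem sum {l : α → List ℕ} (hl : PolyTime m l) : PolyTime m fun a => (l a).sum := by
  have hsum : PolyTime encodeSize fun l : List ℕ => l.foldl (fun s c => s + c) 0 :=
    foldl (f := fun _ s c => s + c) id (const_nat 0) (last.lift.add last) (.refl _) fun l j _ => by
      rw [← List.sum_eq_foldl]
      exact (encodeSize_sum_le _).trans (encodeSize_take_le l j)
  exact (hsum.comp hl).congr fun a => List.sum_eq_foldl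

theorem length {l : α → List γ} (hl : PolyTime m l) : PolyTime m fun a => (l a).length := by
  have hlength : PolyTime encodeSize fun l : List γ => (l.map fun _ => 1).sum :=
    (map (f := fun _ _ => 1) id (const_nat 1)).sum
  exact (hlength.comp hl).congr fun a => by simp

theorem any [SizeMeasure m] {l : α → List γ} {f : α → γ → Bool} (hl : PolyTime m l)
    (hf : PolyTime (extMeasure m) fun q : α × γ => f q.1 q.2) :
    PolyTime m fun a => (l a).any (f a) :=
  ((const_nat 0).lt (hl.filter hf).length).congr fun a => by
    rw [Bool.eq_iff_iff]; simp [List.length_pos_iff, List.filter_eq_nil_iff]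

theorem all [SizeMeasure m] {l : α → List γ} {f : α → γ → Bool} (hl : PolyTime m l)
    (hf : PolyTime (extMeasure m) fun q : α × γ => f q.1 q.2) :
    PolyTime m fun a => (l a).all (f a) :=
  (any (f := fun a c => !f a c) hl hf.not).not.congr fun _ => List.all_eq_not_any_not

theorem getD {l : α → List γ} {i : α → ℕ} {d : α → γ} (hl : PolyTime m l) (hi : PolyTime m i)
    (hd : PolyTime m d) : PolyTime m fun a => (l a).getD (i a) (d a) := by
  have hfold : PolyTime encodeSize fun p : List γ × ℕ × γ => p.1.foldl
      (fun (s : ℕ × γ) c => (s.1 - 1, if s.1 = 1 then c else s.2)) (p.2.1 + 1, p.2.2) := by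
    refine foldl (f := fun _ (s : ℕ × γ) c => (s.1 - 1, if s.1 = 1 then c else s.2))
      (B := fun p => 2 * encodeSize p + 2) id.fst ((id.snd.fst.add (const_nat 1)).pair id.snd.snd)
      ((last.lift.fst.sub (const_nat 1)).pair
        ((last.lift.fst.eq (const_nat 1)).ite last last.lift.snd))
      (((PolyBounded.const _ 2).mul (.refl _)).add (.const _ 2)) fun p j _ => ?_
    have hget := encodeSize_getD_le (p.1.take j) p.2.1 p.2.2
    have htake := encodeSize_take_le p.1 j
    have hcount : encodeSize (p.2.1 + 1 - (p.1.take j).length) ≤ encodeSize p.2.1 + 1 := by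
      refine (encodeSize_nat_mono (Nat.sub_le _ _)).trans ?_
      have := natSize_add_le p.2.1 1
      rw [Nat.size_one] at this
      simp only [encodeSize_nat]
      omega
    rw [foldl_countdown, encodeSize_pair, encodeSize_prod p, encodeSize_prod p.2]
    omega
  exact (hfold.comp (hl.pair (hi.pair hd))).snd.congr fun a => by rw [foldl_countdown]

end PolyTime

end MinStableCut

namespace MinStableCut

/-! ### The dynamic program -/

/-- The entry of a list of numbers at an index, `0` beyond its end. Vectors, cuts and sets of nodes
are lists of numbers that are read through this function. -/
def nth (l : List ℕ) (i : ℕ) : ℕ := l.getD i 0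

/-- The list of the first `n` values of a function. -/
def tabulate (n : ℕ) (f : ℕ → ℕ) : List ℕ := (List.range n).map f

theorem nth_tabulate (n : ℕ) (f : ℕ → ℕ) (i : ℕ) :
    nth (tabulate n f) i = if i < n then f i else 0 := by
  unfold nth tabulate
  rw [List.getD_eq_getElem?_getD]
  by_cases h : i < n <;> simp [h]

theorem nth_of_length_le {l : List ℕ} {i : ℕ} (h : l.length ≤ i) : nth l i = 0 :=
  List.getD_eq_default _ _ h

theorem length_tabulate (n : ℕ) (f : ℕ → ℕ) : (tabulate n f).length = n := by simp [tabulate]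

/-- The input of the dynamic program: weighted adjacency lists, the neighbours and the bag of each
node, an ordering of the nodes, a bound on the size of the bags, the number of steps of the scale on
which crossing weights are recorded, and the number of rounds. -/
structure DPData where
  adj : List (List (ℕ × ℕ))
  decomp : List (List ℕ × List ℕ)
  order : List ℕ
  bagBound : ℕ
  scale : ℕ
  rounds : ℕ

/-- An entry of a table: a set of nodes (those of nonzero value), a cut of the vertices in their
bags, and for each vertex `v` a number `score v` such that at least the fraction `score v / scale`
of the weighted degree of `v` inside the set crosses the cut. -/
structure Entry where
  nodes : List ℕ
  cut : List ℕ
  score : List ℕ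

namespace DPData

variable (d : DPData)

/-- The number of vertices. -/
def n : ℕ := d.adj.length

/-- The number of nodes. -/
def N : ℕ := d.decomp.length

/-- The weight of an edge, `0` for non-edges. -/
def weight (u v : ℕ) : ℕ :=
  (((d.adj.getD u []).filter fun e => decide (e.1 = v)).map fun e => e.2).sum

/-- The vertices in the bag of a node. -/
def bag (i : ℕ) : List ℕ := (d.decomp.getD i ([], [])).2

/-- Membership in a bag. -/
def inBag (i v : ℕ) : Bool := (d.bag i).any fun u => decide (u = v)

/-- The node that owns the edge `uv`: the first one whose bag contains `u` and `v`. In this way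
every edge is counted in exactly one set of a partition of the nodes. -/
def owner (u v : ℕ) : ℕ := nth ((List.range d.N).filter fun i => d.inBag i u && d.inBag i v) 0

/-- The weight of `uv` if the edge is owned by a node of `S`. -/
def ownedWeight (S : ℕ → ℕ) (u v : ℕ) : ℕ := if S (d.owner u v) = 0 then 0 else d.weight u v

/-- The weighted degree of `v` inside `S`. -/
def degreeIn (S : ℕ → ℕ) (v : ℕ) : ℕ := ∑ u ∈ Finset.range d.n, d.ownedWeight S v u

/-- The weight of the edges inside `S` that are incident on `v` and cross the cut `x`. -/
def crossingIn (S x : ℕ → ℕ) (v : ℕ) : ℕ :=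
  ∑ u ∈ Finset.range d.n, if x u = x v then 0 else d.ownedWeight S v u

/-- The weight of the cut `x` inside `S`. -/
def cutCost (S x : ℕ → ℕ) : ℕ :=
  ∑ u ∈ Finset.range d.n, ∑ v ∈ Finset.range d.n,
    if x u = 0 ∧ x v ≠ 0 then d.ownedWeight S u v else 0

/-- `v` occurs in a bag of `S`. -/
def occursIn (S : ℕ → ℕ) (v : ℕ) : Bool :=
  (List.range d.N).any fun i => decide (0 < S i) && d.inBag i v

/-- `v` occurs in a bag outside `S`. -/
def occursOutside (S : ℕ → ℕ) (v : ℕ) : Bool :=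
  (List.range d.N).any fun i => decide (S i = 0) && d.inBag i v

/-- `v` is on the boundary of `S`. -/
def isBoundary (S : ℕ → ℕ) (v : ℕ) : Bool := d.occursIn S v && d.occursOutside S v

/-- `S` is a difference of two intervals of the ordering of the nodes. -/
def isIntervalDiff (S : ℕ → ℕ) : Bool :=
  (List.range (d.N + 1)).any fun a => (List.range (d.N + 1)).any fun b =>
    (List.range (d.N + 1)).any fun c => (List.range (d.N + 1)).any fun e =>
      (List.range d.N).all fun i => decide (0 < S (nth d.order i)) ==
        ((decide (a ≤ i) && decide (i < b)) && !(decide (c ≤ i) && decide (i < e)))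

/-- The size of the boundary of `S`. -/
def boundarySize (S : ℕ → ℕ) : ℕ := ((List.range d.n).filter fun v => d.isBoundary S v).length

/-- `S` is one of the sets of nodes for which entries are kept. -/
def admissible (S : ℕ → ℕ) : Bool :=
  d.isIntervalDiff S && decide (d.boundarySize S ≤ 2 * d.bagBound)

/-- The vertices all of whose bags are in `S` are stable up to an error of `rounds + 1` steps of
the scale. -/
def settled (S k : ℕ → ℕ) : Bool :=
  (List.range d.n).all fun v => d.isBoundary S v ||
    decide (d.scale * d.degreeIn S v ≤ 2 * (k v + (d.rounds + 1)) * d.degreeIn S v)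

/-- The entries that are kept in the tables. -/
def good (e : Entry) : Bool := d.admissible (nth e.nodes) && d.settled (nth e.nodes) (nth e.score)

/-- Two entries that need not be distinguished, as they have the same nodes and agree on the
boundary. -/
def sameKey (e e' : Entry) : Bool :=
  ((List.range d.N).all fun i => decide (nth e.nodes i = nth e'.nodes i)) &&
    ((List.range d.n).all fun v => !d.isBoundary (nth e.nodes) v ||
      (decide (nth e.cut v = nth e'.cut v) && decide (nth e.score v = nth e'.score v)))

/-- Two entries that can be merged: the sets of nodes are disjoint, and the cuts agree on the common
vertices. -/
def compatible (e e' : Entry) : Bool :=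
  ((List.range d.N).all fun i => decide (nth e.nodes i = 0) || decide (nth e'.nodes i = 0)) &&
    ((List.range d.n).all fun v => !(d.occursIn (nth e.nodes) v && d.occursIn (nth e'.nodes) v) ||
      decide (nth e.cut v = nth e'.cut v))

/-- The score of a union: the average of two scores weighted with the degrees, rounded down. It is
`0`, being divided by `0`, where both degrees are. -/
def mergeScore (e e' : Entry) (v : ℕ) : ℕ :=
  (nth e.score v * d.degreeIn (nth e.nodes) v + nth e'.score v * d.degreeIn (nth e'.nodes) v) /
    (d.degreeIn (nth e.nodes) v + d.degreeIn (nth e'.nodes) v)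

/-- The entry for the union of the node sets of two entries. -/
def merge (e e' : Entry) : Entry where
  nodes := tabulate d.N fun i => nth e.nodes i + nth e'.nodes i
  cut := tabulate d.n fun v => if nth e.cut v = 0 then nth e'.cut v else nth e.cut v
  score := tabulate d.n (d.mergeScore e e')

/-- All cuts of the vertices in a list. -/
def cutsOn (n : ℕ) (l : List ℕ) : List (List ℕ) :=
  l.foldl (fun acc v => acc ++ acc.map fun x => tabulate n fun u => if u = v then 1 else nth x u)
    [tabulate n fun _ => 0]

/-- The set that consists of one node. -/
def singleNode (i : ℕ) : List ℕ := tabulate d.N fun j => if j = i then 1 else 0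

/-- The entry for a single node and a cut of its bag. -/
def leaf (i : ℕ) (x : List ℕ) : Entry where
  nodes := d.singleNode i
  cut := x
  score := tabulate d.n fun v => d.scale * d.crossingIn (nth (d.singleNode i)) (nth x) v /
    d.degreeIn (nth (d.singleNode i)) v

/-- The entries for the single nodes. -/
def leaves : List Entry :=
  ((List.range d.N).flatMap fun i => (cutsOn d.n (d.bag i)).map (d.leaf i)).filter d.good

/-- Insertion of an entry into a list of entries with distinct keys, only the cheapest one of each
key being kept. -/
def insertCheapest (l : List Entry) (e : Entry) : List Entry :=
  if l.any fun e' => d.sameKey e e' &&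
      decide (d.cutCost (nth e'.nodes) (nth e'.cut) ≤ d.cutCost (nth e.nodes) (nth e.cut)) then l
  else e :: l.filter fun e' => !d.sameKey e e'

/-- For each key of a list of entries, one of the cheapest entries with this key. -/
def prune (l : List Entry) : List Entry := l.foldl d.insertCheapest []

/-- All unions of two entries of a table. -/
def merges (T : List Entry) : List Entry :=
  (T.flatMap fun e => (T.filter (d.compatible e)).map (d.merge e)).filter d.good

/-- One round of the dynamic program. -/
def step (T : List Entry) : List Entry := d.prune (T ++ d.merges T)

/-- The table after `r` rounds. -/
def table (r : ℕ) : List Entry := d.step^[r] (d.prune d.leaves)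

/-- The cut of an entry for the set of all nodes. -/
def output : List ℕ :=
  (((d.table d.rounds).filter fun e =>
    (List.range d.N).all fun i => decide (0 < nth e.nodes i)).getD 0 ⟨[], [], []⟩).cut

/-- The data describe a graph whose edges are covered by the bags. -/
structure Valid : Prop where
  exists_inBag : ∀ u v, d.weight u v ≠ 0 → ∃ i < d.N, d.inBag i u ∧ d.inBag i v
  lt_n : ∀ i v, d.inBag i v → v < d.n

variable {d}

theorem occursIn_iff {S : ℕ → ℕ} {v : ℕ} :
    d.occursIn S v ↔ ∃ i < d.N, 0 < S i ∧ d.inBag i v := by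
  simp [occursIn]

theorem occursOutside_iff {S : ℕ → ℕ} {v : ℕ} :
    d.occursOutside S v ↔ ∃ i < d.N, S i = 0 ∧ d.inBag i v := by
  simp [occursOutside]

theorem isBoundary_iff {S : ℕ → ℕ} {v : ℕ} :
    d.isBoundary S v ↔ d.occursIn S v ∧ d.occursOutside S v := by
  simp [isBoundary]

theorem owner_spec {u v i : ℕ} (hi : i < d.N) (hu : d.inBag i u) (hv : d.inBag i v) :
    d.owner u v < d.N ∧ d.inBag (d.owner u v) u ∧ d.inBag (d.owner u v) v := by
  have hmem : i ∈ (List.range d.N).filter fun i => d.inBag i u && d.inBag i v := by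
    simp [hi, hu, hv]
  have hpos := List.length_pos_of_mem hmem
  have hown : d.owner u v ∈ (List.range d.N).filter fun i => d.inBag i u && d.inBag i v := by
    unfold owner nth
    rw [List.getD_eq_getElem?_getD, List.getElem?_eq_getElem hpos]
    exact List.getElem_mem hpos
  simpa using hown

theorem ownedWeight_ne_zero (hd : d.Valid) {S : ℕ → ℕ} {u v : ℕ} (h : d.ownedWeight S u v ≠ 0) :
    d.occursIn S u ∧ d.occursIn S v := by
  unfold ownedWeight at h
  split_ifs at h with hS
  · exact absurd rfl h
  obtain ⟨i, hi, h1, h2⟩ := hd.exists_inBag u v h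
  obtain ⟨h3, h4, h5⟩ := owner_spec hi h1 h2
  exact ⟨occursIn_iff.2 ⟨_, h3, by omega, h4⟩, occursIn_iff.2 ⟨_, h3, by omega, h5⟩⟩

theorem ownedWeight_eq_weight (hd : d.Valid) {S : ℕ → ℕ} {v : ℕ} (h : ¬ d.occursOutside S v)
    (u : ℕ) :
    d.ownedWeight S v u = d.weight v u := by
  unfold ownedWeight
  split_ifs with hS
  · by_contra hne
    obtain ⟨i, hi, h1, h2⟩ := hd.exists_inBag v u (Ne.symm hne)
    obtain ⟨h3, h4, -⟩ := owner_spec hi h1 h2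
    exact h (occursOutside_iff.2 ⟨_, h3, hS, h4⟩)
  · rfl

theorem ownedWeight_add {S T : ℕ → ℕ} (h : ∀ i, S i = 0 ∨ T i = 0) (u v : ℕ) :
    d.ownedWeight (fun i => S i + T i) u v = d.ownedWeight S u v + d.ownedWeight T u v := by
  unfold ownedWeight
  rcases h (d.owner u v) with h | h <;> simp [h]

theorem degreeIn_eq_zero (hd : d.Valid) {S : ℕ → ℕ} {v : ℕ} (h : ¬ d.occursIn S v) :
    d.degreeIn S v = 0 :=
  Finset.sum_eq_zero fun u _ => by
    by_contra hne
    exact h (ownedWeight_ne_zero hd hne).1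

theorem degreeIn_add {S T : ℕ → ℕ} (h : ∀ i, S i = 0 ∨ T i = 0) (v : ℕ) :
    d.degreeIn (fun i => S i + T i) v = d.degreeIn S v + d.degreeIn T v := by
  unfold degreeIn
  rw [← Finset.sum_add_distrib]
  exact Finset.sum_congr rfl fun u _ => ownedWeight_add h v u

theorem crossingIn_add {S T : ℕ → ℕ} (h : ∀ i, S i = 0 ∨ T i = 0) (x : ℕ → ℕ) (v : ℕ) :
    d.crossingIn (fun i => S i + T i) x v = d.crossingIn S x v + d.crossingIn T x v := by
  unfold crossingIn
  rw [← Finset.sum_add_distrib]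
  refine Finset.sum_congr rfl fun u _ => ?_
  split_ifs
  · rfl
  · exact ownedWeight_add h v u

theorem cutCost_add {S T : ℕ → ℕ} (h : ∀ i, S i = 0 ∨ T i = 0) (x : ℕ → ℕ) :
    d.cutCost (fun i => S i + T i) x = d.cutCost S x + d.cutCost T x := by
  unfold cutCost
  simp only [← Finset.sum_add_distrib]
  refine Finset.sum_congr rfl fun u _ => Finset.sum_congr rfl fun v _ => ?_
  split_ifs
  · exact ownedWeight_add h u v
  · rfl

theorem crossingIn_congr (hd : d.Valid) {S x y : ℕ → ℕ} (h : ∀ u, d.occursIn S u → x u = y u)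
    (v : ℕ) :
    d.crossingIn S x v = d.crossingIn S y v := by
  refine Finset.sum_congr rfl fun u _ => ?_
  by_cases hz : d.ownedWeight S v u = 0
  · simp [hz]
  · obtain ⟨h1, h2⟩ := ownedWeight_ne_zero hd hz
    rw [h u h2, h v h1]

theorem cutCost_congr (hd : d.Valid) {S x y : ℕ → ℕ} (h : ∀ u, d.occursIn S u → x u = y u) :
    d.cutCost S x = d.cutCost S y := by
  refine Finset.sum_congr rfl fun u _ => Finset.sum_congr rfl fun v _ => ?_
  by_cases hz : d.ownedWeight S u v = 0
  · simp [hz]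
  · obtain ⟨h1, h2⟩ := ownedWeight_ne_zero hd hz
    rw [h u h1, h v h2]

theorem crossingIn_le_degreeIn (S x : ℕ → ℕ) (v : ℕ) : d.crossingIn S x v ≤ d.degreeIn S v :=
  Finset.sum_le_sum fun u _ => by split_ifs <;> simp

theorem occursIn_congr {S T : ℕ → ℕ} (h : ∀ i < d.N, S i = T i) (v : ℕ) :
    d.occursIn S v = d.occursIn T v := by
  rw [Bool.eq_iff_iff, occursIn_iff, occursIn_iff]
  exact exists_congr fun i => and_congr_right fun hi => by rw [h i hi]

theorem occursOutside_congr {S T : ℕ → ℕ} (h : ∀ i < d.N, S i = T i) (v : ℕ) :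
    d.occursOutside S v = d.occursOutside T v := by
  rw [Bool.eq_iff_iff, occursOutside_iff, occursOutside_iff]
  exact exists_congr fun i => and_congr_right fun hi => by rw [h i hi]

theorem isBoundary_congr {S T : ℕ → ℕ} (h : ∀ i < d.N, S i = T i) (v : ℕ) :
    d.isBoundary S v = d.isBoundary T v := by
  rw [isBoundary, isBoundary, occursIn_congr h, occursOutside_congr h]

theorem settled_iff {S k : ℕ → ℕ} : d.settled S k ↔ ∀ v < d.n, d.isBoundary S v ∨
    d.scale * d.degreeIn S v ≤ 2 * (k v + (d.rounds + 1)) * d.degreeIn S v := by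
  simp [settled]

theorem good_iff {e : Entry} : d.good e ↔ d.admissible (nth e.nodes) ∧
    d.settled (nth e.nodes) (nth e.score) := by
  simp [good]

theorem sameKey_iff {e e' : Entry} : d.sameKey e e' ↔
    (∀ i < d.N, nth e.nodes i = nth e'.nodes i) ∧ ∀ v < d.n, d.isBoundary (nth e.nodes) v →
      nth e.cut v = nth e'.cut v ∧ nth e.score v = nth e'.score v := by
  simp only [sameKey, Bool.and_eq_true, List.all_eq_true, List.mem_range, decide_eq_true_eq,
    Bool.or_eq_true, Bool.not_eq_true', ← Bool.not_eq_true]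
  exact and_congr_right fun _ => forall₂_congr fun v _ => by tauto

theorem compatible_iff {e e' : Entry} : d.compatible e e' ↔
    (∀ i < d.N, nth e.nodes i = 0 ∨ nth e'.nodes i = 0) ∧ ∀ v < d.n, d.occursIn (nth e.nodes) v →
      d.occursIn (nth e'.nodes) v → nth e.cut v = nth e'.cut v := by
  simp only [compatible, Bool.and_eq_true, List.all_eq_true, List.mem_range, decide_eq_true_eq,
    Bool.or_eq_true, Bool.not_eq_true', ← Bool.not_eq_true]
  exact and_congr_right fun _ => forall₂_congr fun v _ => by tauto

theorem sameKey_refl (e : Entry) : d.sameKey e e := sameKey_iff.2 (by simp)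

theorem sameKey_symm {e e' : Entry} (h : d.sameKey e e') : d.sameKey e' e := by
  rw [sameKey_iff] at *
  refine ⟨fun i hi => (h.1 i hi).symm, fun v hv hB => ?_⟩
  rw [← isBoundary_congr h.1] at hB
  exact ⟨(h.2 v hv hB).1.symm, (h.2 v hv hB).2.symm⟩

theorem sameKey_trans {e e' e'' : Entry} (h : d.sameKey e e')
    (h' : d.sameKey e' e'') : d.sameKey e e'' := by
  rw [sameKey_iff] at *
  refine ⟨fun i hi => (h.1 i hi).trans (h'.1 i hi), fun v hv hB => ?_⟩
  have hB' := hB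
  rw [isBoundary_congr h.1] at hB'
  exact ⟨(h.2 v hv hB).1.trans (h'.2 v hv hB').1, (h.2 v hv hB).2.trans (h'.2 v hv hB').2⟩

theorem mem_of_mem_insertCheapest {l : List Entry} {e e' : Entry} (h : e' ∈ d.insertCheapest l e) :
    e' = e ∨ e' ∈ l := by
  unfold insertCheapest at h
  split_ifs at h
  · exact Or.inr h
  · rcases List.mem_cons.1 h with h | h
    · exact Or.inl h
    · exact Or.inr (List.mem_of_mem_filter h)

/-- `e'` has the key of `e` and costs no more. -/
def Dominates (d : DPData) (e' e : Entry) : Prop :=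
  d.sameKey e e' ∧ d.cutCost (nth e'.nodes) (nth e'.cut) ≤ d.cutCost (nth e.nodes) (nth e.cut)

theorem Dominates.trans {e e' e'' : Entry} (h : d.Dominates e'' e') (h' : d.Dominates e' e) :
    d.Dominates e'' e := ⟨sameKey_trans h'.1 h.1, h.2.trans h'.2⟩

theorem exists_mem_insertCheapest_self (l : List Entry) (e : Entry) :
    ∃ e' ∈ d.insertCheapest l e, d.Dominates e' e := by
  unfold insertCheapest
  split_ifs with h
  · obtain ⟨e', he', h⟩ := List.any_eq_true.1 h
    simp only [Bool.and_eq_true, decide_eq_true_eq] at h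
    exact ⟨e', he', h⟩
  · exact ⟨e, by simp, sameKey_refl e, le_rfl⟩

theorem exists_mem_insertCheapest {l : List Entry} (e : Entry) {e' : Entry} (he' : e' ∈ l) :
    ∃ e'' ∈ d.insertCheapest l e, d.Dominates e'' e' := by
  unfold insertCheapest
  split_ifs with h
  · exact ⟨e', he', sameKey_refl e', le_rfl⟩
  · by_cases hk : d.sameKey e e'
    · refine ⟨e, by simp, sameKey_symm hk, ?_⟩
      by_contra hlt
      refine h (List.any_eq_true.2 ⟨e', he', ?_⟩)
      simp only [Bool.and_eq_true, decide_eq_true_eq]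
      exact ⟨hk, by omega⟩
    · exact ⟨e', by simp [he', hk], sameKey_refl e', le_rfl⟩

theorem pairwise_insertCheapest {l : List Entry} (h : l.Pairwise fun e e' => ¬ d.sameKey e e')
    (e : Entry) : (d.insertCheapest l e).Pairwise fun e e' => ¬ d.sameKey e e' := by
  unfold insertCheapest
  split_ifs
  · exact h
  · refine List.pairwise_cons.2 ⟨fun e' he' => ?_, h.filter _⟩
    simpa using (List.mem_filter.1 he').2

theorem prune_append_singleton (l : List Entry) (e : Entry) :
    d.prune (l ++ [e]) = d.insertCheapest (d.prune l) e := by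
  simp [prune]

theorem mem_of_mem_prune {l : List Entry} {e : Entry} (h : e ∈ d.prune l) : e ∈ l := by
  induction l using List.reverseRecOn with
  | nil => simp [prune] at h
  | append_singleton l a ih =>
    rw [prune_append_singleton] at h
    rcases mem_of_mem_insertCheapest h with rfl | h
    · simp
    · simp [ih h]

theorem exists_mem_prune {l : List Entry} {e : Entry} (h : e ∈ l) :
    ∃ e' ∈ d.prune l, d.Dominates e' e := by
  induction l using List.reverseRecOn with
  | nil => simp at h
  | append_singleton l a ih =>
    rw [prune_append_singleton]
    rcases List.mem_append.1 h with h | h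
    · obtain ⟨e', he', hd'⟩ := ih h
      obtain ⟨e'', he'', hd''⟩ := exists_mem_insertCheapest a he'
      exact ⟨e'', he'', hd''.trans hd'⟩
    · obtain rfl : e = a := by simpa using h
      exact exists_mem_insertCheapest_self _ _

theorem pairwise_prune (l : List Entry) :
    (d.prune l).Pairwise fun e e' => ¬ d.sameKey e e' := by
  induction l using List.reverseRecOn with
  | nil => simp [prune]
  | append_singleton l a ih =>
    rw [prune_append_singleton]
    exact pairwise_insertCheapest ih a

theorem table_succ (r : ℕ) : d.table (r + 1) = d.step (d.table r) :=
  Function.iterate_succ_apply' _ _ _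

theorem pairwise_table (r : ℕ) : (d.table r).Pairwise fun e e' => ¬ d.sameKey e e' := by
  cases r with
  | zero => exact pairwise_prune _
  | succ r => rw [table_succ]; exact pairwise_prune _

end DPData

end MinStableCut

namespace MinStableCut

namespace DPData

variable {d : DPData}

/-- The entry describes a cut of the vertices in the bags of its set of nodes. -/
structure WellFormed (d : DPData) (e : Entry) : Prop where
  length_nodes : e.nodes.length = d.N
  length_cut : e.cut.length = d.n
  length_score : e.score.length = d.n
  nodes_le_one : ∀ i, nth e.nodes i ≤ 1
  cut_le_one : ∀ v, nth e.cut v ≤ 1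
  cut_eq_zero : ∀ v, ¬ d.occursIn (nth e.nodes) v → nth e.cut v = 0
  score_le : ∀ v, nth e.score v ≤ d.scale
  score_mul_le : ∀ v, nth e.score v * d.degreeIn (nth e.nodes) v ≤
    d.scale * d.crossingIn (nth e.nodes) (nth e.cut) v
  good : d.good e

theorem nth_merge_nodes {e e' : Entry} (h : e.nodes.length = d.N) (h' : e'.nodes.length = d.N) :
    nth (d.merge e e').nodes = fun i => nth e.nodes i + nth e'.nodes i := by
  funext i
  simp only [merge, nth_tabulate]
  split_ifs with hi
  · rfl
  · rw [nth_of_length_le (by omega), nth_of_length_le (by omega)]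

theorem nth_merge_cut {e e' : Entry} (h : e.cut.length = d.n) (h' : e'.cut.length = d.n) (v : ℕ) :
    nth (d.merge e e').cut v =
      if nth e.cut v = 0 then nth e'.cut v else nth e.cut v := by
  simp only [merge, nth_tabulate]
  split_ifs with hi h1 h1
  · rfl
  · rfl
  · rw [nth_of_length_le (by omega)]
  · exact absurd (nth_of_length_le (by omega)) h1

section Merge

variable {e e' : Entry}

theorem WellFormed.disjoint (he : d.WellFormed e) (hc : d.compatible e e') (i : ℕ) :
    nth e.nodes i = 0 ∨ nth e'.nodes i = 0 := by
  by_cases hi : i < d.N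
  · exact (compatible_iff.1 hc).1 i hi
  · exact Or.inl (nth_of_length_le (by rw [he.length_nodes]; omega))

theorem WellFormed.merge_cut_left (hd : d.Valid) (he : d.WellFormed e) (he' : d.WellFormed e')
    (hc : d.compatible e e') {v : ℕ} (hv : d.occursIn (nth e.nodes) v) :
    nth (d.merge e e').cut v = nth e.cut v := by
  rw [nth_merge_cut he.length_cut he'.length_cut]
  split_ifs with h
  · obtain ⟨i, -, -, hi⟩ := occursIn_iff.1 hv
    by_cases hv' : d.occursIn (nth e'.nodes) v
    · exact ((compatible_iff.1 hc).2 v (hd.lt_n i v hi) hv hv').symm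
    · rw [he'.cut_eq_zero v hv', h]
  · rfl

theorem WellFormed.merge_cut_right (hd : d.Valid) (he : d.WellFormed e) (he' : d.WellFormed e')
    (hc : d.compatible e e') {v : ℕ} (hv : d.occursIn (nth e'.nodes) v) :
    nth (d.merge e e').cut v = nth e'.cut v := by
  rw [nth_merge_cut he.length_cut he'.length_cut]
  split_ifs with h
  · rfl
  · obtain ⟨i, -, -, hi⟩ := occursIn_iff.1 hv
    by_cases hv' : d.occursIn (nth e.nodes) v
    · exact (compatible_iff.1 hc).2 v (hd.lt_n i v hi) hv' hv
    · exact absurd (he.cut_eq_zero v hv') h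

theorem WellFormed.crossingIn_merge (hd : d.Valid) (he : d.WellFormed e) (he' : d.WellFormed e')
    (hc : d.compatible e e') (v : ℕ) :
    d.crossingIn (nth (d.merge e e').nodes) (nth (d.merge e e').cut) v =
      d.crossingIn (nth e.nodes) (nth e.cut) v + d.crossingIn (nth e'.nodes) (nth e'.cut) v := by
  rw [nth_merge_nodes he.length_nodes he'.length_nodes, crossingIn_add (he.disjoint hc),
    crossingIn_congr hd fun u hu => he.merge_cut_left hd he' hc hu,
    crossingIn_congr hd fun u hu => he.merge_cut_right hd he' hc hu]

theorem WellFormed.cutCost_merge (hd : d.Valid) (he : d.WellFormed e) (he' : d.WellFormed e')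
    (hc : d.compatible e e') :
    d.cutCost (nth (d.merge e e').nodes) (nth (d.merge e e').cut) =
      d.cutCost (nth e.nodes) (nth e.cut) + d.cutCost (nth e'.nodes) (nth e'.cut) := by
  rw [nth_merge_nodes he.length_nodes he'.length_nodes, cutCost_add (he.disjoint hc),
    cutCost_congr hd fun u hu => he.merge_cut_left hd he' hc hu,
    cutCost_congr hd fun u hu => he.merge_cut_right hd he' hc hu]

theorem WellFormed.degreeIn_merge (he : d.WellFormed e) (he' : d.WellFormed e')
    (hc : d.compatible e e') (v : ℕ) :
    d.degreeIn (nth (d.merge e e').nodes) v =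
      d.degreeIn (nth e.nodes) v + d.degreeIn (nth e'.nodes) v := by
  rw [nth_merge_nodes he.length_nodes he'.length_nodes, degreeIn_add (he.disjoint hc)]

theorem occursIn_add {S T : ℕ → ℕ} {v : ℕ} :
    d.occursIn (fun i => S i + T i) v ↔ d.occursIn S v ∨ d.occursIn T v := by
  simp only [occursIn_iff]
  constructor
  · rintro ⟨i, hi, h, hb⟩
    rcases Nat.eq_zero_or_pos (S i) with h0 | h0
    · exact Or.inr ⟨i, hi, by omega, hb⟩
    · exact Or.inl ⟨i, hi, h0, hb⟩
  · rintro (⟨i, hi, h, hb⟩ | ⟨i, hi, h, hb⟩) <;> exact ⟨i, hi, by omega, hb⟩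

theorem WellFormed.mergeScore_le (he : d.WellFormed e) (he' : d.WellFormed e') (v : ℕ) :
    d.mergeScore e e' v ≤ d.scale := by
  refine Nat.div_le_of_le_mul ?_
  rw [add_mul, mul_comm (nth e.score v), mul_comm (nth e'.score v)]
  gcongr
  · exact he.score_le v
  · exact he'.score_le v

theorem WellFormed.mergeScore_mul_le (hd : d.Valid) (he : d.WellFormed e) (he' : d.WellFormed e')
    (hc : d.compatible e e') (v : ℕ) :
    d.mergeScore e e' v * d.degreeIn (nth (d.merge e e').nodes) v ≤
      d.scale * d.crossingIn (nth (d.merge e e').nodes) (nth (d.merge e e').cut) v := by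
  rw [he.degreeIn_merge he' hc, he.crossingIn_merge hd he' hc, mul_add d.scale]
  exact (Nat.div_mul_le_self _ _).trans (Nat.add_le_add (he.score_mul_le v) (he'.score_mul_le v))

theorem WellFormed.merge (hd : d.Valid) (he : d.WellFormed e) (he' : d.WellFormed e')
    (hc : d.compatible e e') (hg : d.good (d.merge e e')) :
    d.WellFormed (d.merge e e') where
  length_nodes := length_tabulate _ _
  length_cut := length_tabulate _ _
  length_score := length_tabulate _ _
  nodes_le_one i := by
    rw [nth_merge_nodes he.length_nodes he'.length_nodes]
    have h1 := he.nodes_le_one i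
    have h2 := he'.nodes_le_one i
    have := he.disjoint hc i
    beta_reduce
    omega
  cut_le_one v := by
    rw [nth_merge_cut he.length_cut he'.length_cut]
    split_ifs
    · exact he'.cut_le_one v
    · exact he.cut_le_one v
  cut_eq_zero v hv := by
    rw [nth_merge_nodes he.length_nodes he'.length_nodes, occursIn_add, not_or] at hv
    rw [nth_merge_cut he.length_cut he'.length_cut, he.cut_eq_zero v hv.1, he'.cut_eq_zero v hv.2]
    simp
  score_le v := by
    simp only [DPData.merge, nth_tabulate]
    split_ifs
    · exact he.mergeScore_le he' v
    · exact Nat.zero_le _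
  score_mul_le v := by
    simp only [DPData.merge, nth_tabulate]
    split_ifs
    · exact he.mergeScore_mul_le hd he' hc v
    · simp
  good := hg

end Merge

theorem mem_cutsOn {n : ℕ} {l : List ℕ} {x : List ℕ} (h : x ∈ cutsOn n l) :
    x.length = n ∧ (∀ v, nth x v ≤ 1) ∧ ∀ v ∉ l, nth x v = 0 := by
  induction l using List.reverseRecOn generalizing x with
  | nil =>
    obtain rfl : x = tabulate n fun _ => 0 := by simpa [cutsOn] using h
    exact ⟨length_tabulate _ _, by simp [nth_tabulate], by simp [nth_tabulate]⟩
  | append_singleton l a ih =>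
    simp only [cutsOn, List.foldl_append, List.foldl_cons, List.foldl_nil] at h
    rcases List.mem_append.1 h with h | h
    · obtain ⟨h1, h2, h3⟩ := ih h
      exact ⟨h1, h2, fun v hv => h3 v fun hv' => hv (by simp [hv'])⟩
    · obtain ⟨y, hy, rfl⟩ := List.mem_map.1 h
      obtain ⟨-, h2, h3⟩ := ih hy
      refine ⟨length_tabulate _ _, fun v => ?_, fun v hv => ?_⟩
      · rw [nth_tabulate]
        split_ifs
        · exact le_rfl
        · exact h2 v
        · omega
      · simp only [List.mem_append, List.mem_singleton, not_or] at hv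
        rw [nth_tabulate, if_neg hv.2, h3 v hv.1, ite_self]

theorem exists_mem_cutsOn {n : ℕ} {l : List ℕ} (hl : ∀ v ∈ l, v < n) {σ : ℕ → ℕ}
    (hσ : ∀ v, σ v ≤ 1) : ∃ x ∈ cutsOn n l, ∀ v, nth x v = if v ∈ l then σ v else 0 := by
  induction l using List.reverseRecOn with
  | nil => exact ⟨tabulate n fun _ => 0, by simp [cutsOn], by simp [nth_tabulate]⟩
  | append_singleton l a ih =>
    obtain ⟨x, hx, h⟩ := ih fun v hv => hl v (by simp [hv])
    simp only [cutsOn, List.foldl_append, List.foldl_cons, List.foldl_nil]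
    rcases Nat.le_one_iff_eq_zero_or_eq_one.1 (hσ a) with h0 | h1
    · refine ⟨x, List.mem_append_left _ hx, fun v => ?_⟩
      rw [h]
      by_cases hva : v = a
      · simp [hva, h0]
      · simp [hva]
    · refine ⟨_, List.mem_append_right _ (List.mem_map.2 ⟨x, hx, rfl⟩), fun v => ?_⟩
      rw [nth_tabulate]
      by_cases hva : v = a
      · simp [hva, h1, hl a (by simp)]
      · simp only [hva, if_false, h, List.mem_append, List.mem_singleton, or_false]
        split_ifs with h2 h3 h3
        · rfl
        · rfl
        · exact absurd (hl v (by simp [h3])) h2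
        · rfl

/-- The indicator function of a set of nodes, in the form in which entries store such sets. -/
def indicator (F : Finset ℕ) (i : ℕ) : ℕ := if i ∈ F then 1 else 0

theorem indicator_pos {F : Finset ℕ} {i : ℕ} : 0 < indicator F i ↔ i ∈ F := by
  unfold indicator
  split_ifs <;> simp_all

theorem indicator_eq_zero {F : Finset ℕ} {i : ℕ} : indicator F i = 0 ↔ i ∉ F := by
  unfold indicator
  split_ifs <;> simp_all

theorem nth_singleNode {i : ℕ} (hi : i < d.N) : nth (d.singleNode i) = indicator {i} := by
  funext j
  simp only [singleNode, nth_tabulate, indicator, Finset.mem_singleton]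
  split_ifs with h1 h2 h2 <;> first | rfl | omega

theorem inBag_iff {i v : ℕ} : d.inBag i v ↔ v ∈ d.bag i := by simp [inBag]

theorem occursIn_singleNode {i v : ℕ} (hi : i < d.N) :
    d.occursIn (nth (d.singleNode i)) v ↔ v ∈ d.bag i := by
  rw [nth_singleNode hi, occursIn_iff, ← inBag_iff]
  constructor
  · rintro ⟨j, -, h, hb⟩
    obtain rfl : j = i := by simpa [indicator_pos] using h
    exact hb
  · exact fun h => ⟨i, hi, by simp [indicator_pos], h⟩

theorem WellFormed.leaf {i : ℕ} (hi : i < d.N) {x : List ℕ} (hx : x ∈ cutsOn d.n (d.bag i))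
    (hg : d.good (d.leaf i x)) : d.WellFormed (d.leaf i x) where
  length_nodes := length_tabulate _ _
  length_cut := (mem_cutsOn hx).1
  length_score := length_tabulate _ _
  nodes_le_one j := by
    simp only [DPData.leaf, singleNode, nth_tabulate]
    split_ifs <;> omega
  cut_le_one := (mem_cutsOn hx).2.1
  cut_eq_zero v hv := (mem_cutsOn hx).2.2 v fun h => hv ((occursIn_singleNode hi).2 h)
  score_le v := by
    simp only [DPData.leaf, nth_tabulate]
    split_ifs
    · refine Nat.div_le_of_le_mul ?_
      rw [mul_comm]
      exact Nat.mul_le_mul_right _ (crossingIn_le_degreeIn _ _ _)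
    · omega
  score_mul_le v := by
    simp only [DPData.leaf]
    rw [nth_tabulate]
    split_ifs
    · exact Nat.div_mul_le_self _ _
    · simp
  good := hg

theorem wellFormed_of_mem_leaves {e : Entry} (h : e ∈ d.leaves) : d.WellFormed e := by
  obtain ⟨h, hg⟩ := List.mem_filter.1 h
  obtain ⟨i, hi, h⟩ := List.mem_flatMap.1 h
  obtain ⟨x, hx, rfl⟩ := List.mem_map.1 h
  exact .leaf (List.mem_range.1 hi) hx hg

theorem wellFormed_of_mem_step (hd : d.Valid) {T : List Entry} (hT : ∀ e ∈ T, d.WellFormed e)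
    {e : Entry} (h : e ∈ T ++ d.merges T) : d.WellFormed e := by
  rcases List.mem_append.1 h with h | h
  · exact hT e h
  · obtain ⟨h, hg⟩ := List.mem_filter.1 h
    obtain ⟨e₁, h₁, h⟩ := List.mem_flatMap.1 h
    obtain ⟨e₂, h₂, rfl⟩ := List.mem_map.1 h
    obtain ⟨h₂, hc⟩ := List.mem_filter.1 h₂
    exact (hT e₁ h₁).merge hd (hT e₂ h₂) hc hg

theorem wellFormed_of_mem_table (hd : d.Valid) {r : ℕ} {e : Entry} (h : e ∈ d.table r) :
    d.WellFormed e := by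
  induction r generalizing e with
  | zero => exact wellFormed_of_mem_leaves (mem_of_mem_prune h)
  | succ r ih =>
    rw [table_succ] at h
    exact wellFormed_of_mem_step hd (fun e he => ih he) (mem_of_mem_prune h)

end DPData

end MinStableCut

namespace MinStableCut

namespace DPData

variable {d : DPData}

/-- The sets of nodes that arise from single nodes by disjoint unions, nested to a height of at most
`h`, through admissible sets only. Single nodes have height `1`. -/
inductive Derivable (d : DPData) : Finset ℕ → ℕ → Prop
  | leaf (i : ℕ) : i < d.N → d.admissible (indicator {i}) → Derivable d {i} 1
  | merge {F F' : Finset ℕ} {h : ℕ} : Derivable d F h → Derivable d F' h → Disjoint F F' →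
      d.admissible (indicator (F ∪ F')) → Derivable d (F ∪ F') (h + 1)
  | succ {F : Finset ℕ} {h : ℕ} : Derivable d F h → Derivable d F (h + 1)

theorem Derivable.mono {F : Finset ℕ} {h h' : ℕ} (hF : d.Derivable F h) (hh : h ≤ h') :
    d.Derivable F h' := by
  induction hh with
  | refl => exact hF
  | step _ ih => exact ih.succ

theorem Derivable.pos {F : Finset ℕ} {h : ℕ} (hF : d.Derivable F h) : 1 ≤ h := by
  induction hF <;> omega

/-- The weighted degree of `v` in the graph. -/
def totalDegree (d : DPData) (v : ℕ) : ℕ := ∑ u ∈ Finset.range d.n, d.weight v u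

/-- The weight of the edges incident on `v` that cross the cut `x`. -/
def totalCrossing (d : DPData) (x : ℕ → ℕ) (v : ℕ) : ℕ :=
  ∑ u ∈ Finset.range d.n, if x u = x v then 0 else d.weight v u

/-- The weight of the cut `x`. -/
def totalCost (d : DPData) (x : ℕ → ℕ) : ℕ :=
  ∑ u ∈ Finset.range d.n, ∑ v ∈ Finset.range d.n, if x u = 0 ∧ x v ≠ 0 then d.weight u v else 0

/-- `σ` is a stable cut, with `0` and `1` as its sides. -/
def Stable (d : DPData) (σ : ℕ → ℕ) : Prop :=
  (∀ v, σ v ≤ 1) ∧ ∀ v, d.totalDegree v ≤ 2 * d.totalCrossing σ v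

/-- The entry `e` stands for the restriction of the cut `σ` to `F`: it agrees with `σ` on the
boundary of `F`, its scores there fall short of the true ones by at most one step of the scale per
round, and it costs no more than `σ`. -/
structure Approximates (d : DPData) (σ : ℕ → ℕ) (r : ℕ) (F : Finset ℕ) (e : Entry) : Prop where
  nodes_eq : nth e.nodes = indicator F
  cut_eq : ∀ v, d.isBoundary (indicator F) v → nth e.cut v = σ v
  le_score : ∀ v, d.isBoundary (indicator F) v →
    d.scale * d.crossingIn (indicator F) σ v ≤
      (nth e.score v + (r + 1)) * d.degreeIn (indicator F) v
  cost_le : d.cutCost (indicator F) (nth e.cut) ≤ d.cutCost (indicator F) σ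

/-- After `r` rounds the table contains an entry that stands for the restriction of `σ` to `F`. -/
def Tracks (d : DPData) (σ : ℕ → ℕ) (r : ℕ) (F : Finset ℕ) : Prop :=
  ∃ e ∈ d.table r, d.Approximates σ r F e

theorem lt_n_of_isBoundary (hd : d.Valid) {S : ℕ → ℕ} {v : ℕ} (h : d.isBoundary S v) :
    v < d.n := by
  obtain ⟨i, -, -, hi⟩ := occursIn_iff.1 (isBoundary_iff.1 h).1
  exact hd.lt_n i v hi

theorem degreeIn_eq_totalDegree (hd : d.Valid) {S : ℕ → ℕ} {v : ℕ} (h : ¬ d.occursOutside S v) :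
    d.degreeIn S v = d.totalDegree v :=
  Finset.sum_congr rfl fun u _ => ownedWeight_eq_weight hd h u

theorem crossingIn_eq_totalCrossing (hd : d.Valid) {S : ℕ → ℕ} (x : ℕ → ℕ) {v : ℕ}
    (h : ¬ d.occursOutside S v) : d.crossingIn S x v = d.totalCrossing x v :=
  Finset.sum_congr rfl fun u _ => by rw [ownedWeight_eq_weight hd h u]

theorem crossingIn_eq_zero (hd : d.Valid) {S : ℕ → ℕ} (x : ℕ → ℕ) {v : ℕ}
    (h : ¬ d.occursIn S v) : d.crossingIn S x v = 0 :=
  Nat.eq_zero_of_le_zero ((crossingIn_le_degreeIn S x v).trans_eq (degreeIn_eq_zero hd h))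

theorem Approximates.tracks (hd : d.Valid) {σ : ℕ → ℕ} {r : ℕ} {F : Finset ℕ} {e : Entry}
    (h : d.Approximates σ r F e) {T : List Entry} (hT : d.table r = d.prune T)
    (hok : ∀ e ∈ T, d.WellFormed e) (he : e ∈ T) : d.Tracks σ r F := by
  obtain ⟨e', he', hk, hle⟩ := exists_mem_prune (d := d) he
  have hok' := hok e' (mem_of_mem_prune he')
  obtain ⟨h1, h2⟩ := sameKey_iff.1 hk
  have hnodes : nth e'.nodes = indicator F := by
    rw [← h.nodes_eq]
    funext i
    by_cases hi : i < d.N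
    · exact (h1 i hi).symm
    · rw [nth_of_length_le (by rw [hok'.length_nodes]; omega),
        nth_of_length_le (by rw [(hok e he).length_nodes]; omega)]
  have hkey : ∀ v, d.isBoundary (indicator F) v →
      nth e.cut v = nth e'.cut v ∧ nth e.score v = nth e'.score v := fun v hv =>
    h2 v (lt_n_of_isBoundary hd hv) (by rwa [h.nodes_eq])
  rw [h.nodes_eq, hnodes] at hle
  refine ⟨e', hT ▸ he', hnodes, fun v hv => ?_, fun v hv => ?_, hle.trans h.cost_le⟩
  · rw [← (hkey v hv).1]
    exact h.cut_eq v hv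
  · rw [← (hkey v hv).2]
    exact h.le_score v hv

theorem Stable.scale_mul_degreeIn_le (hd : d.Valid) {σ : ℕ → ℕ} (hσ : d.Stable σ) {S : ℕ → ℕ}
    {k v : ℕ} (hB : ¬ d.isBoundary S v)
    (h : d.scale * d.crossingIn S σ v ≤ (k + (d.rounds + 1)) * d.degreeIn S v) :
    d.scale * d.degreeIn S v ≤ 2 * (k + (d.rounds + 1)) * d.degreeIn S v := by
  by_cases hV : d.occursIn S v
  · have ho : ¬ d.occursOutside S v := fun ho => hB (isBoundary_iff.2 ⟨hV, ho⟩)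
    have hhalf : d.degreeIn S v ≤ 2 * d.crossingIn S σ v := by
      rw [degreeIn_eq_totalDegree hd ho, crossingIn_eq_totalCrossing hd σ ho]
      exact hσ.2 v
    calc d.scale * d.degreeIn S v ≤ d.scale * (2 * d.crossingIn S σ v) :=
          Nat.mul_le_mul_left _ hhalf
      _ = 2 * (d.scale * d.crossingIn S σ v) := by ring
      _ ≤ 2 * ((k + (d.rounds + 1)) * d.degreeIn S v) := Nat.mul_le_mul_left _ h
      _ = _ := by ring
  · simp [degreeIn_eq_zero hd hV]

theorem le_leaf_score (hd : d.Valid) {i : ℕ} (hi : i < d.N) {x : List ℕ} {σ : ℕ → ℕ}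
    (hx : ∀ v, d.occursIn (indicator {i}) v → nth x v = σ v) {v : ℕ} (hv : v < d.n) :
    d.scale * d.crossingIn (indicator {i}) σ v ≤
      (nth (d.leaf i x).score v + 1) * d.degreeIn (indicator {i}) v := by
  simp only [leaf, nth_tabulate, if_pos hv, nth_singleNode hi]
  rw [crossingIn_congr hd hx, add_mul, one_mul]
  rcases Nat.eq_zero_or_pos (d.degreeIn (indicator {i}) v) with h0 | h0
  · have := crossingIn_le_degreeIn (d := d) (indicator {i}) σ v
    have h1 : d.crossingIn (indicator {i}) σ v = 0 := by omega
    simp [h0, h1]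
  · exact (Nat.lt_div_mul_add h0).le

theorem tracks_leaf (hd : d.Valid) {σ : ℕ → ℕ} (hσ : d.Stable σ) {i : ℕ} (hi : i < d.N)
    (ha : d.admissible (indicator {i})) : d.Tracks σ 0 {i} := by
  obtain ⟨x, hx, hxv⟩ := exists_mem_cutsOn (n := d.n) (l := d.bag i)
    (fun v hv => hd.lt_n i v (inBag_iff.2 hv)) hσ.1
  have hagree : ∀ v, d.occursIn (indicator {i}) v → nth x v = σ v := fun v hv => by
    rw [← nth_singleNode hi, occursIn_singleNode hi] at hv
    rw [hxv, if_pos hv]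
  have hnodes : nth (d.leaf i x).nodes = indicator {i} := nth_singleNode hi
  have hgood : d.good (d.leaf i x) := by
    refine good_iff.2 ⟨by rwa [hnodes], settled_iff.2 fun v hv => ?_⟩
    rw [hnodes]
    refine or_iff_not_imp_left.2 fun hB => hσ.scale_mul_degreeIn_le hd hB ?_
    exact (le_leaf_score hd hi hagree hv).trans (Nat.mul_le_mul_right _ (by omega))
  refine Approximates.tracks hd (e := d.leaf i x) ⟨hnodes, fun v hv => ?_, fun v hv => ?_, ?_⟩
    rfl (fun e => wellFormed_of_mem_leaves) ?_
  · exact hagree v (isBoundary_iff.1 hv).1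
  · exact le_leaf_score hd hi hagree (lt_n_of_isBoundary hd hv)
  · exact (cutCost_congr hd hagree).le
  · exact List.mem_filter.2 ⟨List.mem_flatMap.2 ⟨i, List.mem_range.2 hi,
      List.mem_map.2 ⟨x, hx, rfl⟩⟩, hgood⟩

section Union

variable {F F' : Finset ℕ}

theorem indicator_union (h : Disjoint F F') :
    indicator (F ∪ F') = fun i => indicator F i + indicator F' i := by
  funext i
  have h1 : i ∈ F → i ∉ F' := fun h2 => Finset.disjoint_left.1 h h2
  simp only [indicator, Finset.mem_union]
  by_cases hF : i ∈ F
  · simp [hF, h1 hF]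
  · simp [hF]

theorem indicator_eq_zero_or (h : Disjoint F F') (i : ℕ) :
    indicator F i = 0 ∨ indicator F' i = 0 := by
  rw [indicator_eq_zero, indicator_eq_zero, ← not_and_or]
  exact fun ⟨h1, h2⟩ => Finset.disjoint_left.1 h h1 h2

theorem degreeIn_union (h : Disjoint F F') (v : ℕ) : d.degreeIn (indicator (F ∪ F')) v =
    d.degreeIn (indicator F) v + d.degreeIn (indicator F') v := by
  rw [indicator_union h, degreeIn_add (indicator_eq_zero_or h)]

theorem crossingIn_union (h : Disjoint F F') (x : ℕ → ℕ) (v : ℕ) :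
    d.crossingIn (indicator (F ∪ F')) x v =
      d.crossingIn (indicator F) x v + d.crossingIn (indicator F') x v := by
  rw [indicator_union h, crossingIn_add (indicator_eq_zero_or h)]

theorem cutCost_union (h : Disjoint F F') (x : ℕ → ℕ) : d.cutCost (indicator (F ∪ F')) x =
    d.cutCost (indicator F) x + d.cutCost (indicator F') x := by
  rw [indicator_union h, cutCost_add (indicator_eq_zero_or h)]

theorem isBoundary_of_occursIn_both (h : Disjoint F F') {v : ℕ}
    (hv : d.occursIn (indicator F) v) (hv' : d.occursIn (indicator F') v) :
    d.isBoundary (indicator F) v := by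
  obtain ⟨i, hi, h1, h2⟩ := occursIn_iff.1 hv'
  exact isBoundary_iff.2 ⟨hv, occursOutside_iff.2 ⟨i, hi, indicator_eq_zero.2 fun h3 =>
    Finset.disjoint_left.1 h h3 (indicator_pos.1 h1), h2⟩⟩

theorem isBoundary_of_isBoundary_union {v : ℕ} (h : d.isBoundary (indicator (F ∪ F')) v)
    (hv : d.occursIn (indicator F) v) : d.isBoundary (indicator F) v := by
  obtain ⟨i, hi, h1, h2⟩ := occursOutside_iff.1 (isBoundary_iff.1 h).2
  refine isBoundary_iff.2 ⟨hv, occursOutside_iff.2 ⟨i, hi, ?_, h2⟩⟩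
  rw [indicator_eq_zero] at *
  exact fun h3 => h1 (Finset.mem_union_left _ h3)

variable {σ : ℕ → ℕ} {r : ℕ} {e e' : Entry}

theorem Approximates.compatible (h : d.Approximates σ r F e) (h' : d.Approximates σ r F' e')
    (hdis : Disjoint F F') : d.compatible e e' := by
  refine compatible_iff.2 ⟨fun i _ => ?_, fun v _ hv hv' => ?_⟩
  · rw [h.nodes_eq, h'.nodes_eq]
    exact indicator_eq_zero_or hdis i
  · rw [h.nodes_eq] at hv
    rw [h'.nodes_eq] at hv'
    rw [h.cut_eq v (isBoundary_of_occursIn_both hdis hv hv'),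
      h'.cut_eq v (isBoundary_of_occursIn_both hdis.symm hv' hv)]

theorem Approximates.le_score_of_imp (hd : d.Valid) (h : d.Approximates σ r F e) {v : ℕ}
    (hv : d.occursIn (indicator F) v → d.isBoundary (indicator F) v) :
    d.scale * d.crossingIn (indicator F) σ v ≤
      (nth e.score v + (r + 1)) * d.degreeIn (indicator F) v := by
  by_cases hV : d.occursIn (indicator F) v
  · exact h.le_score v (hv hV)
  · simp [crossingIn_eq_zero hd σ hV]

theorem Approximates.le_mergeScore (hd : d.Valid) (h : d.Approximates σ r F e)
    (h' : d.Approximates σ r F' e') (hdis : Disjoint F F') {v : ℕ}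
    (hv : d.occursIn (indicator F) v → d.isBoundary (indicator F) v)
    (hv' : d.occursIn (indicator F') v → d.isBoundary (indicator F') v) :
    d.scale * d.crossingIn (indicator (F ∪ F')) σ v ≤
      (d.mergeScore e e' v + (r + 1 + 1)) * d.degreeIn (indicator (F ∪ F')) v := by
  have h1 := h.le_score_of_imp hd hv
  have h2 := h'.le_score_of_imp hd hv'
  rw [degreeIn_union hdis, crossingIn_union hdis, mergeScore, h.nodes_eq, h'.nodes_eq]
  set D := d.degreeIn (indicator F) v
  set D' := d.degreeIn (indicator F') v
  rcases Nat.eq_zero_or_pos (D + D') with h0 | h0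
  · have hD : D = 0 := by omega
    have hD' : D' = 0 := by omega
    rw [hD] at h1
    rw [hD'] at h2
    rw [h0]
    nlinarith
  · have := Nat.lt_div_mul_add h0 (a := nth e.score v * D + nth e'.score v * D')
    nlinarith

theorem mergeScore_comm (e e' : Entry) (v : ℕ) : d.mergeScore e e' v = d.mergeScore e' e v := by
  unfold mergeScore
  rw [add_comm, add_comm (d.degreeIn _ v)]

theorem WellFormed.scale_mul_degreeIn_le (he : d.WellFormed e) {v : ℕ} (hv : v < d.n)
    (hB : ¬ d.isBoundary (nth e.nodes) v) (h0 : d.degreeIn (nth e'.nodes) v = 0) :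
    d.scale * d.degreeIn (nth e.nodes) v ≤
      2 * (d.mergeScore e e' v + (d.rounds + 1)) * d.degreeIn (nth e.nodes) v := by
  rcases Nat.eq_zero_or_pos (d.degreeIn (nth e.nodes) v) with hpos | hpos
  · simp [hpos]
  · rw [mergeScore, h0, mul_zero, add_zero, add_zero, Nat.mul_div_cancel _ hpos]
    exact (settled_iff.1 (good_iff.1 he.good).2 v hv).resolve_left hB

/-- Where one of the parts contains all bags of `v`, the score of `v` does not change. -/
theorem Approximates.scale_mul_degreeIn_union_le (hd : d.Valid) (h : d.Approximates σ r F e)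
    (he : d.WellFormed e) (h' : d.Approximates σ r F' e') (hdis : Disjoint F F') {v : ℕ}
    (hv : v < d.n) (hV : d.occursIn (indicator F) v) (hB : ¬ d.isBoundary (indicator F) v) :
    d.scale * d.degreeIn (indicator (F ∪ F')) v ≤
      2 * (d.mergeScore e e' v + (d.rounds + 1)) * d.degreeIn (indicator (F ∪ F')) v := by
  have h0 : d.degreeIn (indicator F') v = 0 :=
    degreeIn_eq_zero hd fun hV' => hB (isBoundary_of_occursIn_both hdis hV hV')
  rw [degreeIn_union hdis, h0, add_zero, ← h.nodes_eq]
  exact he.scale_mul_degreeIn_le hv (by rwa [h.nodes_eq]) (by rwa [h'.nodes_eq])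

theorem Approximates.nodes_merge (h : d.Approximates σ r F e) (h' : d.Approximates σ r F' e')
    (he : d.WellFormed e) (he' : d.WellFormed e') (hdis : Disjoint F F') :
    nth (d.merge e e').nodes = indicator (F ∪ F') := by
  rw [nth_merge_nodes he.length_nodes he'.length_nodes, indicator_union hdis, h.nodes_eq,
    h'.nodes_eq]

theorem nth_merge_score {v : ℕ} (hv : v < d.n) :
    nth (d.merge e e').score v = d.mergeScore e e' v := by
  simp only [merge, nth_tabulate, if_pos hv]

theorem Approximates.good_merge (hd : d.Valid) (hσ : d.Stable σ) (h : d.Approximates σ r F e)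
    (h' : d.Approximates σ r F' e') (he : d.WellFormed e) (he' : d.WellFormed e')
    (hdis : Disjoint F F') (ha : d.admissible (indicator (F ∪ F'))) (hr : r + 1 ≤ d.rounds) :
    d.good (d.merge e e') := by
  have hnodes := h.nodes_merge h' he he' hdis
  refine good_iff.2 ⟨by rwa [hnodes], settled_iff.2 fun v hv => ?_⟩
  rw [hnodes, nth_merge_score hv]
  refine or_iff_not_imp_left.2 fun hB => ?_
  by_cases h1 : d.occursIn (indicator F) v → d.isBoundary (indicator F) v
  · by_cases h2 : d.occursIn (indicator F') v → d.isBoundary (indicator F') v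
    · refine hσ.scale_mul_degreeIn_le hd hB ?_
      exact (h.le_mergeScore hd h' hdis h1 h2).trans (Nat.mul_le_mul_right _ (by omega))
    · push Not at h2
      rw [Finset.union_comm, mergeScore_comm]
      exact h'.scale_mul_degreeIn_union_le hd he' h hdis.symm hv h2.1 h2.2
  · push Not at h1
    exact h.scale_mul_degreeIn_union_le hd he h' hdis hv h1.1 h1.2

theorem Approximates.merge (hd : d.Valid) (h : d.Approximates σ r F e)
    (h' : d.Approximates σ r F' e') (he : d.WellFormed e) (he' : d.WellFormed e')
    (hdis : Disjoint F F') : d.Approximates σ (r + 1) (F ∪ F') (d.merge e e') := by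
  have hc := h.compatible h' hdis
  have hnodes := h.nodes_merge h' he he' hdis
  have hleft : ∀ {v}, d.isBoundary (indicator (F ∪ F')) v →
      d.occursIn (indicator F) v → d.isBoundary (indicator F) v := isBoundary_of_isBoundary_union
  have hright : ∀ {v}, d.isBoundary (indicator (F ∪ F')) v →
      d.occursIn (indicator F') v → d.isBoundary (indicator F') v := fun hv =>
    isBoundary_of_isBoundary_union (by rwa [Finset.union_comm])
  refine ⟨hnodes, fun v hv => ?_, fun v hv => ?_, ?_⟩
  · have hV := (isBoundary_iff.1 hv).1
    rw [indicator_union hdis, occursIn_add] at hV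
    rcases hV with hV | hV
    · rw [he.merge_cut_left hd he' hc (by rwa [h.nodes_eq])]
      exact h.cut_eq v (hleft hv hV)
    · rw [he.merge_cut_right hd he' hc (by rwa [h'.nodes_eq])]
      exact h'.cut_eq v (hright hv hV)
  · rw [nth_merge_score (lt_n_of_isBoundary hd hv)]
    exact h.le_mergeScore hd h' hdis (hleft hv) (hright hv)
  · have hcost := he.cutCost_merge hd he' hc
    rw [hnodes, h.nodes_eq, h'.nodes_eq] at hcost
    rw [hcost, cutCost_union hdis]
    exact Nat.add_le_add h.cost_le h'.cost_le

end Union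

theorem Approximates.tracks_succ (hd : d.Valid) {σ : ℕ → ℕ} {F : Finset ℕ} {r : ℕ} {e : Entry}
    (h : d.Approximates σ (r + 1) F e) (he : e ∈ d.table r ++ d.merges (d.table r)) :
    d.Tracks σ (r + 1) F :=
  h.tracks hd (table_succ r)
    (fun _ ha => wellFormed_of_mem_step hd (fun _ ha => wellFormed_of_mem_table hd ha) ha) he

theorem Tracks.merge (hd : d.Valid) {σ : ℕ → ℕ} (hσ : d.Stable σ) {F F' : Finset ℕ} {r : ℕ}
    (h : d.Tracks σ r F) (h' : d.Tracks σ r F') (hdis : Disjoint F F')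
    (ha : d.admissible (indicator (F ∪ F'))) (hr : r + 1 ≤ d.rounds) :
    d.Tracks σ (r + 1) (F ∪ F') := by
  obtain ⟨e, hmem, h⟩ := h
  obtain ⟨e', hmem', h'⟩ := h'
  have he := wellFormed_of_mem_table hd hmem
  have he' := wellFormed_of_mem_table hd hmem'
  have hgood := h.good_merge hd hσ h' he he' hdis ha hr
  refine (h.merge hd h' he he' hdis).tracks_succ hd (List.mem_append_right _ ?_)
  exact List.mem_filter.2 ⟨List.mem_flatMap.2 ⟨e, hmem,
    List.mem_map.2 ⟨e', List.mem_filter.2 ⟨hmem', h.compatible h' hdis⟩, rfl⟩⟩, hgood⟩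

theorem Tracks.succ (hd : d.Valid) {σ : ℕ → ℕ} {F : Finset ℕ} {r : ℕ} (h : d.Tracks σ r F) :
    d.Tracks σ (r + 1) F := by
  obtain ⟨e, he, h⟩ := h
  refine Approximates.tracks_succ hd (e := e) ⟨h.nodes_eq, h.cut_eq, fun v hv => ?_, h.cost_le⟩
    (List.mem_append_left _ he)
  exact (h.le_score v hv).trans (Nat.mul_le_mul_right _ (by omega))

theorem Derivable.tracks (hd : d.Valid) {σ : ℕ → ℕ} (hσ : d.Stable σ) {F : Finset ℕ} {h : ℕ}
    (hF : d.Derivable F h) : ∀ r, h = r + 1 → r ≤ d.rounds → d.Tracks σ r F := by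
  induction hF with
  | leaf i hi ha =>
    rintro r hr -
    obtain rfl : r = 0 := by omega
    exact tracks_leaf hd hσ hi ha
  | merge hF _ hdis ha ih ih' =>
    intro r hr hR
    have := hF.pos
    obtain ⟨r, rfl⟩ : ∃ s, r = s + 1 := ⟨r - 1, by omega⟩
    exact (ih r (by omega) (by omega)).merge hd hσ (ih' r (by omega) (by omega)) hdis ha hR
  | succ hF ih =>
    intro r hr hR
    have := hF.pos
    obtain ⟨r, rfl⟩ : ∃ s, r = s + 1 := ⟨r - 1, by omega⟩
    exact (ih r (by omega) (by omega)).succ hd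

theorem not_occursOutside_of_pos {S : ℕ → ℕ} (hS : ∀ i < d.N, 0 < S i) (v : ℕ) :
    ¬ d.occursOutside S v := fun h => by
  obtain ⟨i, hi, h1, -⟩ := occursOutside_iff.1 h
  exact (hS i hi).ne' h1

theorem not_isBoundary_of_pos {S : ℕ → ℕ} (hS : ∀ i < d.N, 0 < S i) (v : ℕ) :
    ¬ d.isBoundary S v := fun h => not_occursOutside_of_pos hS v (isBoundary_iff.1 h).2

theorem cutCost_eq_totalCost (hd : d.Valid) {S : ℕ → ℕ} (hS : ∀ i < d.N, 0 < S i) (x : ℕ → ℕ) :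
    d.cutCost S x = d.totalCost x :=
  Finset.sum_congr rfl fun u _ => Finset.sum_congr rfl fun v _ => by
    rw [ownedWeight_eq_weight hd (not_occursOutside_of_pos hS u)]

theorem Derivable.exists_full_entry (hd : d.Valid)
    (hD : d.Derivable (Finset.range d.N) (d.rounds + 1)) {σ : ℕ → ℕ} (hσ : d.Stable σ) :
    ∃ e ∈ d.table d.rounds, (∀ i < d.N, 0 < nth e.nodes i) ∧
      d.totalCost (nth e.cut) ≤ d.totalCost σ := by
  obtain ⟨e, he, h⟩ := hD.tracks hd hσ d.rounds rfl le_rfl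
  have hpos : ∀ i < d.N, 0 < indicator (Finset.range d.N) i := fun i hi =>
    indicator_pos.2 (Finset.mem_range.2 hi)
  have hcost := h.cost_le
  rw [cutCost_eq_totalCost hd hpos, cutCost_eq_totalCost hd hpos] at hcost
  exact ⟨e, he, by rwa [h.nodes_eq], hcost⟩

theorem eq_of_mem_table_of_pos (hd : d.Valid) {r : ℕ} {e e' : Entry} (he : e ∈ d.table r)
    (hpos : ∀ i < d.N, 0 < nth e.nodes i) (he' : e' ∈ d.table r)
    (hpos' : ∀ i < d.N, 0 < nth e'.nodes i) : e = e' := by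
  by_contra hne
  have : Std.Symm fun e e' : Entry => ¬ d.sameKey e e' := ⟨fun a b h h' => h (sameKey_symm h')⟩
  refine (pairwise_table r).forall he he' hne (sameKey_iff.2 ⟨fun i hi => ?_, fun v _ hv => ?_⟩)
  · have h1 := hpos i hi
    have h2 := hpos' i hi
    have h3 := (wellFormed_of_mem_table hd he).nodes_le_one i
    have h4 := (wellFormed_of_mem_table hd he').nodes_le_one i
    omega
  · exact absurd hv (not_isBoundary_of_pos hpos v)

theorem output_eq (hd : d.Valid) {e : Entry} (he : e ∈ d.table d.rounds)
    (hpos : ∀ i < d.N, 0 < nth e.nodes i) : d.output = e.cut := by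
  set L := (d.table d.rounds).filter fun e =>
    (List.range d.N).all fun i => decide (0 < nth e.nodes i) with hL
  have hmem : e ∈ L := by simpa [hL, he] using hpos
  have hlen := List.length_pos_of_mem hmem
  have hget : L.getD 0 ⟨[], [], []⟩ ∈ L := by
    rw [List.getD_eq_getElem?_getD, List.getElem?_eq_getElem hlen]
    exact List.getElem_mem hlen
  obtain ⟨h1, h2⟩ : L.getD 0 ⟨[], [], []⟩ ∈ d.table d.rounds ∧
      ∀ i < d.N, 0 < nth (L.getD 0 ⟨[], [], []⟩).nodes i := by
    simpa [hL] using hget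
  unfold output
  rw [← hL, eq_of_mem_table_of_pos hd h1 h2 he hpos]

theorem WellFormed.scale_mul_totalDegree_le (hd : d.Valid) {e : Entry} (he : d.WellFormed e)
    (hpos : ∀ i < d.N, 0 < nth e.nodes i) {v : ℕ} (hv : v < d.n) :
    d.scale * d.totalDegree v ≤ 2 * d.scale * d.totalCrossing (nth e.cut) v +
      2 * (d.rounds + 1) * d.totalDegree v := by
  have hsettled := (settled_iff.1 (good_iff.1 he.good).2 v hv).resolve_left
    (not_isBoundary_of_pos hpos v)
  have hscore := he.score_mul_le v
  have ho := not_occursOutside_of_pos hpos v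
  rw [degreeIn_eq_totalDegree hd ho] at hsettled hscore
  rw [crossingIn_eq_totalCrossing hd _ ho] at hscore
  calc d.scale * d.totalDegree v
      ≤ 2 * (nth e.score v + (d.rounds + 1)) * d.totalDegree v := hsettled
    _ = 2 * (nth e.score v * d.totalDegree v) + 2 * (d.rounds + 1) * d.totalDegree v := by ring
    _ ≤ 2 * (d.scale * d.totalCrossing (nth e.cut) v) + 2 * (d.rounds + 1) * d.totalDegree v := by
        gcongr
    _ = _ := by ring

theorem output_spec (hd : d.Valid) (hD : d.Derivable (Finset.range d.N) (d.rounds + 1))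
    {σ₀ : ℕ → ℕ} (hσ₀ : d.Stable σ₀) :
    d.output.length = d.n ∧ (∀ v, nth d.output v ≤ 1) ∧
    (∀ v < d.n, d.scale * d.totalDegree v ≤ 2 * d.scale * d.totalCrossing (nth d.output) v +
      2 * (d.rounds + 1) * d.totalDegree v) ∧
    ∀ σ, d.Stable σ → d.totalCost (nth d.output) ≤ d.totalCost σ := by
  obtain ⟨e, hmem, hpos, -⟩ := hD.exists_full_entry hd hσ₀
  have he := wellFormed_of_mem_table hd hmem
  rw [output_eq hd hmem hpos]
  refine ⟨he.length_cut, he.cut_le_one, fun v hv => he.scale_mul_totalDegree_le hd hpos hv,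
    fun σ hσ => ?_⟩
  obtain ⟨e', hmem', hpos', hcost⟩ := hD.exists_full_entry hd hσ
  rwa [eq_of_mem_table_of_pos hd hmem hpos hmem' hpos']

end DPData

end MinStableCut

/-! ### Shallow derivations along heavy paths -/

namespace MinStableCut

/-- Ordered rooted forests. `node x l r` stands for the tree with root `x` and the forest `l` of its
children, followed by the forest `r` of its later siblings. -/
inductive Forest
  | nil : Forest
  | node : ℕ → Forest → Forest → Forest

namespace Forest

/-- The preorder of the nodes. -/
def preorder : Forest → List ℕ
  | nil => []
  | node x l r => x :: (l.preorder ++ r.preorder)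

/-- The pairs of a node and its parent, where the roots receive the parent `p`. -/
def edges (p : ℕ) : Forest → List (ℕ × ℕ)
  | nil => []
  | node x l r => (x, p) :: (edges x l ++ edges p r)

theorem mem_of_mem_edges {t : Forest} {p a b : ℕ} (h : (a, b) ∈ t.edges p) :
    a ∈ t.preorder ∧ (b = p ∨ b ∈ t.preorder) := by
  induction t generalizing p with
  | nil => simp [edges] at h
  | node x l r ihl ihr =>
    simp only [edges, List.mem_cons, List.mem_append, Prod.mk.injEq] at h
    simp only [preorder, List.mem_cons, List.mem_append]
    rcases h with ⟨rfl, rfl⟩ | h | h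
    · simp
    · have := ihl h; tauto
    · have := ihr h; tauto

theorem nodup_preorder_node {x : ℕ} {l r : Forest} : (node x l r).preorder.Nodup ↔
    x ∉ l.preorder ∧ x ∉ r.preorder ∧ l.preorder.Nodup ∧ r.preorder.Nodup ∧
      l.preorder.Disjoint r.preorder := by
  simp only [preorder, List.nodup_cons, List.mem_append, not_or, List.nodup_append', and_assoc]

/-- One step of a descent into a forest: the node that is passed, and the forest that is left behind
together with the parent of its roots. -/
structure Step where
  node : ℕ
  rest : Forest
  parent : ℕ

/-- `Path s p fs s' p'`: the forest `s'`, whose roots have the parent `p'`, is reached along the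
steps `fs` from the forest `s`, whose roots have the parent `p`. -/
inductive Path : Forest → ℕ → List Step → Forest → ℕ → Prop
  | refl (s : Forest) (p : ℕ) : Path s p [] s p
  | left {x p p' : ℕ} {l r s' : Forest} {fs : List Step} :
      Path l x fs s' p' → Path (node x l r) p (⟨x, r, p⟩ :: fs) s' p'
  | right {x p p' : ℕ} {l r s' : Forest} {fs : List Step} :
      Path r p fs s' p' → Path (node x l r) p (⟨x, l, x⟩ :: fs) s' p'

theorem Path.split {s s'' : Forest} {p p'' : ℕ} {fs fs' : List Step}
    (h : Path s p (fs ++ fs') s'' p'') : ∃ s' p', Path s p fs s' p' ∧ Path s' p' fs' s'' p'' := by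
  induction fs generalizing s p with
  | nil => exact ⟨s, p, .refl s p, h⟩
  | cons f fs ih =>
    cases h with
    | left h =>
      obtain ⟨s', p', hfs, hfs'⟩ := ih h
      exact ⟨s', p', hfs.left, hfs'⟩
    | right h =>
      obtain ⟨s', p', hfs, hfs'⟩ := ih h
      exact ⟨s', p', hfs.right, hfs'⟩

theorem Path.subset {s s' : Forest} {p p' : ℕ} {fs : List Step} (h : Path s p fs s' p') :
    s'.preorder ⊆ s.preorder := by
  induction h with
  | refl => exact List.Subset.refl _
  | left _ ih => intro a ha; simp [preorder, ih ha]
  | right _ ih => intro a ha; simp [preorder, ih ha]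

theorem exists_heavy_path (t : Forest) (p : ℕ) : ∃ fs p', Path t p fs nil p' ∧
    fs.length ≤ t.preorder.length ∧
      ∀ f ∈ fs, 2 * f.rest.preorder.length + 1 ≤ t.preorder.length := by
  induction t generalizing p with
  | nil => exact ⟨[], p, .refl _ _, by simp, by simp⟩
  | node x l r ihl ihr =>
    simp only [preorder, List.length_cons, List.length_append]
    rcases le_total r.preorder.length l.preorder.length with h | h
    · obtain ⟨fs, p', hpath, hlen, hrest⟩ := ihl x
      refine ⟨_, p', hpath.left, by rw [List.length_cons]; omega,
        List.forall_mem_cons.2 ⟨by dsimp only; omega, fun f hf => ?_⟩⟩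
      have := hrest f hf
      omega
    · obtain ⟨fs, p', hpath, hlen, hrest⟩ := ihr p
      refine ⟨_, p', hpath.right, by rw [List.length_cons]; omega,
        List.forall_mem_cons.2 ⟨by dsimp only; omega, fun f hf => ?_⟩⟩
      have := hrest f hf
      omega

/-- The nodes of `s` outside `s'`. -/
def between (s s' : Forest) : Finset ℕ := s.preorder.toFinset \ s'.preorder.toFinset

theorem mem_between {s s' : Forest} {a : ℕ} :
    a ∈ between s s' ↔ a ∈ s.preorder ∧ a ∉ s'.preorder := by
  simp only [between, Finset.mem_sdiff, List.mem_toFinset]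

theorem between_nil (s : Forest) : between s nil = s.preorder.toFinset := by
  simp [between, preorder]

theorem between_union_between {s s₁ s' : Forest} (h : s₁.preorder ⊆ s.preorder)
    (h' : s'.preorder ⊆ s₁.preorder) : between s s₁ ∪ between s₁ s' = between s s' := by
  ext a
  have := @h a
  have := @h' a
  simp only [Finset.mem_union, mem_between]
  tauto

theorem disjoint_between_between (s s₁ s' : Forest) :
    Disjoint (between s s₁) (between s₁ s') := by
  rw [Finset.disjoint_left]
  simp only [mem_between]
  tauto

theorem Path.between_eq_of_step {s s' : Forest} {p p' : ℕ} {f : Step} (h : Path s p [f] s' p')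
    (hs : s.preorder.Nodup) : f.node ∈ s.preorder ∧ f.node ∉ f.rest.preorder ∧
      between s s' = {f.node} ∪ f.rest.preorder.toFinset := by
  cases h with
  | left h | right h =>
    cases h
    obtain ⟨hl, hr, -, -, hlr⟩ := nodup_preorder_node.1 hs
    refine ⟨List.mem_cons_self, by assumption, Finset.ext fun a => ?_⟩
    have := @hlr a
    simp only [mem_between, preorder, List.mem_cons, List.mem_append, Finset.mem_union,
      Finset.mem_singleton, List.mem_toFinset]
    grind

end Forest

namespace DPData

open Forest (Path Step between)

variable {d : DPData} {A : ℕ → ℕ → Prop}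

/-- The ordering enumerates the nodes, and the bags form a tree decomposition with respect to the
adjacency relation `A` on the nodes. Connectedness enters only in the form `exists_adj`: a vertex on
the boundary of a set of nodes lies in both bags of an edge that leaves the set. -/
structure Layout (d : DPData) (A : ℕ → ℕ → Prop) : Prop where
  nodup : d.order.Nodup
  mem_order : ∀ i, i ∈ d.order ↔ i < d.N
  symm : ∀ i j, A i j → A j i
  exists_adj : ∀ (F : Finset ℕ) (v : ℕ), d.isBoundary (indicator F) v →
    ∃ a ∈ F, ∃ b ∉ F, A a b ∧ v ∈ d.bag a ∧ v ∈ d.bag b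
  length_bag_le : ∀ i, (d.bag i).length ≤ d.bagBound

/-- The nodes of `s` are consecutive in the ordering, their adjacencies are the edges of the forest,
and `p` is their only outside neighbour. -/
structure Block (d : DPData) (A : ℕ → ℕ → Prop) (s : Forest) (p : ℕ) : Prop where
  isInfix : s.preorder <:+: d.order
  adj_mem_edges : ∀ a ∈ s.preorder, ∀ b, A a b → (a, b) ∈ s.edges p ∨ (b, a) ∈ s.edges p
  notMem : p ∉ s.preorder

namespace Layout

theorem length_order (hL : d.Layout A) : d.order.length = d.N := by
  have : d.order.toFinset = Finset.range d.N := by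
    ext i; simp [hL.mem_order]
  rw [← List.toFinset_card_of_nodup hL.nodup, this, Finset.card_range]

theorem nth_mem_iff (hL : d.Layout A) {u X w : List ℕ} (h : u ++ X ++ w = d.order) {i : ℕ}
    (hi : i < d.N) : nth d.order i ∈ X ↔ u.length ≤ i ∧ i < u.length + X.length := by
  have hnd := hL.nodup
  have hlen := hL.length_order
  simp only [← h, List.length_append] at hnd hlen
  have hi' : i < (u ++ X ++ w).length := by simp only [List.length_append]; omega
  have hget : nth d.order i = (u ++ X ++ w)[i] := by
    rw [nth, ← h, List.getD_eq_getElem _ _ hi']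
  rw [hget]
  constructor
  · intro hmem
    obtain ⟨j, hj, hj'⟩ := List.getElem_of_mem hmem
    have hX : (u ++ X ++ w)[u.length + j]'(by simp; omega) = X[j] := by
      rw [List.getElem_append_left (by simp; omega), List.getElem_append_right (by omega)]
      simp
    have := hnd.getElem_inj_iff.1 (hX.trans hj')
    omega
  · rintro ⟨_, _⟩
    rw [List.getElem_append_left (by simp; omega), List.getElem_append_right (by omega)]
    exact List.getElem_mem _

theorem isIntervalDiff_sdiff (hL : d.Layout A) {X Y : List ℕ} (hX : X <:+: d.order)
    (hY : Y <:+: d.order) : d.isIntervalDiff (indicator (X.toFinset \ Y.toFinset)) := by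
  obtain ⟨u, w, hX⟩ := hX
  obtain ⟨u', w', hY⟩ := hY
  have hlenX := congrArg List.length hX
  have hlenY := congrArg List.length hY
  simp only [List.length_append, hL.length_order] at hlenX hlenY
  simp only [isIntervalDiff, List.any_eq_true, List.all_eq_true, List.mem_range]
  refine ⟨u.length, by omega, u.length + X.length, by omega, u'.length, by omega,
    u'.length + Y.length, by omega, fun i hi => ?_⟩
  rw [beq_iff_eq, Bool.eq_iff_iff]
  simp only [indicator_pos, decide_eq_true_eq, Finset.mem_sdiff, List.mem_toFinset,
    hL.nth_mem_iff hX hi, hL.nth_mem_iff hY hi, Bool.and_eq_true, Bool.not_eq_true',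
    ← Bool.not_eq_true]

theorem boundarySize_le (hL : d.Layout A) {S : ℕ → ℕ} {p p' : ℕ}
    (h : ∀ v, d.isBoundary S v → v ∈ d.bag p ∨ v ∈ d.bag p') :
    d.boundarySize S ≤ 2 * d.bagBound := by
  have hsub : ((List.range d.n).filter fun v => d.isBoundary S v).toFinset ⊆
      (d.bag p ++ d.bag p').toFinset := fun v hv => by
    simp only [List.mem_toFinset, List.mem_filter, List.mem_append] at hv ⊢
    exact h v hv.2
  have hcard := (Finset.card_le_card hsub).trans (List.toFinset_card_le _)
  rw [List.toFinset_card_of_nodup (List.nodup_range.filter _), List.length_append] at hcard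
  have := hL.length_bag_le p
  have := hL.length_bag_le p'
  unfold boundarySize
  omega

theorem derivable_singleton (hL : d.Layout A) {i : ℕ} (hi : i < d.N) : d.Derivable {i} 1 := by
  refine .leaf i hi ?_
  simp only [admissible, Bool.and_eq_true, decide_eq_true_eq]
  constructor
  · have hX : [i] <:+: d.order := by
      obtain ⟨u, w, h⟩ := List.append_of_mem ((hL.mem_order i).2 hi)
      exact ⟨u, w, by simp [h]⟩
    simpa using hL.isIntervalDiff_sdiff hX (List.nil_infix (l := d.order))
  · refine hL.boundarySize_le (p := i) (p' := i) fun v hv => ?_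
    obtain ⟨a, ha, b, -, -, hva, -⟩ := hL.exists_adj _ v hv
    rw [Finset.mem_singleton.1 ha] at hva
    exact Or.inl hva

end Layout

namespace Block

theorem lt (hL : d.Layout A) {s : Forest} {p a : ℕ} (h : d.Block A s p) (ha : a ∈ s.preorder) :
    a < d.N :=
  (hL.mem_order a).1 (h.isInfix.subset ha)

theorem nodup (hL : d.Layout A) {s : Forest} {p : ℕ} (h : d.Block A s p) : s.preorder.Nodup :=
  h.isInfix.sublist.nodup hL.nodup

theorem eq_of_adj {s : Forest} {p a b : ℕ} (h : d.Block A s p) (ha : a ∈ s.preorder)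
    (hb : b ∉ s.preorder) (hab : A a b) : b = p := by
  rcases h.adj_mem_edges a ha b hab with hmem | hmem
  · exact (Forest.mem_of_mem_edges hmem).2.resolve_right hb
  · exact absurd (Forest.mem_of_mem_edges hmem).1 hb

theorem left (hL : d.Layout A) {x p : ℕ} {l r : Forest} (h : d.Block A (.node x l r) p) :
    d.Block A l x := by
  obtain ⟨hxl, -, -, -, hlr⟩ := Forest.nodup_preorder_node.1 (h.nodup hL)
  have hp := h.notMem
  simp only [Forest.preorder, List.mem_cons, List.mem_append, not_or] at hp
  refine ⟨.trans ⟨[x], r.preorder, by simp [Forest.preorder]⟩ h.isInfix, fun a ha b hab => ?_, hxl⟩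
  have hedge := h.adj_mem_edges a (by simp [Forest.preorder, ha]) b hab
  simp only [Forest.edges, List.mem_cons, List.mem_append, Prod.mk.injEq] at hedge
  have := @hlr a ha
  have := @Forest.mem_of_mem_edges r p a b
  have := @Forest.mem_of_mem_edges r p b a
  grind

theorem right (hL : d.Layout A) {x p : ℕ} {l r : Forest} (h : d.Block A (.node x l r) p) :
    d.Block A r p := by
  obtain ⟨-, hxr, -, -, hlr⟩ := Forest.nodup_preorder_node.1 (h.nodup hL)
  have hp := h.notMem
  simp only [Forest.preorder, List.mem_cons, List.mem_append, not_or] at hp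
  refine ⟨.trans ⟨x :: l.preorder, [], by simp [Forest.preorder]⟩ h.isInfix, fun a ha b hab => ?_,
    hp.2.2⟩
  have hedge := h.adj_mem_edges a (by simp [Forest.preorder, ha]) b hab
  simp only [Forest.edges, List.mem_cons, List.mem_append, Prod.mk.injEq] at hedge
  have := fun hal => @hlr a hal ha
  have := @Forest.mem_of_mem_edges l x a b
  have := @Forest.mem_of_mem_edges l x b a
  grind

theorem path (hL : d.Layout A) {s s' : Forest} {p p' : ℕ} {fs : List Step}
    (h : Path s p fs s' p') (hs : d.Block A s p) :
    d.Block A s' p' ∧ ∀ f ∈ fs, d.Block A f.rest f.parent := by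
  induction h with
  | refl => exact ⟨hs, by simp⟩
  | left _ ih =>
    obtain ⟨hs', hfs⟩ := ih (hs.left hL)
    exact ⟨hs', List.forall_mem_cons.2 ⟨hs.right hL, hfs⟩⟩
  | right _ ih =>
    obtain ⟨hs', hfs⟩ := ih (hs.right hL)
    exact ⟨hs', List.forall_mem_cons.2 ⟨hs.left hL, hfs⟩⟩

theorem admissible_between (hL : d.Layout A) {s s' : Forest} {p p' : ℕ} (hs : d.Block A s p)
    (hs' : d.Block A s' p') : d.admissible (indicator (between s s')) := by
  simp only [admissible, Bool.and_eq_true, decide_eq_true_eq]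
  refine ⟨hL.isIntervalDiff_sdiff hs.isInfix hs'.isInfix,
    hL.boundarySize_le (p := p) (p' := p') fun v hv => ?_⟩
  obtain ⟨a, ha, b, hb, hab, hva, hvb⟩ := hL.exists_adj _ v hv
  simp only [Forest.mem_between, not_and, not_not] at ha hb
  by_cases h : b ∈ s.preorder
  · rw [← hs'.eq_of_adj (hb h) ha.2 (hL.symm _ _ hab)]
    exact Or.inr hva
  · rw [← hs.eq_of_adj ha.1 h hab]
    exact Or.inl hvb

theorem derivable_between_of_step (hL : d.Layout A) {h : ℕ} (hh : 1 ≤ h) {s s' : Forest}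
    {p p' : ℕ} {f : Step} (hpath : Path s p [f] s' p') (hs : d.Block A s p)
    (hder : f.rest.preorder ≠ [] → d.Derivable f.rest.preorder.toFinset h) :
    d.Derivable (between s s') (h + 1) := by
  have hadm := hs.admissible_between hL (hs.path hL hpath).1
  obtain ⟨hmem, hnotMem, heq⟩ := hpath.between_eq_of_step (hs.nodup hL)
  have hnode := (hL.derivable_singleton (hs.lt hL hmem)).mono hh
  rw [heq] at hadm ⊢
  by_cases hrest : f.rest.preorder = []
  · simpa [hrest] using hnode.succ
  · exact hnode.merge (hder hrest) (by simpa using hnotMem) hadm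

-- The path is halved, so that its length enters the height only logarithmically.
theorem derivable_between (hL : d.Layout A) {h : ℕ} (hh : 1 ≤ h) (j : ℕ) {s s' : Forest}
    {p p' : ℕ} {fs : List Step} (hpath : Path s p fs s' p') (hs : d.Block A s p) (hne : fs ≠ [])
    (hlen : fs.length ≤ 2 ^ j)
    (hder : ∀ f ∈ fs, f.rest.preorder ≠ [] → d.Derivable f.rest.preorder.toFinset h) :
    d.Derivable (between s s') (h + 1 + j) := by
  induction j generalizing s s' p p' fs with
  | zero =>
    obtain ⟨f, rfl⟩ := List.length_eq_one_iff.1 (hlen.antisymm (List.length_pos_of_ne_nil hne))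
    exact hs.derivable_between_of_step hL hh hpath (hder f (List.mem_singleton_self f))
  | succ j ih =>
    by_cases hsmall : fs.length ≤ 2 ^ j
    · exact (ih hpath hs hne hsmall hder).succ
    have hadm := hs.admissible_between hL (hs.path hL hpath).1
    obtain ⟨s₁, p₁, hpath₁, hpath₂⟩ :=
      Path.split (fs := fs.take (2 ^ j)) (fs' := fs.drop (2 ^ j)) (by simpa using hpath)
    have hpos : 0 < 2 ^ j := by positivity
    have hlen₁ : (fs.take (2 ^ j)).length = 2 ^ j := by simp; omega
    have hlen₂ : (fs.drop (2 ^ j)).length = fs.length - 2 ^ j := by simp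
    have hder₁ := ih hpath₁ hs (List.ne_nil_of_length_pos (by omega)) hlen₁.le
      fun f hf => hder f (List.mem_of_mem_take hf)
    have hder₂ := ih hpath₂ (hs.path hL hpath₁).1 (List.ne_nil_of_length_pos (by omega))
      (by rw [pow_succ] at hlen; omega) fun f hf => hder f (List.mem_of_mem_drop hf)
    rw [← Forest.between_union_between hpath₁.subset hpath₂.subset] at hadm ⊢
    exact hder₁.merge hder₂ (Forest.disjoint_between_between s s₁ s') hadm

theorem derivable (hL : d.Layout A) {K : ℕ} (hK : d.N < 2 ^ K) (k : ℕ) {t : Forest} {p : ℕ}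
    (ht : d.Block A t p) (hne : t.preorder ≠ []) (hlen : t.preorder.length < 2 ^ k) :
    d.Derivable t.preorder.toFinset (k * (K + 1) + 1) := by
  induction k generalizing t p with
  | zero => exact absurd (List.length_eq_zero_iff.1 (by simpa using hlen)) hne
  | succ k ih =>
    obtain ⟨fs, p', hpath, hfs, hsmall⟩ := t.exists_heavy_path p
    have hle : t.preorder.length ≤ d.N := hL.length_order ▸ ht.isInfix.length_le
    have hfs_ne : fs ≠ [] := by
      rintro rfl
      cases hpath
      exact hne rfl
    have hrest : ∀ f ∈ fs, f.rest.preorder ≠ [] →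
        d.Derivable f.rest.preorder.toFinset (k * (K + 1) + 1) := fun f hf hf' => by
      refine ih ((ht.path hL hpath).2 f hf) hf' ?_
      have := hsmall f hf
      rw [pow_succ] at hlen
      omega
    have hder := ht.derivable_between hL (by omega) K hpath hfs_ne (by omega) hrest
    rw [Forest.between_nil] at hder
    exact hder.mono (by ring_nf; omega)

end Block

end DPData

end MinStableCut

/-! ### Depth-first orderings -/

namespace MinStableCut

/-- Insertion of `x` behind `y`. -/
def insertAfter (y x : ℕ) (L : List ℕ) : List ℕ := L.flatMap fun z => if z = y then [z, x] else [z]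

/-- The nodes outside `L` that are adjacent to a node of `L`, with this neighbour. -/
def fringe (nb : ℕ → List ℕ) (L : List ℕ) : List (ℕ × ℕ) :=
  L.flatMap fun y => ((nb y).filter fun x => !L.any fun z => decide (z = x)).map fun x => (x, y)

/-- One step of the construction of the ordering: a new node is inserted behind its neighbour. -/
def grow (nb : ℕ → List ℕ) (L : List ℕ) : List ℕ :=
  if (fringe nb L).length = 0 then L
  else insertAfter ((fringe nb L).getD 0 (0, 0)).2 ((fringe nb L).getD 0 (0, 0)).1 L

/-- A depth-first ordering of the nodes of a tree that is given by its neighbour lists. -/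
def dfsOrder (N : ℕ) (nb : ℕ → List ℕ) : List ℕ := (grow nb)^[N] [0]

namespace Forest

/-- Insertion of `x` as the first child of `y`. -/
def insertChild (y x : ℕ) : Forest → Forest
  | nil => nil
  | node z l r => node z (if z = y then node x nil (insertChild y x l) else insertChild y x l)
      (insertChild y x r)

theorem preorder_insertChild (y x : ℕ) (t : Forest) :
    (insertChild y x t).preorder = insertAfter y x t.preorder := by
  induction t with
  | nil => rfl
  | node z l r ihl ihr =>
    simp only [insertChild, preorder, insertAfter, List.flatMap_cons, List.flatMap_append]
      at ihl ihr ⊢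
    split_ifs <;> simp [preorder, ihl, ihr]

theorem mem_edges_insertChild {y x p a b : ℕ} {t : Forest} (h : (a, b) ∈ t.edges p) :
    (a, b) ∈ (insertChild y x t).edges p := by
  induction t generalizing p with
  | nil => exact h
  | node z l r ihl ihr =>
    simp only [insertChild, edges, List.mem_cons, List.mem_append] at h ⊢
    rcases h with h | h | h
    · exact Or.inl h
    · refine Or.inr (Or.inl ?_)
      split_ifs
      · simp [edges, ihl h]
      · exact ihl h
    · exact Or.inr (Or.inr (ihr h))

theorem mem_edges_insertChild_self {y x p : ℕ} {t : Forest} (h : y ∈ t.preorder) :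
    (x, y) ∈ (insertChild y x t).edges p := by
  induction t generalizing p with
  | nil => simp [preorder] at h
  | node z l r ihl ihr =>
    simp only [insertChild, edges, preorder, List.mem_cons, List.mem_append] at h ⊢
    by_cases hz : z = y
    · simp [hz, edges]
    · rcases h with h | h | h
      · exact absurd h.symm hz
      · rw [if_neg hz]
        exact Or.inr (Or.inl (ihl h))
      · exact Or.inr (Or.inr (ihr h))

end Forest

theorem insertAfter_of_notMem {y x : ℕ} {L : List ℕ} (hy : y ∉ L) : insertAfter y x L = L := by
  have hL : ∀ z ∈ L, (if z = y then [z, x] else [z]) = [z] := fun z hz =>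
    if_neg (ne_of_mem_of_not_mem hz hy)
  rw [insertAfter, List.flatMap_congr hL, List.flatMap_singleton']

theorem insertAfter_perm {y x : ℕ} {L : List ℕ} (hL : L.Nodup) (hy : y ∈ L) :
    (insertAfter y x L).Perm (x :: L) := by
  obtain ⟨L₁, L₂, rfl⟩ := List.append_of_mem hy
  rw [List.nodup_middle, List.nodup_cons, List.mem_append, not_or] at hL
  have heq : insertAfter y x (L₁ ++ y :: L₂) =
      insertAfter y x L₁ ++ y :: x :: insertAfter y x L₂ := by simp [insertAfter]
  rw [heq, insertAfter_of_notMem hL.1.1, insertAfter_of_notMem hL.1.2]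
  exact ((List.Perm.swap x y L₂).append_left L₁).trans List.perm_middle

theorem mem_fringe {nb : ℕ → List ℕ} {L : List ℕ} {x y : ℕ} :
    (x, y) ∈ fringe nb L ↔ y ∈ L ∧ x ∈ nb y ∧ x ∉ L := by
  simp only [fringe, List.mem_flatMap, List.mem_map, List.mem_filter, Prod.mk.injEq,
    Bool.not_eq_true', List.any_eq_false, decide_eq_true_eq]
  constructor
  · rintro ⟨z, hz, w, ⟨hw, hwL⟩, rfl, rfl⟩
    exact ⟨hz, hw, fun h => hwL w h rfl⟩
  · rintro ⟨hy, hx, hxL⟩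
    exact ⟨y, hy, x, ⟨hx, fun z hz hzx => hxL (hzx ▸ hz)⟩, rfl, rfl⟩

theorem exists_adj_leaving {V : Type*} {G : SimpleGraph V} (hG : G.Preconnected) {S : Set V}
    {a b : V} (ha : a ∈ S) (hb : b ∉ S) : ∃ x ∈ S, ∃ y ∉ S, G.Adj x y := by
  obtain ⟨p⟩ := hG a b
  obtain ⟨e, -, hfst, hsnd⟩ := p.exists_boundary_dart S ha hb
  exact ⟨_, hfst, _, hsnd, e.adj⟩

theorem eq_of_adj_of_walk {V : Type*} {T : SimpleGraph V} (hT : T.IsAcyclic) {x y y' : V}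
    (hxy : T.Adj x y) (hxy' : T.Adj x y') (p : T.Walk y y') (hx : x ∉ p.support) : y = y' := by
  classical
  have hx' : x ∉ p.bypass.support := fun h => hx (p.support_bypass_subset_support h)
  have hpath : (SimpleGraph.Walk.cons hxy p.bypass).IsPath :=
    (SimpleGraph.Walk.cons_isPath_iff _ _).2 ⟨p.bypass_isPath, hx'⟩
  have hpath' : (SimpleGraph.Walk.cons hxy' SimpleGraph.Walk.nil).IsPath := by
    simp [SimpleGraph.Walk.cons_isPath_iff, hxy'.ne]
  have hsupport := congrArg (fun q : T.Path x y' => q.1.support)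
    ((hT.subsingleton_path x y').elim ⟨_, hpath⟩ ⟨_, hpath'⟩)
  simp only [SimpleGraph.Walk.support_cons, SimpleGraph.Walk.support_nil] at hsupport
  have hy : y ∈ p.bypass.support := p.bypass.start_mem_support
  rwa [(List.cons.inj hsupport).2, List.mem_singleton] at hy

section Tree

variable {N : ℕ} {T : SimpleGraph (Fin N)} {nb : ℕ → List ℕ} {L : List ℕ} {x y : ℕ}

/-- Adjacency of nodes that are given as numbers. -/
def NodeAdj (T : SimpleGraph (Fin N)) (i j : ℕ) : Prop :=
  ∃ (hi : i < N) (hj : j < N), T.Adj ⟨i, hi⟩ ⟨j, hj⟩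

theorem NodeAdj.symm {i j : ℕ} : NodeAdj T i j → NodeAdj T j i :=
  fun ⟨hi, hj, h⟩ => ⟨hj, hi, h.symm⟩

/-- The invariant of the construction of the ordering: `L` is the preorder of a forest whose edges
are the adjacencies of `T` within `L`, and `L` induces a connected subgraph of `T`. -/
structure Grown (T : SimpleGraph (Fin N)) (L : List ℕ) : Prop where
  nodup : L.Nodup
  lt : ∀ i ∈ L, i < N
  exists_forest : ∃ t : Forest, t.preorder = L ∧ ∀ a ∈ L, ∀ b ∈ L, NodeAdj T a b →
    (a, b) ∈ t.edges N ∨ (b, a) ∈ t.edges N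
  exists_walk : ∀ a b : Fin N, (a : ℕ) ∈ L → (b : ℕ) ∈ L →
    ∃ p : T.Walk a b, ∀ c ∈ p.support, (c : ℕ) ∈ L
  zero_mem : 0 ∈ L

namespace Grown

theorem singleton_zero (hN : 0 < N) : Grown T [0] where
  nodup := List.nodup_singleton 0
  lt := by simpa using hN
  exists_forest := by
    refine ⟨.node 0 .nil .nil, rfl, fun a ha b hb ⟨_, _, h⟩ => ?_⟩
    obtain rfl := List.mem_singleton.1 ha
    obtain rfl := List.mem_singleton.1 hb
    exact absurd h T.irrefl
  exists_walk a b ha hb := by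
    obtain rfl : a = b := Fin.ext ((List.mem_singleton.1 ha).trans (List.mem_singleton.1 hb).symm)
    exact ⟨.nil, by simpa using ha⟩
  zero_mem := List.mem_singleton_self 0

theorem toFinset_subset (h : Grown T L) : L.toFinset ⊆ Finset.range N := fun i hi =>
  Finset.mem_range.2 (h.lt i (List.mem_toFinset.1 hi))

theorem length_le (h : Grown T L) : L.length ≤ N := by
  simpa [List.toFinset_card_of_nodup h.nodup] using Finset.card_le_card h.toFinset_subset

theorem toFinset_eq_range (h : Grown T L) (hlen : N ≤ L.length) : L.toFinset = Finset.range N :=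
  Finset.eq_of_subset_of_card_le h.toFinset_subset (by
    rwa [List.toFinset_card_of_nodup h.nodup, Finset.card_range])

theorem eq_of_nodeAdj (hT : T.IsAcyclic) (h : Grown T L) (hx : x ∉ L) (hy : y ∈ L)
    (hxy : NodeAdj T x y) {z : ℕ} (hz : z ∈ L) (hxz : NodeAdj T x z) : z = y := by
  obtain ⟨_, hyN, hadj⟩ := hxy
  obtain ⟨_, hzN, hadj'⟩ := hxz
  obtain ⟨p, hp⟩ := h.exists_walk ⟨z, hzN⟩ ⟨y, hyN⟩ hz hy
  exact congrArg Fin.val (eq_of_adj_of_walk hT hadj' hadj p fun hxp => hx (hp _ hxp))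

theorem exists_forest_insertAfter (hT : T.IsAcyclic) (h : Grown T L) (hx : x ∉ L) (hy : y ∈ L)
    (hxy : NodeAdj T x y) : ∃ t : Forest, t.preorder = insertAfter y x L ∧
      ∀ a ∈ x :: L, ∀ b ∈ x :: L, NodeAdj T a b → (a, b) ∈ t.edges N ∨ (b, a) ∈ t.edges N := by
  obtain ⟨t, rfl, hedge⟩ := h.exists_forest
  have hself : (x, y) ∈ (t.insertChild y x).edges N := Forest.mem_edges_insertChild_self hy
  refine ⟨t.insertChild y x, t.preorder_insertChild y x, fun a ha b hb hab => ?_⟩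
  rw [List.mem_cons] at ha hb
  rcases ha with rfl | ha <;> rcases hb with rfl | hb
  · exact absurd hab.2.2 T.irrefl
  · rw [h.eq_of_nodeAdj hT hx hy hxy hb hab]
    exact Or.inl hself
  · rw [h.eq_of_nodeAdj hT hx hy hxy ha hab.symm]
    exact Or.inr hself
  · exact (hedge a ha b hb hab).imp Forest.mem_edges_insertChild Forest.mem_edges_insertChild

theorem exists_walk_cons (h : Grown T L) (hy : y ∈ L) (hxy : NodeAdj T x y) (a b : Fin N)
    (ha : (a : ℕ) ∈ x :: L) (hb : (b : ℕ) ∈ x :: L) :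
    ∃ p : T.Walk a b, ∀ c ∈ p.support, (c : ℕ) ∈ x :: L := by
  obtain ⟨hxN, hyN, hadj⟩ := hxy
  have hxb : ∀ b : Fin N, (b : ℕ) ∈ L → ∃ p : T.Walk ⟨x, hxN⟩ b,
      ∀ c ∈ p.support, (c : ℕ) ∈ x :: L := fun b hb => by
    obtain ⟨p, hp⟩ := h.exists_walk ⟨y, hyN⟩ b hy hb
    exact ⟨.cons hadj p, List.forall_mem_cons.2
      ⟨List.mem_cons_self, fun c hc => List.mem_cons_of_mem x (hp c hc)⟩⟩
  rcases List.mem_cons.1 ha with ha | ha <;> rcases List.mem_cons.1 hb with hb | hb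
  · obtain rfl : a = b := Fin.ext (ha.trans hb.symm)
    exact ⟨.nil, by simp [ha]⟩
  · obtain rfl : a = ⟨x, hxN⟩ := Fin.ext ha
    exact hxb b hb
  · obtain rfl : b = ⟨x, hxN⟩ := Fin.ext hb
    obtain ⟨p, hp⟩ := hxb a ha
    exact ⟨p.reverse, fun c hc => hp c (by simpa using hc)⟩
  · obtain ⟨p, hp⟩ := h.exists_walk a b ha hb
    exact ⟨p, fun c hc => List.mem_cons_of_mem x (hp c hc)⟩

theorem insertAfter (hT : T.IsAcyclic) (h : Grown T L) (hx : x ∉ L) (hy : y ∈ L)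
    (hxy : NodeAdj T x y) : Grown T (insertAfter y x L) := by
  have hperm := insertAfter_perm (x := x) h.nodup hy
  constructor
  · exact hperm.nodup_iff.2 (List.nodup_cons.2 ⟨hx, h.nodup⟩)
  · exact fun i hi => (List.mem_cons.1 (hperm.mem_iff.1 hi)).elim (fun hix => hix ▸ hxy.1) (h.lt i)
  · simpa only [hperm.mem_iff] using h.exists_forest_insertAfter hT hx hy hxy
  · simpa only [hperm.mem_iff] using h.exists_walk_cons hy hxy
  · exact hperm.mem_iff.2 (List.mem_cons_of_mem x h.zero_mem)

theorem exists_mem_fringe (hT : T.Preconnected) (hnb : ∀ i j, j ∈ nb i ↔ NodeAdj T i j)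
    (h : Grown T L) (hlen : L.length < N) : ∃ e, e ∈ fringe nb L := by
  obtain ⟨i, hi, hiL⟩ : ∃ i ∈ Finset.range N, i ∉ L.toFinset := by
    refine Finset.exists_mem_notMem_of_card_lt_card ?_
    rwa [List.toFinset_card_of_nodup h.nodup, Finset.card_range]
  obtain ⟨x, hx, y, hy, hxy⟩ := exists_adj_leaving hT (S := {c : Fin N | (c : ℕ) ∈ L})
    (a := ⟨0, by omega⟩) (b := ⟨i, Finset.mem_range.1 hi⟩) h.zero_mem (by simpa using hiL)
  exact ⟨(y, x), mem_fringe.2 ⟨hx, (hnb _ _).2 ⟨x.2, y.2, hxy⟩, hy⟩⟩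

theorem grow (hT : T.IsTree) (hnb : ∀ i j, j ∈ nb i ↔ NodeAdj T i j) (h : Grown T L) :
    Grown T (grow nb L) ∧ min (L.length + 1) N ≤ (grow nb L).length := by
  unfold MinStableCut.grow
  split_ifs with hfringe
  · refine ⟨h, ?_⟩
    by_contra hlt
    obtain ⟨e, he⟩ := h.exists_mem_fringe hT.1.preconnected hnb (by omega)
    simp [List.length_eq_zero_iff.1 hfringe] at he
  · have hmem : (fringe nb L).getD 0 (0, 0) ∈ fringe nb L := by
      rw [List.getD_eq_getElem _ _ (Nat.pos_of_ne_zero hfringe)]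
      exact List.getElem_mem _
    generalize (fringe nb L).getD 0 (0, 0) = e at hmem ⊢
    obtain ⟨hy, hxy, hx⟩ := mem_fringe.1 hmem
    refine ⟨h.insertAfter hT.2 hx hy ((hnb _ _).1 hxy).symm, ?_⟩
    rw [(insertAfter_perm h.nodup hy).length_eq, List.length_cons]
    exact min_le_left _ _

theorem iterate_grow (hT : T.IsTree) (hN : 0 < N) (hnb : ∀ i j, j ∈ nb i ↔ NodeAdj T i j)
    (k : ℕ) : Grown T ((MinStableCut.grow nb)^[k] [0]) ∧
      min (k + 1) N ≤ ((MinStableCut.grow nb)^[k] [0]).length := by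
  induction k with
  | zero => exact ⟨singleton_zero hN, by simp⟩
  | succ k ih =>
    rw [Function.iterate_succ_apply']
    obtain ⟨hgrown, hlen⟩ := ih.1.grow hT hnb
    exact ⟨hgrown, by omega⟩

end Grown

theorem grown_dfsOrder (hT : T.IsTree) (hN : 0 < N) (hnb : ∀ i j, j ∈ nb i ↔ NodeAdj T i j) :
    Grown T (dfsOrder N nb) ∧ ∀ i, i ∈ dfsOrder N nb ↔ i < N := by
  obtain ⟨hgrown, hlen⟩ := Grown.iterate_grow hT hN hnb N
  rw [← dfsOrder] at hgrown hlen
  refine ⟨hgrown, fun i => ?_⟩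
  rw [← List.mem_toFinset, hgrown.toFinset_eq_range (by omega), Finset.mem_range]

theorem DPData.Layout.derivable_range {d : DPData} (hL : d.Layout (NodeAdj T)) (hdN : d.N = N)
    (hT : T.IsTree) (hN : 0 < N) (hnb : ∀ i j, j ∈ nb i ↔ NodeAdj T i j)
    (horder : d.order = dfsOrder N nb) {K : ℕ} (hK : N < 2 ^ K) :
    d.Derivable (Finset.range d.N) (K * (K + 1) + 1) := by
  obtain ⟨hgrown, hmem⟩ := grown_dfsOrder hT hN hnb
  obtain ⟨t, ht, hedge⟩ := hgrown.exists_forest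
  have hblock : d.Block (NodeAdj T) t N := by
    refine ⟨by rw [ht, horder], fun a ha b hab => ?_, ?_⟩
    · exact hedge a (ht ▸ ha) b ((hmem b).2 hab.2.1) hab
    · simp [ht, hmem]
  have hpreorder : t.preorder.toFinset = Finset.range d.N := by
    ext i; simp [ht, hmem, hdN]
  rw [← hpreorder]
  exact hblock.derivable hL (hdN ▸ hK) K (ht ▸ List.ne_nil_of_mem hgrown.zero_mem)
    (ht ▸ hgrown.length_le.trans_lt hK)

end Tree

end MinStableCut

namespace MinStableCut

open Encoding (encode)

/-! ### Running time of the dynamic program -/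

instance : Encoding DPData :=
  ⟨fun d => encode (d.adj, d.decomp, d.order, d.bagBound, d.scale, d.rounds)⟩

instance : Encoding Entry := ⟨fun e => encode (e.nodes, e.cut, e.score)⟩

theorem encodeSize_filter_le {γ : Type*} [Encoding γ] (l : List γ) (p : γ → Bool) :
    encodeSize (l.filter p) ≤ encodeSize l := by
  induction l with
  | nil => exact le_rfl
  | cons a l ih =>
    rw [List.filter_cons, encodeSize_cons]
    split_ifs
    · rw [encodeSize_cons]; omega
    · omega

theorem encodeSize_le_of_nth_le {l : List ℕ} {B : ℕ} (h : ∀ i, nth l i ≤ B) :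
    encodeSize l ≤ l.length * (encodeSize B + 1) + 1 := by
  refine encodeSize_list_le le_rfl fun v hv => ?_
  obtain ⟨i, hi, rfl⟩ := List.getElem_of_mem hv
  have := h i
  rw [nth, List.getD_eq_getElem _ _ hi] at this
  exact encodeSize_nat_mono this

namespace DPData

theorem encodeSize_prune_le (d : DPData) (T : List Entry) :
    encodeSize (d.prune T) ≤ encodeSize T := by
  induction T using List.reverseRecOn with
  | nil => exact le_rfl
  | append_singleton T e ih =>
    have happend := encodeSize_append T [e]
    rw [encodeSize_cons, encodeSize_nil] at happend
    have hinsert : encodeSize (d.insertCheapest (d.prune T) e) ≤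
        encodeSize (d.prune T) + encodeSize e + 1 := by
      unfold insertCheapest
      split_ifs
      · omega
      · have := encodeSize_filter_le (d.prune T) fun e' => !d.sameKey e e'
        rw [encodeSize_cons]
        omega
    rw [prune_append_singleton]
    omega

theorem length_cutsOn (n : ℕ) (l : List ℕ) : (cutsOn n l).length = 2 ^ l.length := by
  induction l using List.reverseRecOn with
  | nil => rfl
  | append_singleton l v ih =>
    simp only [cutsOn, List.foldl_append, List.foldl_cons, List.foldl_nil, List.length_append,
      List.length_map, List.length_singleton, pow_succ] at ih ⊢
    omega

theorem encodeSize_cutsOn_le (n : ℕ) (l : List ℕ) :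
    encodeSize (cutsOn n l) ≤ 2 ^ l.length * ((n * 3 + 1) + 1) + 1 := by
  refine encodeSize_list_le (length_cutsOn n l).le fun x hx => ?_
  obtain ⟨hlength, hle, -⟩ := mem_cutsOn hx
  simpa [hlength, encodeSize_nat] using encodeSize_le_of_nth_le hle

end DPData

namespace PolyTime

variable {α : Type*} [Encoding α] {m : α → ℕ}

theorem nth {l : α → List ℕ} {i : α → ℕ} (hl : PolyTime m l) (hi : PolyTime m i) :
    PolyTime m fun a => nth (l a) (i a) := hl.getD hi (const_nat 0)

theorem tabulate [SizeMeasure m] {n : α → ℕ} {f : α → ℕ → ℕ} (hn : PolyTime m n)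
    (hnb : PolyBounded m n) (hf : PolyTime (extMeasure m) fun q : α × ℕ => f q.1 q.2) :
    PolyTime m fun a => tabulate (n a) (f a) := (range hn hnb).map hf

theorem sum_range [SizeMeasure m] {n : α → ℕ} {f : α → ℕ → ℕ} (hn : PolyTime m n)
    (hnb : PolyBounded m n) (hf : PolyTime (extMeasure m) fun q : α × ℕ => f q.1 q.2) :
    PolyTime m fun a => ∑ i ∈ Finset.range (n a), f a i :=
  ((range hn hnb).map hf).sum.congr fun _ => rfl

section DPData

variable {d : α → DPData}

theorem toTuple (hd : PolyTime m d) :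
    PolyTime m fun a =>
      ((d a).adj, (d a).decomp, (d a).order, (d a).bagBound, (d a).scale, (d a).rounds) :=
  hd.congr_encode fun _ => rfl

theorem adj (hd : PolyTime m d) : PolyTime m fun a => (d a).adj := hd.toTuple.fst

theorem decomp (hd : PolyTime m d) : PolyTime m fun a => (d a).decomp := hd.toTuple.snd.fst

theorem order (hd : PolyTime m d) : PolyTime m fun a => (d a).order := hd.toTuple.snd.snd.fst

theorem bagBound (hd : PolyTime m d) : PolyTime m fun a => (d a).bagBound :=
  hd.toTuple.snd.snd.snd.fst

theorem scale (hd : PolyTime m d) : PolyTime m fun a => (d a).scale :=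
  hd.toTuple.snd.snd.snd.snd.fst

theorem rounds (hd : PolyTime m d) : PolyTime m fun a => (d a).rounds :=
  hd.toTuple.snd.snd.snd.snd.snd

theorem n (hd : PolyTime m d) : PolyTime m fun a => (d a).n := hd.adj.length

theorem N (hd : PolyTime m d) : PolyTime m fun a => (d a).N := hd.decomp.length

theorem bag {i : α → ℕ} (hd : PolyTime m d) (hi : PolyTime m i) :
    PolyTime m fun a => (d a).bag (i a) :=
  (hd.decomp.getD hi (nil.pair nil)).snd

theorem polyBounded_n (hd : PolyTime m d) : PolyBounded m fun a => (d a).n :=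
  hd.adj.polyBounded.mono fun _ => (length_lt_encodeSize _).le

theorem polyBounded_N (hd : PolyTime m d) : PolyBounded m fun a => (d a).N :=
  hd.decomp.polyBounded.mono fun _ => (length_lt_encodeSize _).le

end DPData

section Entry

variable {e : α → Entry}

theorem toTriple (he : PolyTime m e) : PolyTime m fun a => ((e a).nodes, (e a).cut, (e a).score) :=
  he.congr_encode fun _ => rfl

theorem nodes (he : PolyTime m e) : PolyTime m fun a => (e a).nodes := he.toTriple.fst

theorem cut (he : PolyTime m e) : PolyTime m fun a => (e a).cut := he.toTriple.snd.fst

theorem score (he : PolyTime m e) : PolyTime m fun a => (e a).score := he.toTriple.snd.snd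

theorem entry {S x k : α → List ℕ} (hS : PolyTime m S) (hx : PolyTime m x) (hk : PolyTime m k) :
    PolyTime m fun a => (⟨S a, x a, k a⟩ : Entry) :=
  (hS.pair (hx.pair hk)).congr_encode fun _ => rfl

end Entry

section Graph

variable [SizeMeasure m] {d : α → DPData} {S x : α → List ℕ} {u v i : α → ℕ}

theorem weight (hd : PolyTime m d) (hu : PolyTime m u) (hv : PolyTime m v) :
    PolyTime m fun a => (d a).weight (u a) (v a) :=
  (((hd.adj.getD hu nil).filter (last.fst.eq hv.lift)).map last.snd).sum

theorem inBag (hd : PolyTime m d) (hi : PolyTime m i) (hv : PolyTime m v) :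
    PolyTime m fun a => (d a).inBag (i a) (v a) :=
  (hd.bag hi).any (last.eq hv.lift)

theorem owner (hd : PolyTime m d) (hu : PolyTime m u) (hv : PolyTime m v) :
    PolyTime m fun a => (d a).owner (u a) (v a) :=
  nth ((range hd.N hd.polyBounded_N).filter ((hd.lift.inBag last hu.lift).and
    (hd.lift.inBag last hv.lift))) (const_nat 0)

theorem ownedWeight (hd : PolyTime m d) (hS : PolyTime m S) (hu : PolyTime m u)
    (hv : PolyTime m v) :
    PolyTime m fun a => (d a).ownedWeight (MinStableCut.nth (S a)) (u a) (v a) :=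
  ite ((hS.nth (hd.owner hu hv)).eq (const_nat 0)) (const_nat 0) (hd.weight hu hv)

theorem degreeIn (hd : PolyTime m d) (hS : PolyTime m S) (hv : PolyTime m v) :
    PolyTime m fun a => (d a).degreeIn (MinStableCut.nth (S a)) (v a) :=
  sum_range hd.n hd.polyBounded_n (hd.lift.ownedWeight hS.lift hv.lift last)

theorem crossingIn (hd : PolyTime m d) (hS : PolyTime m S) (hx : PolyTime m x)
    (hv : PolyTime m v) :
    PolyTime m fun a =>
      (d a).crossingIn (MinStableCut.nth (S a)) (MinStableCut.nth (x a)) (v a) :=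
  sum_range hd.n hd.polyBounded_n (ite ((hx.lift.nth last).eq (hx.lift.nth hv.lift))
    (const_nat 0) (hd.lift.ownedWeight hS.lift hv.lift last))

theorem cutCost (hd : PolyTime m d) (hS : PolyTime m S) (hx : PolyTime m x) :
    PolyTime m fun a => (d a).cutCost (MinStableCut.nth (S a)) (MinStableCut.nth (x a)) := by
  have hcross := ((hx.lift.lift.nth (last (m := m)).lift).eq (const_nat 0)).and
    ((hx.lift.lift.nth last).eq (const_nat 0)).not
  exact sum_range hd.n hd.polyBounded_n (sum_range hd.lift.n hd.lift.polyBounded_n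
    (ite (hcross.congr fun _ => by rw [Bool.decide_and, decide_not])
      (hd.lift.lift.ownedWeight hS.lift.lift last.lift last) (const_nat 0)))

theorem occursIn (hd : PolyTime m d) (hS : PolyTime m S) (hv : PolyTime m v) :
    PolyTime m fun a => (d a).occursIn (MinStableCut.nth (S a)) (v a) :=
  (range hd.N hd.polyBounded_N).any (((const_nat 0).lt (hS.lift.nth last)).and
    (hd.lift.inBag last hv.lift))

theorem occursOutside (hd : PolyTime m d) (hS : PolyTime m S) (hv : PolyTime m v) :
    PolyTime m fun a => (d a).occursOutside (MinStableCut.nth (S a)) (v a) :=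
  (range hd.N hd.polyBounded_N).any (((hS.lift.nth last).eq (const_nat 0)).and
    (hd.lift.inBag last hv.lift))

theorem isBoundary (hd : PolyTime m d) (hS : PolyTime m S) (hv : PolyTime m v) :
    PolyTime m fun a => (d a).isBoundary (MinStableCut.nth (S a)) (v a) :=
  (hd.occursIn hS hv).and (hd.occursOutside hS hv)

theorem isIntervalDiff (hd : PolyTime m d) (hS : PolyTime m S) :
    PolyTime m fun a => (d a).isIntervalDiff (MinStableCut.nth (S a)) := by
  have hrange : ∀ {β : Type _} [Encoding β] {m : β → ℕ} {d : β → DPData}, PolyTime m d →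
      PolyTime m fun a => List.range ((d a).N + 1) := fun hd =>
    range (hd.N.add (const_nat 1)) (hd.polyBounded_N.add (.const _ 1))
  have hd₄ := hd.lift (γ := ℕ) |>.lift (γ := ℕ) |>.lift (γ := ℕ) |>.lift (γ := ℕ)
  have hS₅ := hS.lift (γ := ℕ) |>.lift (γ := ℕ) |>.lift (γ := ℕ) |>.lift (γ := ℕ) |>.lift (γ := ℕ)
  exact any (hrange hd) (any (hrange hd.lift) (any (hrange hd.lift.lift)
    (any (hrange hd.lift.lift.lift) (all (range hd₄.N hd₄.polyBounded_N)
      (((const_nat 0).lt (hS₅.nth (hd₄.lift.order.nth last))).beq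
        (((last.lift.lift.lift.lift.le last).and (last.lt last.lift.lift.lift)).and
          ((last.lift.lift.le last).and (last.lt last.lift)).not))))))

theorem boundarySize (hd : PolyTime m d) (hS : PolyTime m S) :
    PolyTime m fun a => (d a).boundarySize (MinStableCut.nth (S a)) :=
  ((range hd.n hd.polyBounded_n).filter (hd.lift.isBoundary hS.lift last)).length

end Graph

section Tables

variable [SizeMeasure m] {d : α → DPData} {x l : α → List ℕ} {i : α → ℕ} {e e' : α → Entry}
  {T : α → List Entry}

theorem good (hd : PolyTime m d) (he : PolyTime m e) : PolyTime m fun a => (d a).good (e a) := by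
  have hadmissible := (hd.isIntervalDiff he.nodes).and
    ((hd.boundarySize he.nodes).le ((const_nat 2).mul hd.bagBound))
  have hdegree := (hd.lift (γ := ℕ)).degreeIn he.lift.nodes last
  have hscore := (he.lift.score.nth (last (m := m))).add (hd.lift.rounds.add (const_nat 1))
  exact hadmissible.and ((range hd.n hd.polyBounded_n).all
    ((hd.lift.isBoundary he.lift.nodes last).or
      ((hd.lift.scale.mul hdegree).le (((const_nat 2).mul hscore).mul hdegree))))

theorem sameKey (hd : PolyTime m d) (he : PolyTime m e) (he' : PolyTime m e') :
    PolyTime m fun a => (d a).sameKey (e a) (e' a) :=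
  ((range hd.N hd.polyBounded_N).all ((he.lift.nodes.nth last).eq (he'.lift.nodes.nth last))).and
    ((range hd.n hd.polyBounded_n).all ((hd.lift.isBoundary he.lift.nodes last).not.or
      (((he.lift.cut.nth last).eq (he'.lift.cut.nth last)).and
        ((he.lift.score.nth last).eq (he'.lift.score.nth last)))))

theorem compatible (hd : PolyTime m d) (he : PolyTime m e) (he' : PolyTime m e') :
    PolyTime m fun a => (d a).compatible (e a) (e' a) :=
  ((range hd.N hd.polyBounded_N).all (((he.lift.nodes.nth last).eq (const_nat 0)).or
      ((he'.lift.nodes.nth last).eq (const_nat 0)))).and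
    ((range hd.n hd.polyBounded_n).all (((hd.lift.occursIn he.lift.nodes last).and
      (hd.lift.occursIn he'.lift.nodes last)).not.or
        ((he.lift.cut.nth last).eq (he'.lift.cut.nth last))))

theorem mergeScore (hd : PolyTime m d) (he : PolyTime m e) (he' : PolyTime m e')
    (hi : PolyTime m i) : PolyTime m fun a => (d a).mergeScore (e a) (e' a) (i a) :=
  (((he.score.nth hi).mul (hd.degreeIn he.nodes hi)).add
      ((he'.score.nth hi).mul (hd.degreeIn he'.nodes hi))).div
    ((hd.degreeIn he.nodes hi).add (hd.degreeIn he'.nodes hi))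

theorem merge (hd : PolyTime m d) (he : PolyTime m e) (he' : PolyTime m e') :
    PolyTime m fun a => (d a).merge (e a) (e' a) :=
  entry (tabulate hd.N hd.polyBounded_N ((he.lift.nodes.nth last).add (he'.lift.nodes.nth last)))
    (tabulate hd.n hd.polyBounded_n (ite ((he.lift.cut.nth last).eq (const_nat 0))
      (he'.lift.cut.nth last) (he.lift.cut.nth last)))
    (tabulate hd.n hd.polyBounded_n (hd.lift.mergeScore he.lift he'.lift last))

theorem singleNode (hd : PolyTime m d) (hi : PolyTime m i) :
    PolyTime m fun a => (d a).singleNode (i a) :=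
  tabulate hd.N hd.polyBounded_N (ite (last.eq hi.lift) (const_nat 1) (const_nat 0))

theorem leaf (hd : PolyTime m d) (hi : PolyTime m i) (hx : PolyTime m x) :
    PolyTime m fun a => (d a).leaf (i a) (x a) := by
  have hnode := hd.singleNode hi
  exact entry hnode hx (tabulate hd.n hd.polyBounded_n ((hd.lift.scale.mul
    (hd.lift.crossingIn hnode.lift hx.lift last)).div (hd.lift.degreeIn hnode.lift last)))

theorem insertCheapest (hd : PolyTime m d) (hT : PolyTime m T) (he : PolyTime m e) :
    PolyTime m fun a => (d a).insertCheapest (T a) (e a) := by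
  have hsame := hd.lift.sameKey he.lift (last (m := m))
  have hcost := (hd.lift.cutCost (last (m := m)).nodes last.cut).le
    (hd.lift.cutCost he.lift.nodes he.lift.cut)
  refine ite (PolyTime.congr ?_ fun _ => Bool.decide_eq_true) hT (he.cons (hT.filter hsame.not))
  exact hT.any (hsame.and hcost)

theorem prune (hd : PolyTime m d) (hT : PolyTime m T) : PolyTime m fun a => (d a).prune (T a) :=
  foldl hT nil (hd.lift.lift.insertCheapest last.lift last) hT.polyBounded
    fun a j _ => ((d a).encodeSize_prune_le _).trans (encodeSize_take_le _ j)

theorem step (hd : PolyTime m d) (hT : PolyTime m T) : PolyTime m fun a => (d a).step (T a) := by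
  have hmerges : PolyTime m fun a => (d a).merges (T a) := by
    refine (hT.flatMap ?_).filter (hd.lift.good last)
    exact (hT.lift.filter (hd.lift.lift.compatible last.lift last)).map
      (hd.lift.lift.merge last.lift last)
  exact hd.prune (hT.append hmerges)

theorem cutsOn {n : α → ℕ} (hn : PolyTime m n) (hnb : PolyBounded m n) (hl : PolyTime m l)
    (hlb : PolyBounded m fun a => 2 ^ (l a).length) :
    PolyTime m fun a => DPData.cutsOn (n a) (l a) := by
  refine foldl (B := fun a => 2 ^ (l a).length * ((n a * 3 + 1) + 1) + 1) hl
    ((tabulate hn hnb (const_nat 0)).cons nil)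
    (last.lift.append (last.lift.map (tabulate hn.lift.lift.lift hnb.lift.lift.lift
      (ite (last.eq last.lift.lift) (const_nat 1) (last.lift.nth last))))) ?_ fun a j _ => ?_
  · exact (hlb.mul (((hnb.mul (.const m 3)).add (.const m 1)).add (.const m 1))).add (.const m 1)
  · refine (DPData.encodeSize_cutsOn_le (n a) _).trans ?_
    gcongr
    · norm_num
    · exact List.length_take_le' ..

theorem leaves (hd : PolyTime m d) (hbag : ∀ a i, ((d a).bag i).length ≤ (d a).bagBound)
    (hb : PolyBounded m fun a => 2 ^ (d a).bagBound) : PolyTime m fun a => (d a).leaves := by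
  have hpow : PolyBounded (extMeasure m) fun q : α × ℕ => 2 ^ ((d q.1).bag q.2).length :=
    hb.lift.mono fun q => Nat.pow_le_pow_right two_pos (hbag q.1 q.2)
  refine ((range hd.N hd.polyBounded_N).flatMap ?_).filter (hd.lift.good last)
  exact (cutsOn hd.lift.n hd.lift.polyBounded_n (hd.lift.bag last) hpow).map
    (hd.lift.lift.leaf last.lift last)

end Tables

end PolyTime

end MinStableCut

namespace MinStableCut

theorem eq_of_nth_eq {l l' : List ℕ} (hlength : l.length = l'.length)
    (h : ∀ i < l.length, nth l i = nth l' i) : l = l' :=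
  List.ext_getElem hlength fun i hi hi' => by
    simpa only [nth, List.getD_eq_getElem _ _ hi, List.getD_eq_getElem _ _ hi'] using h i hi

namespace DPData

variable {d : DPData} {A : ℕ → ℕ → Prop} {e : Entry}

theorem WellFormed.encodeSize_le (h : d.WellFormed e) :
    encodeSize e ≤ (d.N * 3 + 1) + (d.n * 3 + 1) + (d.n * (encodeSize d.scale + 1) + 1) + 2 := by
  have hnodes := encodeSize_le_of_nth_le h.nodes_le_one
  have hcut := encodeSize_le_of_nth_le h.cut_le_one
  have hscore := encodeSize_le_of_nth_le h.score_le
  have hone : encodeSize 1 = 2 := by simp [encodeSize_nat]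
  have he : encodeSize e = encodeSize e.nodes + (encodeSize e.cut + encodeSize e.score + 1) + 1 :=
    rfl
  rw [h.length_nodes, hone] at hnodes
  rw [h.length_cut, hone] at hcut
  rw [h.length_score] at hscore
  omega

/-- A bound on the number of keys of entries: the node set is given by the four ends of two
intervals, and every boundary vertex has a side and a score. -/
def keyBound (d : DPData) : ℕ := (d.N + 1) ^ 4 * (2 * (d.scale + 1)) ^ (2 * d.bagBound)

/-- The difference of the intervals `[c.1.1, c.1.2)` and `[c.2.1, c.2.2)` of the ordering. -/
def intervalDiff (d : DPData) (c : (ℕ × ℕ) × ℕ × ℕ) : List ℕ :=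
  tabulate d.N fun j => if (c.1.1 ≤ d.order.idxOf j ∧ d.order.idxOf j < c.1.2) ∧
    ¬(c.2.1 ≤ d.order.idxOf j ∧ d.order.idxOf j < c.2.2) then 1 else 0

theorem Layout.exists_intervalDiff_eq (hL : d.Layout A) (he : d.WellFormed e) :
    ∃ c ∈ (Finset.range (d.N + 1) ×ˢ Finset.range (d.N + 1)) ×ˢ
      (Finset.range (d.N + 1) ×ˢ Finset.range (d.N + 1)), d.intervalDiff c = e.nodes := by
  have hdiff : d.isIntervalDiff (nth e.nodes) :=
    (Bool.and_eq_true_iff.1 (good_iff.1 he.good).1).1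
  simp only [isIntervalDiff, List.any_eq_true, List.all_eq_true, List.mem_range, beq_iff_eq]
    at hdiff
  obtain ⟨a, ha, b, hb, s, hs, t, ht, hnodes⟩ := hdiff
  refine ⟨((a, b), (s, t)), by simp; omega, eq_of_nth_eq ?_ fun j hj => ?_⟩
  · rw [he.length_nodes]; exact length_tabulate _ _
  · replace hj : j < d.N := hj.trans_eq (length_tabulate _ _)
    have hidx := List.idxOf_lt_length_of_mem ((hL.mem_order j).2 hj)
    have hj_nodes := hnodes _ (hL.length_order ▸ hidx)
    rw [show nth d.order (d.order.idxOf j) = j by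
      rw [nth, List.getD_eq_getElem _ _ hidx, List.getElem_idxOf]] at hj_nodes
    have hle := he.nodes_le_one j
    rw [intervalDiff, nth_tabulate, if_pos hj]
    grind

theorem Layout.card_image_nodes_le (hL : d.Layout A) [DecidableEq (List ℕ)] {F : Finset Entry}
    (hF : ∀ e ∈ F, d.WellFormed e) : (F.image Entry.nodes).card ≤ (d.N + 1) ^ 4 := by
  have hsub : F.image Entry.nodes ⊆ Finset.image d.intervalDiff
      ((Finset.range (d.N + 1) ×ˢ Finset.range (d.N + 1)) ×ˢ
        (Finset.range (d.N + 1) ×ˢ Finset.range (d.N + 1))) := by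
    intro S hS
    obtain ⟨e, he, rfl⟩ := Finset.mem_image.1 hS
    exact Finset.mem_image.2 (hL.exists_intervalDiff_eq (hF e he))
  refine (Finset.card_le_card hsub).trans (Finset.card_image_le.trans_eq ?_)
  simp only [Finset.card_product, Finset.card_range]
  ring

theorem card_le_of_nodes_eq {F : Finset Entry} {S : List ℕ} (hF : ∀ e ∈ F, d.WellFormed e)
    (hkey : ∀ e ∈ F, ∀ e' ∈ F, d.sameKey e e' → e = e') (hS : ∀ e ∈ F, e.nodes = S) :
    F.card ≤ (2 * (d.scale + 1)) ^ (2 * d.bagBound) := by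
  obtain rfl | ⟨e₀, he₀⟩ := F.eq_empty_or_nonempty
  · exact Nat.zero_le _
  set B := ((List.range d.n).filter fun v => d.isBoundary (nth S) v).toFinset with hB
  have hBcard : B.card ≤ 2 * d.bagBound := by
    have hsize := (Bool.and_eq_true_iff.1 (good_iff.1 (hF e₀ he₀).good).1).2
    rw [hS e₀ he₀] at hsize
    exact (List.toFinset_card_le _).trans (of_decide_eq_true hsize)
  calc F.card ≤ (B.pi fun _ => Finset.range 2 ×ˢ Finset.range (d.scale + 1)).card := by
        refine Finset.card_le_card_of_injOn (fun e v _ => (nth e.cut v, nth e.score v))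
          (fun e he => ?_) fun e he e' he' heq => hkey e he e' he' (sameKey_iff.2 ⟨?_, ?_⟩)
        · refine Finset.mem_coe.2 (Finset.mem_pi.2 fun v _ => ?_)
          exact Finset.mk_mem_product
            (Finset.mem_range.2 (Nat.lt_succ_of_le ((hF e he).cut_le_one v)))
            (Finset.mem_range.2 (Nat.lt_succ_of_le ((hF e he).score_le v)))
        · simp [hS e he, hS e' he']
        · intro v hv hvB
          rw [hS e he] at hvB
          simpa using congrFun (congrFun heq v) (by simp [hB, hv, hvB])
    _ = (2 * (d.scale + 1)) ^ B.card := by simp [Finset.card_pi]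
    _ ≤ (2 * (d.scale + 1)) ^ (2 * d.bagBound) := Nat.pow_le_pow_right (by omega) hBcard

theorem Layout.length_le_keyBound (hL : d.Layout A) {T : List Entry}
    (hT : ∀ e ∈ T, d.WellFormed e) (hkey : T.Pairwise fun e e' => ¬ d.sameKey e e') :
    T.length ≤ d.keyBound := by
  classical
  have hnodup : T.Nodup := hkey.imp fun {e e'} h (he : e = e') => h (he ▸ sameKey_refl e)
  have hsymm : Std.Symm fun e e' : Entry => ¬ d.sameKey e e' :=
    ⟨fun _ _ h h' => h (sameKey_symm h')⟩
  have hF : ∀ e ∈ T.toFinset, d.WellFormed e := fun e he => hT e (List.mem_toFinset.1 he)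
  have hinj : ∀ e ∈ T.toFinset, ∀ e' ∈ T.toFinset, d.sameKey e e' → e = e' :=
    fun e he e' he' h => by
      by_contra hne
      exact hkey.forall (List.mem_toFinset.1 he) (List.mem_toFinset.1 he') hne h
  have hfiber : ∀ S ∈ T.toFinset.image Entry.nodes,
      (T.toFinset.filter fun e => e.nodes = S).card ≤ (2 * (d.scale + 1)) ^ (2 * d.bagBound) := by
    refine fun S _ => card_le_of_nodes_eq (S := S) (fun e he => hF e (Finset.filter_subset _ _ he))
      (fun e he e' he' => hinj e (Finset.filter_subset _ _ he) e' (Finset.filter_subset _ _ he'))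
      fun e he => (Finset.mem_filter.1 he).2
  calc T.length = T.toFinset.card := (List.toFinset_card_of_nodup hnodup).symm
    _ ≤ (2 * (d.scale + 1)) ^ (2 * d.bagBound) * (T.toFinset.image Entry.nodes).card :=
        Finset.card_le_mul_card_image _ _ hfiber
    _ ≤ (2 * (d.scale + 1)) ^ (2 * d.bagBound) * (d.N + 1) ^ 4 :=
        Nat.mul_le_mul_left _ (hL.card_image_nodes_le hF)
    _ = d.keyBound := mul_comm _ _

theorem Layout.encodeSize_table_le (hL : d.Layout A) (hd : d.Valid) (r : ℕ) :
    encodeSize (d.table r) ≤ d.keyBound *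
      ((d.N * 3 + 1) + (d.n * 3 + 1) + (d.n * (encodeSize d.scale + 1) + 1) + 2 + 1) + 1 :=
  encodeSize_list_le
    (hL.length_le_keyBound (fun _ he => wellFormed_of_mem_table hd he) (pairwise_table r))
    fun _ he => (wellFormed_of_mem_table hd he).encodeSize_le

theorem two_pow_bagBound_le_keyBound (d : DPData) : 2 ^ d.bagBound ≤ d.keyBound :=
  calc 2 ^ d.bagBound ≤ (2 * (d.scale + 1)) ^ d.bagBound := Nat.pow_le_pow_left (by omega) _
    _ ≤ (2 * (d.scale + 1)) ^ (2 * d.bagBound) := Nat.pow_le_pow_right (by omega) (by omega)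
    _ ≤ d.keyBound := Nat.le_mul_of_pos_left _ (by positivity)

end DPData

theorem PolyTime.output {α : Type*} [Encoding α] {m : α → ℕ} [SizeMeasure m] {d : α → DPData}
    {A : α → ℕ → ℕ → Prop} (hd : PolyTime m d) (hrounds : PolyBounded m fun a => (d a).rounds)
    (hkeys : PolyBounded m fun a => (d a).keyBound) (hvalid : ∀ a, (d a).Valid)
    (hL : ∀ a, (d a).Layout (A a)) : PolyTime m fun a => (d a).output := by
  have hpow : PolyBounded m fun a => 2 ^ (d a).bagBound :=
    hkeys.mono fun a => (d a).two_pow_bagBound_le_keyBound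
  have hsize : PolyBounded m fun a => (d a).keyBound * (((d a).N * 3 + 1) + ((d a).n * 3 + 1) +
      ((d a).n * (encodeSize (d a).scale + 1) + 1) + 2 + 1) + 1 :=
    (hkeys.mul ((((((hd.polyBounded_N.mul (.const m 3)).add (.const m 1)).add
      ((hd.polyBounded_n.mul (.const m 3)).add (.const m 1))).add
      ((hd.polyBounded_n.mul (hd.scale.polyBounded.add (.const m 1))).add (.const m 1))).add
      (.const m 2)).add (.const m 1))).add (.const m 1)
  have htable : PolyTime m fun a => (d a).table (d a).rounds :=
    iterate hd.rounds hrounds (hd.prune (hd.leaves (fun a => (hL a).length_bag_le) hpow))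
      (hd.lift.step last) hsize fun a j _ => (hL a).encodeSize_table_le (hvalid a) j
  exact ((htable.filter ((range hd.lift.N hd.lift.polyBounded_N).all
    ((const_nat 0).lt (last.lift.nodes.nth last)))).getD (const_nat 0) (entry nil nil nil)).cut

end MinStableCut

/-! ### Existence of stable cuts -/

namespace MinStableCut

section StableCut

variable {V : Type} (G : SimpleGraph V) (w : Sym2 V → ℕ)

open Classical in
/-- The weight of a pair of vertices, `0` for non-edges. -/
noncomputable def pairWeight (u v : V) : ℕ := if G.Adj u v then w s(u, v) else 0

theorem pairWeight_comm (u v : V) : pairWeight G w u v = pairWeight G w v u := by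
  rw [pairWeight, pairWeight, Sym2.eq_swap]
  by_cases h : G.Adj u v <;> simp [G.adj_comm v u, h]

variable [Fintype V]

theorem weightedDegree_eq (v : V) : weightedDegree G w v = ∑ u, pairWeight G w v u := rfl

theorem crossWeight_eq (side : V → Bool) (v : V) :
    crossWeight G w side v = ∑ u, if side u = side v then 0 else pairWeight G w v u := by
  refine Finset.sum_congr rfl fun u _ => ?_
  unfold pairWeight
  by_cases hside : side u = side v <;> by_cases hadj : G.Adj v u <;> simp [hside, hadj]

theorem cutWeight_eq (side : V → Bool) : cutWeight G w side =
    ∑ u, ∑ v, if side u = false ∧ side v then pairWeight G w u v else 0 := by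
  refine Finset.sum_congr rfl fun u _ => Finset.sum_congr rfl fun v _ => ?_
  unfold pairWeight
  by_cases hside : side u = false ∧ side v <;> by_cases hadj : G.Adj u v <;> simp [hside, hadj]

theorem sum_crossWeight_eq [DecidableEq V] (side : V → Bool) (v : V) :
    ∑ u, crossWeight G w side u =
      (∑ u ∈ Finset.univ.erase v, ∑ t ∈ Finset.univ.erase v,
        if side t = side u then 0 else pairWeight G w u t) + 2 * crossWeight G w side v := by
  have hsplit : ∀ u, crossWeight G w side u =
      (if side v = side u then 0 else pairWeight G w u v) +
        ∑ t ∈ Finset.univ.erase v, if side t = side u then 0 else pairWeight G w u t := fun u => by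
    rw [crossWeight_eq, ← Finset.add_sum_erase _ _ (Finset.mem_univ v)]
  have hcross : crossWeight G w side v =
      ∑ u ∈ Finset.univ.erase v, if side v = side u then 0 else pairWeight G w u v := by
    rw [hsplit v, if_pos rfl, zero_add]
    refine Finset.sum_congr rfl fun u _ => ?_
    rw [pairWeight_comm]
    simp only [eq_comm]
  rw [← Finset.add_sum_erase _ _ (Finset.mem_univ v),
    Finset.sum_congr rfl fun u _ => hsplit u, Finset.sum_add_distrib, ← hcross]
  ring

theorem crossWeight_update_not_add [DecidableEq V] (side : V → Bool) (v : V) :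
    crossWeight G w (Function.update side v (!side v)) v + crossWeight G w side v =
      weightedDegree G w v := by
  rw [weightedDegree_eq, crossWeight_eq, crossWeight_eq, ← Finset.sum_add_distrib]
  refine Finset.sum_congr rfl fun u _ => ?_
  rcases eq_or_ne u v with rfl | hu
  · simp [pairWeight]
  · rw [Function.update_of_ne hu, Function.update_self]
    cases side u <;> cases side v <;> simp

/-- A cut of maximum weight is stable, since no flip of a single vertex improves it. -/
theorem exists_isStable : ∃ side : V → Bool, IsStable G w side := by
  classical
  obtain ⟨side, -, hmax⟩ := Finset.exists_max_image Finset.univ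
    (fun side : V → Bool => ∑ v, crossWeight G w side v) Finset.univ_nonempty
  refine ⟨side, fun v => ?_⟩
  have hflip := hmax (Function.update side v (!side v)) (Finset.mem_univ _)
  rw [sum_crossWeight_eq G w _ v, sum_crossWeight_eq G w side v] at hflip
  have hrest : (∑ u ∈ Finset.univ.erase v, ∑ t ∈ Finset.univ.erase v,
      if Function.update side v (!side v) t = Function.update side v (!side v) u then 0
        else pairWeight G w u t) =
      ∑ u ∈ Finset.univ.erase v, ∑ t ∈ Finset.univ.erase v,
        if side t = side u then 0 else pairWeight G w u t :=
    Finset.sum_congr rfl fun u hu => Finset.sum_congr rfl fun t ht => by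
      rw [Function.update_of_ne (Finset.ne_of_mem_erase hu),
        Function.update_of_ne (Finset.ne_of_mem_erase ht)]
  have hdegree := crossWeight_update_not_add G w side v
  rw [div_le_iff₀ (by norm_num)]
  exact_mod_cast (by omega : weightedDegree G w v ≤ crossWeight G w side v * 2)

end StableCut

end MinStableCut

/-! ### Instances as input of the dynamic program -/

namespace MinStableCut

open Encoding (encode)

theorem getD_map_finRange {α : Type*} {n : ℕ} (f : Fin n → α) (i : ℕ) (d : α) :
    ((List.finRange n).map f).getD i d = if h : i < n then f ⟨i, h⟩ else d := by
  rw [List.getD_eq_getElem?_getD]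
  split_ifs with h <;> simp [h]

theorem mem_map_val_filter_finRange {n : ℕ} {p : Fin n → Bool} {i : ℕ} :
    i ∈ ((List.finRange n).filter p).map Fin.val ↔ ∃ h : i < n, p ⟨i, h⟩ := by
  simp only [List.mem_map, List.mem_filter, List.mem_finRange, true_and]
  exact ⟨fun ⟨j, hj, h⟩ => h ▸ ⟨j.2, hj⟩, fun ⟨h, hi⟩ => ⟨⟨i, h⟩, hi, rfl⟩⟩

theorem sum_map_filter {α : Type*} (l : List α) (p : α → Bool) (f : α → ℕ) :
    ((l.filter p).map f).sum = (l.map fun a => if p a then f a else 0).sum := by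
  induction l with
  | nil => rfl
  | cons a l ih => by_cases h : p a <;> simp [h, ih]

theorem foldl_max_le_iff {α : Type*} (l : List α) (f : α → ℕ) {a k : ℕ} :
    l.foldl (fun j c => max j (f c)) a ≤ k ↔ a ≤ k ∧ ∀ c ∈ l, f c ≤ k := by
  induction l generalizing a with
  | nil => simp
  | cons c l ih => simp [ih, and_assoc]

/-- An instance of the problem. -/
structure Instance where
  n : ℕ
  N : ℕ
  G : SimpleGraph (Fin n)
  w : Sym2 (Fin n) → ℕ
  D : TreeDecomposition G N
  ε : ℚ
  ε_pos : 0 < ε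

noncomputable instance : Encoding Instance := ⟨fun I => encodeInput I.G I.w I.D I.ε⟩

namespace Instance

variable (I : Instance)

open Classical in
/-- The weighted adjacency lists of the graph. -/
noncomputable def adj : List (List (ℕ × ℕ)) :=
  (List.finRange I.n).map fun v => ((List.finRange I.n).filter fun u => I.G.Adj v u).map
    fun u : Fin I.n => ((u : ℕ), I.w s(v, u))

open Classical in
/-- The neighbours and the bag of each node of the tree decomposition. -/
noncomputable def decomp : List (List ℕ × List ℕ) :=
  (List.finRange I.N).map fun i =>
    (((List.finRange I.N).filter fun j => I.D.tree.Adj i j).map Fin.val,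
      ((List.finRange I.n).filter fun v => v ∈ I.D.bag i).map Fin.val)

/-- The components of the input. The last `0` ends the list of components. -/
noncomputable def components :
    ℕ × ℕ × List (List (ℕ × ℕ)) × List (List ℕ × List ℕ) × ℕ × ℕ × ℕ :=
  (I.n, I.N, I.adj, I.decomp, I.ε.num.toNat, I.ε.den, 0)

theorem encode_components : encode I.components = encode I := by
  have hadj : encode I.adj = encodeGraph I.G I.w := by
    simp only [encode, adj, encodeGraph, List.map_map, Function.comp_def]
  have hdecomp : encode I.decomp = encodeDecomposition I.D := by
    simp only [encode, decomp, encodeDecomposition, List.map_map, Function.comp_def]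
  change _ = encodeInput I.G I.w I.D I.ε
  rw [encodeInput, ← hadj, ← hdecomp]
  rfl

/-- The neighbours of a node. -/
noncomputable def neighbours (i : ℕ) : List ℕ := (I.decomp.getD i ([], [])).1

/-- The maximum size of a bag. -/
noncomputable def maxBag : ℕ := I.decomp.foldl (fun k e => max k e.2.length) 0

/-- The number of rounds of the dynamic program, of order `log² N`. -/
noncomputable def rounds : ℕ := I.N.size * (I.N.size + 1)

/-- The input of the dynamic program. The scale is chosen so large that an error of `rounds + 1`
steps is at most the fraction `ε / 2` of it. -/
noncomputable def data : DPData where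
  adj := I.adj
  decomp := I.decomp
  order := dfsOrder I.N I.neighbours
  bagBound := I.maxBag
  scale := 2 * (I.rounds + 1) * I.ε.den / I.ε.num.toNat + 1
  rounds := I.rounds

/-- The instances in which every cut satisfies the relaxed stability condition, because there are
no edges or `1 ≤ ε`. -/
noncomputable def isTrivial : Bool := decide (I.maxBag ≤ 1) || decide (I.ε.den ≤ I.ε.num.toNat)

/-- The output of the algorithm. -/
noncomputable def solution : List ℕ :=
  if I.isTrivial then tabulate I.n fun _ => 0 else I.data.output

variable {I}

theorem data_n : I.data.n = I.n := by simp [DPData.n, data, adj]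

theorem data_N : I.data.N = I.N := by simp [DPData.N, data, decomp]

open Classical in
theorem neighbours_eq (i : ℕ) : I.neighbours i = if h : i < I.N then
    ((List.finRange I.N).filter fun j => I.D.tree.Adj ⟨i, h⟩ j).map Fin.val else [] := by
  rw [neighbours, decomp, getD_map_finRange]
  split_ifs <;> rfl

open Classical in
theorem bag_eq (i : ℕ) : I.data.bag i = if h : i < I.N then
    ((List.finRange I.n).filter fun v => v ∈ I.D.bag ⟨i, h⟩).map Fin.val else [] := by
  rw [DPData.bag, data, decomp, getD_map_finRange]
  split_ifs <;> rfl

open Classical in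
theorem weight_eq (u v : ℕ) : I.data.weight u v =
    if h : u < I.n ∧ v < I.n then pairWeight I.G I.w ⟨u, h.1⟩ ⟨v, h.2⟩ else 0 := by
  rw [DPData.weight, data, adj, getD_map_finRange]
  by_cases hu : u < I.n
  · rw [dif_pos hu, sum_map_filter, List.map_map, sum_map_filter, ← Fin.sum_univ_def]
    by_cases hv : v < I.n
    · rw [dif_pos ⟨hu, hv⟩, Finset.sum_eq_single ⟨v, hv⟩]
      · simp [pairWeight]
      · intro t _ ht
        have htv : (t : ℕ) ≠ v := fun h => ht (Fin.ext h)
        simp [htv]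
      · simp
    · rw [dif_neg fun h => hv h.2]
      refine Finset.sum_eq_zero fun t _ => ?_
      have htv : (t : ℕ) ≠ v := fun h => hv (h ▸ t.2)
      simp [htv]
  · rw [dif_neg hu, dif_neg fun h => hu h.1]
    simp

theorem mem_neighbours (i j : ℕ) : j ∈ I.neighbours i ↔ NodeAdj I.D.tree i j := by
  rw [neighbours_eq, NodeAdj]
  split_ifs with hi
  · simp only [mem_map_val_filter_finRange, decide_eq_true_eq, hi, exists_true_left]
  · simp [hi]

theorem inBag_iff {i v : ℕ} : I.data.inBag i v ↔
    ∃ (hi : i < I.N) (hv : v < I.n), (⟨v, hv⟩ : Fin I.n) ∈ I.D.bag ⟨i, hi⟩ := by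
  rw [DPData.inBag_iff, bag_eq]
  split_ifs with hi
  · simp only [mem_map_val_filter_finRange, decide_eq_true_eq, hi, exists_true_left]
  · simp [hi]

theorem length_bag (i : Fin I.N) : (I.data.bag i).length = (I.D.bag i).card := by
  classical
  rw [bag_eq, dif_pos i.2, List.length_map,
    ← List.toFinset_card_of_nodup ((List.nodup_finRange _).filter _)]
  congr 1
  ext v
  simp

theorem maxBag_le_iff {k : ℕ} : I.maxBag ≤ k ↔ ∀ i, (I.D.bag i).card ≤ k := by
  rw [maxBag, foldl_max_le_iff, decomp]
  simp only [zero_le, true_and, List.forall_mem_map, List.mem_finRange, forall_true_left]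
  refine forall_congr' fun i => ?_
  rw [← length_bag, bag_eq, dif_pos i.2]

theorem card_bag_le (i : Fin I.N) : (I.D.bag i).card ≤ I.maxBag := maxBag_le_iff.1 le_rfl i

theorem maxBag_le : I.maxBag ≤ I.D.width + 1 :=
  maxBag_le_iff.2 fun i => by
    have hsup := Finset.le_sup (f := fun i => (I.D.bag i).card) (Finset.mem_univ i)
    unfold TreeDecomposition.width
    omega

theorem N_pos : 0 < I.N :=
  let ⟨i⟩ := I.D.isTree.1.nonempty
  i.pos

theorem valid : I.data.Valid where
  exists_inBag u v h := by
    rw [weight_eq] at h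
    split_ifs at h with huv
    · have hadj : I.G.Adj ⟨u, huv.1⟩ ⟨v, huv.2⟩ := by
        by_contra hadj
        exact h (if_neg hadj)
      obtain ⟨i, hu, hv⟩ := I.D.exists_edge_bag _ _ hadj
      exact ⟨i, i.2.trans_eq data_N.symm, inBag_iff.2 ⟨i.2, huv.1, hu⟩,
        inBag_iff.2 ⟨i.2, huv.2, hv⟩⟩
    · exact absurd rfl h
  lt_n i v h := by
    obtain ⟨-, hv, -⟩ := inBag_iff.1 h
    rwa [data_n]

theorem layout : I.data.Layout (NodeAdj I.D.tree) where
  nodup := (grown_dfsOrder I.D.isTree N_pos mem_neighbours).1.nodup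
  mem_order i := by
    rw [data_N]
    exact (grown_dfsOrder I.D.isTree N_pos mem_neighbours).2 i
  symm _ _ := NodeAdj.symm
  exists_adj F v h := by
    simp only [← DPData.inBag_iff]
    obtain ⟨hin, hout⟩ := DPData.isBoundary_iff.1 h
    obtain ⟨i, -, hiF, hiv⟩ := DPData.occursIn_iff.1 hin
    obtain ⟨j, -, hjF, hjv⟩ := DPData.occursOutside_iff.1 hout
    obtain ⟨hi, hv, hiv⟩ := inBag_iff.1 hiv
    obtain ⟨hj, _, hjv⟩ := inBag_iff.1 hjv
    obtain ⟨x, hx, y, hy, hxy⟩ := exists_adj_leaving (I.D.connected ⟨v, hv⟩).preconnected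
      (S := {c | ((c : Fin I.N) : ℕ) ∈ F}) (a := ⟨⟨i, hi⟩, hiv⟩) (b := ⟨⟨j, hj⟩, hjv⟩)
      (DPData.indicator_pos.1 hiF) (DPData.indicator_eq_zero.1 hjF)
    exact ⟨x.1, hx, y.1, hy, ⟨x.1.2, y.1.2, hxy⟩, inBag_iff.2 ⟨x.1.2, hv, x.2⟩,
      inBag_iff.2 ⟨y.1.2, hv, y.2⟩⟩
  length_bag_le i := by
    change _ ≤ I.maxBag
    rcases lt_or_ge i I.N with hi | hi
    · exact (length_bag ⟨i, hi⟩).trans_le (card_bag_le _)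
    · rw [bag_eq, dif_neg hi.not_gt]
      exact Nat.zero_le _

theorem derivable : I.data.Derivable (Finset.range I.data.N) (I.data.rounds + 1) :=
  layout.derivable_range data_N I.D.isTree N_pos mem_neighbours rfl (Nat.lt_size_self I.N)

end Instance

end MinStableCut

/-! ### The cut returned by the algorithm -/

namespace MinStableCut

open Encoding (encode)

/-- A cut as a function on the natural numbers. -/
def extend {n : ℕ} (side : Fin n → Bool) (v : ℕ) : ℕ :=
  if h : v < n then (side ⟨v, h⟩).toNat else 0

theorem extend_val {n : ℕ} (side : Fin n → Bool) (v : Fin n) : extend side v = (side v).toNat := by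
  simp [extend]

theorem extend_le_one {n : ℕ} (side : Fin n → Bool) (v : ℕ) : extend side v ≤ 1 := by
  unfold extend
  split_ifs
  exacts [Bool.toNat_le _, Nat.zero_le 1]

namespace Instance

variable {I : Instance}

theorem weight_val (u v : Fin I.n) : I.data.weight u v = pairWeight I.G I.w u v := by
  rw [weight_eq, dif_pos ⟨u.2, v.2⟩]

theorem totalDegree_eq (v : Fin I.n) : I.data.totalDegree v = weightedDegree I.G I.w v := by
  rw [DPData.totalDegree, data_n, Finset.sum_range, weightedDegree_eq]
  exact Finset.sum_congr rfl fun u _ => weight_val v u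

theorem totalDegree_of_le {v : ℕ} (hv : I.n ≤ v) : I.data.totalDegree v = 0 :=
  Finset.sum_eq_zero fun u _ => by rw [weight_eq, dif_neg fun h => hv.not_gt h.1]

section Cut

variable {x : ℕ → ℕ} {side : Fin I.n → Bool} (hx : ∀ v : Fin I.n, x v = (side v).toNat)

include hx

theorem totalCrossing_eq (v : Fin I.n) :
    I.data.totalCrossing x v = crossWeight I.G I.w side v := by
  rw [DPData.totalCrossing, data_n, Finset.sum_range, crossWeight_eq]
  refine Finset.sum_congr rfl fun u _ => ?_
  rw [hx, hx, weight_val]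
  cases side u <;> cases side v <;> simp

theorem totalCost_eq : I.data.totalCost x = cutWeight I.G I.w side := by
  simp only [DPData.totalCost, data_n, Finset.sum_range]
  rw [cutWeight_eq]
  refine Finset.sum_congr rfl fun u _ => Finset.sum_congr rfl fun v _ => ?_
  rw [hx, hx, weight_val]
  cases side u <;> cases side v <;> simp

end Cut

theorem stable_extend {side : Fin I.n → Bool} (h : IsStable I.G I.w side) :
    I.data.Stable (extend side) := by
  refine ⟨extend_le_one side, fun v => ?_⟩
  rcases lt_or_ge v I.n with hv | hv
  · have hstable := h ⟨v, hv⟩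
    rw [← totalDegree_eq, ← totalCrossing_eq (extend_val side),
      div_le_iff₀ (by norm_num)] at hstable
    rw [mul_comm]
    exact_mod_cast hstable
  · rw [totalDegree_of_le hv]
    exact Nat.zero_le _

theorem exists_stable (I : Instance) : ∃ σ, I.data.Stable σ :=
  let ⟨_, h⟩ := exists_isStable I.G I.w
  ⟨_, stable_extend h⟩

theorem length_solution : I.solution.length = I.n := by
  unfold solution
  split_ifs
  · exact length_tabulate _ _
  · obtain ⟨σ, hσ⟩ := I.exists_stable
    exact (DPData.output_spec valid derivable hσ).1.trans data_n

theorem nth_solution_le_one (v : ℕ) : nth I.solution v ≤ 1 := by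
  unfold solution
  split_ifs
  · rw [nth_tabulate, ite_self]
    exact Nat.zero_le 1
  · obtain ⟨σ, hσ⟩ := I.exists_stable
    exact (DPData.output_spec valid derivable hσ).2.1 v

/-- The cut that is returned. -/
noncomputable def side (I : Instance) (v : Fin I.n) : Bool := decide (nth I.solution v ≠ 0)

theorem nth_solution (v : Fin I.n) : nth I.solution v = (I.side v).toNat := by
  rw [side]
  rcases Nat.le_one_iff_eq_zero_or_eq_one.1 (nth_solution_le_one (I := I) v) with h | h <;> simp [h]

theorem encodeCut_side : encodeCut I.side = encode I.solution := by
  have hsolution : I.solution = (List.finRange I.n).map fun v => (I.side v).toNat := by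
    refine List.ext_getElem (by simp [length_solution]) fun v hv _ => ?_
    rw [List.getElem_map, List.getElem_finRange, ← nth_solution]
    exact (List.getD_eq_getElem _ 0 hv).symm
  rw [hsolution]
  simp only [encode, encodeCut, List.map_map, Function.comp_def]

theorem num_pos : 0 < I.ε.num.toNat := by
  have := Rat.num_pos.2 I.ε_pos
  omega

theorem ε_eq : I.ε = (I.ε.num.toNat : ℚ) / I.ε.den := by
  have hnum : ((I.ε.num.toNat : ℤ) : ℚ) = I.ε.num := by
    rw [Int.toNat_of_nonneg (Rat.num_pos.2 I.ε_pos).le]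
  rw [← Int.cast_natCast, hnum]
  exact (Rat.num_div_den I.ε).symm

theorem rounds_le_scale_mul : (2 * (I.rounds + 1) : ℚ) ≤ I.data.scale * I.ε := by
  have hlt : 2 * (I.rounds + 1) * I.ε.den < I.data.scale * I.ε.num.toNat := by
    change _ < (_ / _ + 1) * _
    rw [add_mul, one_mul]
    exact Nat.lt_div_mul_add num_pos
  rw [ε_eq, ← mul_div_assoc, le_div_iff₀ (mod_cast I.ε.den_pos)]
  exact_mod_cast hlt.le

theorem weightedDegree_eq_zero_of_maxBag_le_one (h : I.maxBag ≤ 1) (v : Fin I.n) :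
    weightedDegree I.G I.w v = 0 := by
  rw [weightedDegree_eq]
  refine Finset.sum_eq_zero fun u _ => if_neg fun hadj => ?_
  obtain ⟨i, hv, hu⟩ := I.D.exists_edge_bag _ _ hadj
  exact absurd (Finset.one_lt_card.2 ⟨_, hv, _, hu, hadj.ne⟩)
    ((card_bag_le i).trans h).not_gt

theorem le_crossWeight_of_isTrivial (h : I.isTrivial) (side : Fin I.n → Bool) (v : Fin I.n) :
    (1 - I.ε) * (weightedDegree I.G I.w v : ℚ) / 2 ≤ (crossWeight I.G I.w side v : ℚ) := by
  simp only [isTrivial, Bool.or_eq_true, decide_eq_true_eq] at h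
  rcases h with hbag | hnum
  · rw [weightedDegree_eq_zero_of_maxBag_le_one hbag]
    simp
  · have hε : 1 ≤ I.ε := by
      rw [ε_eq, le_div_iff₀ (mod_cast I.ε.den_pos), one_mul]
      exact_mod_cast hnum
    calc (1 - I.ε) * (weightedDegree I.G I.w v : ℚ) / 2 ≤ 0 :=
          div_nonpos_of_nonpos_of_nonneg
            (mul_nonpos_of_nonpos_of_nonneg (sub_nonpos.2 hε) (Nat.cast_nonneg _)) zero_le_two
      _ ≤ _ := Nat.cast_nonneg _

theorem le_crossWeight_side (v : Fin I.n) :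
    (1 - I.ε) * (weightedDegree I.G I.w v : ℚ) / 2 ≤ (crossWeight I.G I.w I.side v : ℚ) := by
  by_cases ht : I.isTrivial
  · exact le_crossWeight_of_isTrivial ht _ v
  obtain ⟨σ, hσ⟩ := I.exists_stable
  have houtput := (DPData.output_spec valid derivable hσ).2.2.1 v
    (v.2.trans_eq data_n.symm)
  rw [show I.data.output = I.solution from (if_neg ht).symm, totalDegree_eq,
    totalCrossing_eq nth_solution] at houtput
  have hscale : (0 : ℚ) < I.data.scale := mod_cast Nat.succ_pos _
  set d := weightedDegree I.G I.w v
  set c := crossWeight I.G I.w I.side v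
  have hspec : (I.data.scale : ℚ) * d ≤ 2 * I.data.scale * c + 2 * (I.rounds + 1) * d := by
    exact_mod_cast houtput
  have hround := mul_le_mul_of_nonneg_right (rounds_le_scale_mul (I := I)) (Nat.cast_nonneg d)
  have hscaled : (I.data.scale : ℚ) * ((1 - I.ε) * d) ≤ I.data.scale * (2 * c) := by linarith
  linarith [le_of_mul_le_mul_left hscaled hscale]

theorem cutWeight_side_le {side' : Fin I.n → Bool} (h : IsStable I.G I.w side') :
    cutWeight I.G I.w I.side ≤ cutWeight I.G I.w side' := by
  by_cases ht : I.isTrivial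
  · have hside : ∀ v, I.side v = false := fun v => by
      simp [side, solution, ht, nth_tabulate]
    rw [cutWeight_eq]
    simp [hside]
  · have houtput := (DPData.output_spec valid derivable (stable_extend h)).2.2.2 _ (stable_extend h)
    rwa [show I.data.output = I.solution from (if_neg ht).symm, totalCost_eq nth_solution,
      totalCost_eq (extend_val side')] at houtput

end Instance

end MinStableCut

/-! ### Running time of the algorithm -/

namespace MinStableCut

open Encoding (encode)

/-- A step of the computation of `Nat.size` by doubling: the first component counts the doublings,
the second one is the power of two. -/
def doublingStep (N : ℕ) (s : ℕ × ℕ) : ℕ × ℕ := if s.2 ≤ N then (s.1 + 1, 2 * s.2) else s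

theorem iterate_doublingStep (N j : ℕ) :
    (doublingStep N)^[j] (0, 1) = (min j N.size, 2 ^ min j N.size) := by
  induction j with
  | zero => simp
  | succ j ih =>
    rw [Function.iterate_succ_apply', ih, doublingStep]
    split_ifs with h
    · have hlt : min j N.size < N.size := Nat.lt_size.2 h
      rw [show min (j + 1) N.size = min j N.size + 1 by omega, pow_succ']
    · have hle : N.size ≤ min j N.size := not_lt.1 fun h' => h (Nat.lt_size.1 h')
      rw [show min (j + 1) N.size = min j N.size by omega]

namespace PolyTime

variable {α : Type*} [Encoding α] {m : α → ℕ}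

theorem max {f g : α → ℕ} (hf : PolyTime m f) (hg : PolyTime m g) :
    PolyTime m fun a => max (f a) (g a) :=
  ((hf.le hg).ite hg hf).congr fun _ => max_def _ _

theorem natSize [SizeMeasure m] {N : α → ℕ} (hN : PolyTime m N) (hb : PolyBounded m N) :
    PolyTime m fun a => (N a).size := by
  have hstep : PolyTime (extMeasure m) fun q : α × ℕ × ℕ => doublingStep (N q.1) q.2 :=
    ite (last.snd.le hN.lift) ((last.fst.add (const_nat 1)).pair ((const_nat 2).mul last.snd)) last
  have hiterate : PolyTime m fun a => (doublingStep (N a))^[N a] (0, 1) :=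
    iterate hN hb ((const_nat 0).pair (const_nat 1)) hstep
      (((PolyBounded.const m 2).mul hb).add (.const m 4)) fun a j _ => by
        have := natSize_le_self (min j (N a).size)
        have := natSize_le_self (N a)
        rw [iterate_doublingStep, encodeSize_pair, encodeSize_nat, encodeSize_nat, Nat.size_pow]
        omega
  exact hiterate.fst.congr fun a => by
    rw [iterate_doublingStep, min_eq_right (natSize_le_self _)]

variable {decomp : α → List (List ℕ × List ℕ)} {L : α → List ℕ}

theorem fringe [SizeMeasure m] (hdecomp : PolyTime m decomp) (hL : PolyTime m L) :
    PolyTime m fun a => fringe (fun i => ((decomp a).getD i ([], [])).1) (L a) := by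
  have hneighbours : PolyTime (extMeasure m) fun q : α × ℕ =>
      ((decomp q.1).getD q.2 ([], [])).1 := (hdecomp.lift.getD last (nil.pair nil)).fst
  exact hL.flatMap ((hneighbours.filter (hL.lift.lift.any (last.eq last.lift)).not).map
    (last.pair last.lift))

theorem grow [SizeMeasure m] (hdecomp : PolyTime m decomp) (hL : PolyTime m L) :
    PolyTime m fun a => grow (fun i => ((decomp a).getD i ([], [])).1) (L a) := by
  have hfringe := hdecomp.fringe hL
  have hnew := hfringe.getD (const_nat 0) ((const_nat 0).pair (const_nat 0))
  exact ite (hfringe.length.eq (const_nat 0)) hL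
    (hL.flatMap (ite (last.eq hnew.lift.snd) (last.cons (hnew.lift.fst.cons nil)) (last.cons nil)))

end PolyTime

namespace Instance

/-- The size of an instance, with the numbers of vertices and of nodes counted in unary. -/
noncomputable def inputSize (I : Instance) : ℕ := encodeSize I + I.n + I.N

/-- The measure in which the running time of the algorithm is polynomial. -/
noncomputable def measure (I : Instance) : ℕ :=
  I.inputSize + if I.isTrivial then 0 else I.data.keyBound

theorem polyBounded_n : PolyBounded inputSize n := .of_le fun I => by unfold inputSize; omega

theorem polyBounded_N : PolyBounded inputSize N := .of_le fun I => by unfold inputSize; omega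

theorem polyBounded_inputSize : PolyBounded measure inputSize :=
  .of_le fun _ => Nat.le_add_right _ _

instance : SizeMeasure inputSize := ⟨.of_le fun I => by unfold inputSize; omega⟩

instance : SizeMeasure measure := ⟨SizeMeasure.polyBounded_encodeSize.trans polyBounded_inputSize⟩

theorem polyTime_components : PolyTime inputSize components :=
  .of_encode_eq encode_components

theorem polyTime_n : PolyTime inputSize n := polyTime_components.fst

theorem polyTime_N : PolyTime inputSize N := polyTime_components.snd.fst

theorem polyTime_adj : PolyTime inputSize adj := polyTime_components.snd.snd.fst

theorem polyTime_decomp : PolyTime inputSize decomp := polyTime_components.snd.snd.snd.fst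

theorem polyTime_num : PolyTime inputSize fun I => I.ε.num.toNat :=
  polyTime_components.snd.snd.snd.snd.fst

theorem polyTime_den : PolyTime inputSize fun I => I.ε.den :=
  polyTime_components.snd.snd.snd.snd.snd.fst

theorem length_le_of_mem_decomp {I : Instance} {e : List ℕ × List ℕ} (he : e ∈ I.decomp) :
    e.2.length ≤ I.n := by
  obtain ⟨i, -, rfl⟩ := List.mem_map.1 he
  simpa using List.length_filter_le _ (List.finRange I.n)

theorem polyTime_maxBag : PolyTime inputSize maxBag :=
  .foldl (f := fun _ (k : ℕ) (e : List ℕ × List ℕ) => max k e.2.length) polyTime_decomp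
    (.const_nat 0) (PolyTime.last.lift.max PolyTime.last.snd.length)
    (polyBounded_n.add (.const _ 1)) fun _ _ _ =>
      (encodeSize_nat_le _).trans (Nat.succ_le_succ ((foldl_max_le_iff _ _).2
        ⟨Nat.zero_le _, fun _ he => length_le_of_mem_decomp (List.mem_of_mem_take he)⟩))

theorem polyTime_rounds : PolyTime inputSize rounds :=
  have hsize := polyTime_N.natSize polyBounded_N
  hsize.mul (hsize.add (.const_nat 1))

theorem polyBounded_rounds : PolyBounded inputSize rounds :=
  (polyBounded_N.mul (polyBounded_N.add (.const _ 1))).mono fun I =>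
    Nat.mul_le_mul (natSize_le_self I.N) (Nat.succ_le_succ (natSize_le_self I.N))

theorem polyTime_dfsOrder : PolyTime inputSize fun I => dfsOrder I.N I.neighbours := by
  refine .iterate (B := fun I => I.N * (I.N + 1 + 1) + 1) polyTime_N polyBounded_N
    ((PolyTime.const_nat 0).cons .nil) (polyTime_decomp.lift.grow .last) ?_ fun I j _ => ?_
  · exact (polyBounded_N.mul ((polyBounded_N.add (.const _ 1)).add (.const _ 1))).add (.const _ 1)
  · have h := (Grown.iterate_grow I.D.isTree N_pos mem_neighbours j).1
    exact encodeSize_list_le h.length_le fun i hi =>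
      (encodeSize_nat_le i).trans (Nat.succ_le_succ (h.lt i hi).le)

theorem polyTime_data : PolyTime inputSize data :=
  have hscale := ((((PolyTime.const_nat 2).mul (polyTime_rounds.add (.const_nat 1))).mul
    polyTime_den).div polyTime_num).add (.const_nat 1)
  (polyTime_adj.pair (polyTime_decomp.pair (polyTime_dfsOrder.pair (polyTime_maxBag.pair
    (hscale.pair polyTime_rounds))))).congr_encode fun _ => rfl

theorem polyTime_isTrivial : PolyTime inputSize isTrivial :=
  (polyTime_maxBag.le (.const_nat 1)).or (polyTime_den.le polyTime_num)

theorem polyTime_solution : PolyTime measure solution := by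
  refine .ite_subtype (b := isTrivial) (f := fun I => tabulate I.1.n fun _ => 0)
    (g := fun I => I.1.data.output) (polyTime_isTrivial.mono_measure polyBounded_inputSize) ?_ ?_
    (fun I h => if_pos h) fun I h => if_neg (by simp [h])
  · exact ((PolyTime.tabulate (f := fun _ _ => 0) polyTime_n polyBounded_n
      (.const_nat 0)).mono_measure polyBounded_inputSize).restrict _
  · refine .output (A := fun I => NodeAdj I.1.D.tree)
      ((polyTime_data.mono_measure polyBounded_inputSize).restrict _)
      ((polyBounded_rounds.trans polyBounded_inputSize).comp (.refl _)) (.of_le fun I => ?_)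
      (fun I => valid) fun I => layout
    simp [measure, I.2]

end Instance

end MinStableCut

/-! ### The bound on the running time -/

namespace MinStableCut

theorem pow_le_pow_self_mul_four_pow (x : ℕ) {j : ℕ} (hj : 0 < j) : x ^ j ≤ j ^ j * 4 ^ x := by
  have hj' : (0 : ℝ) < j := Nat.cast_pos.2 hj
  have hexp : Real.exp x ≤ 4 ^ x := by
    rw [← mul_one (x : ℝ), Real.exp_nat_mul]
    exact pow_le_pow_left₀ (Real.exp_pos _).le (by linarith [Real.exp_one_lt_three]) x
  suffices (x : ℝ) ^ j ≤ j ^ j * 4 ^ x by exact_mod_cast this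
  calc (x : ℝ) ^ j = j ^ j * (x / j : ℝ) ^ j := by rw [← mul_pow, mul_div_cancel₀ _ hj'.ne']
    _ ≤ j ^ j * Real.exp (x / j) ^ j := by
      gcongr
      linarith [Real.add_one_le_exp ((x : ℝ) / j)]
    _ = j ^ j * Real.exp x := by rw [← Real.exp_nat_mul, mul_div_cancel₀ _ hj'.ne']
    _ ≤ j ^ j * 4 ^ x := by gcongr

theorem size_add_one_pow_le {N j : ℕ} (hN : 0 < N) (hj : 0 < j) :
    (N.size + 1) ^ j ≤ j ^ j * (16 * N ^ 2) := by
  obtain ⟨k, hk⟩ := Nat.exists_eq_succ_of_ne_zero (Nat.size_pos.2 hN).ne'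
  have hkN : 2 ^ k ≤ N := Nat.lt_size.1 (hk ▸ k.lt_succ_self)
  calc (N.size + 1) ^ j ≤ j ^ j * 4 ^ (N.size + 1) := pow_le_pow_self_mul_four_pow _ hj
    _ = j ^ j * (16 * (2 ^ k) ^ 2) := by
      rw [hk, Nat.succ_eq_add_one, show (4 : ℕ) = 2 ^ 2 from rfl, ← pow_mul, ← pow_mul]
      ring
    _ ≤ j ^ j * (16 * N ^ 2) := by gcongr

theorem encodeSize_map_val_filter_le {n k : ℕ} (hn : n ≤ k) (p : Fin n → Bool) :
    encodeSize (((List.finRange n).filter p).map Fin.val) ≤ k * (k + 1) + 1 := by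
  refine encodeSize_list_le ?_ fun a ha => ?_
  · simpa using (List.length_filter_le p (List.finRange n)).trans (by simpa using hn)
  · obtain ⟨h, -⟩ := mem_map_val_filter_finRange.1 ha
    exact (encodeSize_nat_le a).trans (h.trans_le hn)

namespace Instance

/-- The parameter in which the running time is polynomial. -/
noncomputable def bits (I : Instance) : ℕ :=
  I.n + I.N + Nat.log 2 (maxWeight I.G I.w) + bitLength I.ε

/-- The parameter in which the running time is exponential. -/
noncomputable def ratio (I : Instance) : ℚ := max 1 ((I.D.width : ℚ) / I.ε)

variable {I : Instance}

theorem add_two_le_bits : I.n + I.N + Nat.log 2 (maxWeight I.G I.w) + 2 ≤ I.bits := by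
  have hnum := Nat.size_pos.2 (num_pos (I := I))
  have hden := Nat.size_pos.2 I.ε.den_pos
  unfold bits bitLength
  omega

theorem one_le_ratio : 1 ≤ I.ratio := le_max_left _ _

/-! #### The size of the input -/

theorem size_weight_le {u v : Fin I.n} (h : I.G.Adj v u) :
    (I.w s(v, u)).size ≤ Nat.log 2 (maxWeight I.G I.w) + 1 :=
  have hle : I.w s(v, u) ≤ maxWeight I.G I.w := Finset.le_sup (f := I.w) (by simpa using h)
  Nat.size_le.2 (hle.trans_lt (Nat.lt_pow_succ_log_self one_lt_two _))

theorem encodeSize_adj_le :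
    encodeSize I.adj ≤ I.bits * ((I.bits * ((2 * I.bits + 1) + 1) + 1) + 1) + 1 := by
  classical
  have hbits := add_two_le_bits (I := I)
  refine encodeSize_list_le (by simp only [adj, List.length_map, List.length_finRange]; omega)
    fun l hl => ?_
  obtain ⟨v, -, rfl⟩ := List.mem_map.1 hl
  refine encodeSize_list_le ?_ fun e he => ?_
  · have := List.length_filter_le (fun u => decide (I.G.Adj v u)) (List.finRange I.n)
    rw [List.length_finRange] at this
    rw [List.length_map]
    omega
  · obtain ⟨u, hu, rfl⟩ := List.mem_map.1 he
    have hweight := size_weight_le (of_decide_eq_true (List.mem_filter.1 hu).2)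
    have hu := encodeSize_nat_le u
    rw [encodeSize_pair, encodeSize_nat (I.w s(v, u))]
    omega

theorem encodeSize_decomp_le :
    encodeSize I.decomp ≤ I.bits * ((2 * (I.bits * (I.bits + 1) + 1) + 1) + 1) + 1 := by
  classical
  have hbits := add_two_le_bits (I := I)
  refine encodeSize_list_le (by simp only [decomp, List.length_map, List.length_finRange]; omega)
    fun e he => ?_
  obtain ⟨i, -, rfl⟩ := List.mem_map.1 he
  have hneighbours := encodeSize_map_val_filter_le (show I.N ≤ I.bits by omega)
    fun j => decide (I.D.tree.Adj i j)
  have hbag := encodeSize_map_val_filter_le (show I.n ≤ I.bits by omega)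
    fun v => decide (v ∈ I.D.bag i)
  rw [encodeSize_pair]
  omega

theorem encodeSize_eq : encodeSize I = encodeSize I.n + encodeSize I.N + encodeSize I.adj +
    encodeSize I.decomp + encodeSize I.ε.num.toNat + encodeSize I.ε.den + 7 := by
  have h : encodeSize I = encodeSize I.components := by
    rw [encodeSize, encodeSize, encode_components]
  have hzero : encodeSize 0 = 1 := rfl
  rw [h, components]
  simp only [encodeSize_pair, hzero]
  ring

theorem inputSize_le : I.inputSize ≤ 20 * I.bits ^ 3 := by
  have hbits := add_two_le_bits (I := I)
  have hadj := encodeSize_adj_le (I := I)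
  have hdecomp := encodeSize_decomp_le (I := I)
  have hlinear : I.inputSize ≤ encodeSize I.adj + encodeSize I.decomp + 4 * I.bits + 7 := by
    have hn := encodeSize_nat_le I.n
    have hN := encodeSize_nat_le I.N
    rw [inputSize, encodeSize_eq, encodeSize_nat I.ε.num.toNat, encodeSize_nat I.ε.den]
    unfold bits bitLength at *
    omega
  obtain ⟨k, hk⟩ := Nat.exists_eq_add_of_le' (show 2 ≤ I.bits by omega)
  rw [hk] at hadj hdecomp hlinear ⊢
  nlinarith [sq_nonneg k, pow_nonneg (Nat.zero_le k) 3]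

/-! #### The number of keys -/

theorem rounds_le : (2 * ((I.rounds : ℚ) + 1)) ≤ 2 * ((I.N.size : ℚ) + 1) ^ 2 := by
  have : (0 : ℚ) ≤ I.N.size := Nat.cast_nonneg _
  rw [rounds]
  push_cast
  nlinarith

theorem scale_le : (I.data.scale : ℚ) ≤ 2 * (I.rounds + 1) * (1 / I.ε) + 1 := by
  have hdiv := Nat.cast_div_le (α := ℚ) (m := 2 * (I.rounds + 1) * I.ε.den) (n := I.ε.num.toNat)
  have hε : 1 / I.ε = I.ε.den / I.ε.num.toNat := by
    conv_lhs => rw [ε_eq]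
    rw [one_div_div]
  rw [hε, ← mul_div_assoc]
  simp only [data]
  push_cast at hdiv ⊢
  linarith

theorem not_isTrivial_iff : I.isTrivial = false ↔ 1 < I.maxBag ∧ I.ε.num.toNat < I.ε.den := by
  simp [isTrivial]

theorem one_le_width (h : I.isTrivial = false) : 1 ≤ I.D.width := by
  have := (not_isTrivial_iff.1 h).1
  have := maxBag_le (I := I)
  omega

theorem ε_le_one (h : I.isTrivial = false) : I.ε ≤ 1 := by
  rw [ε_eq, div_le_one (Nat.cast_pos.2 I.ε.den_pos)]
  exact_mod_cast (not_isTrivial_iff.1 h).2.le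

theorem width_le_ratio (h : I.isTrivial = false) : (I.D.width : ℚ) ≤ I.ratio :=
  (le_div_self (Nat.cast_nonneg _) I.ε_pos (ε_le_one h)).trans (le_max_right _ _)

theorem one_div_ε_le_ratio (h : I.isTrivial = false) : 1 / I.ε ≤ I.ratio := by
  refine le_trans ?_ (le_max_right _ _)
  have := I.ε_pos
  gcongr
  exact_mod_cast one_le_width h

theorem two_mul_scale_add_one_le (h : I.isTrivial = false) :
    2 * ((I.data.scale : ℚ) + 1) ≤ 8 * ((I.N.size : ℚ) + 1) ^ 2 * I.ratio := by
  have hone : 1 ≤ ((I.N.size : ℚ) + 1) ^ 2 * I.ratio :=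
    one_le_mul_of_one_le_of_one_le (one_le_pow₀ (by simp)) one_le_ratio
  have hscale : (I.data.scale : ℚ) ≤ 2 * ((I.N.size : ℚ) + 1) ^ 2 * I.ratio + 1 :=
    scale_le.trans (add_le_add_left (mul_le_mul rounds_le (one_div_ε_le_ratio h)
      (one_div_nonneg.2 I.ε_pos.le) (by positivity)) 1)
  linarith

theorem two_pow_mul_width_le (h : I.isTrivial = false) (k : ℕ) :
    (2 : ℚ) ^ (k * I.D.width) ≤ 2 ^ k * I.ratio ^ (k * I.D.width) := by
  have hratio := one_le_ratio (I := I)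
  rcases (one_le_width h).eq_or_lt with hone | htwo
  · rw [← hone, mul_one]
    exact le_mul_of_one_le_right (by positivity) (one_le_pow₀ hratio)
  · have htwo : 2 ≤ I.ratio := le_trans (by exact_mod_cast htwo) (width_le_ratio h)
    calc (2 : ℚ) ^ (k * I.D.width) ≤ I.ratio ^ (k * I.D.width) := by gcongr
      _ ≤ 2 ^ k * I.ratio ^ (k * I.D.width) :=
        le_mul_of_one_le_left (by positivity) (one_le_pow₀ one_le_two)

/-- The factor `(log N) ^ O(tw)` is absorbed by `tw ^ O(tw)` and a polynomial in `N`. -/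
theorem size_add_one_pow_mul_width_le (h : I.isTrivial = false) :
    ((I.N.size : ℚ) + 1) ^ (8 * I.D.width) ≤
      2 ^ (24 * I.D.width) * I.ratio ^ (8 * I.D.width) * (16 * (I.N : ℚ) ^ 2) := by
  have hwidth := one_le_width h
  have hnat := size_add_one_pow_le (N_pos (I := I)) (show 0 < 8 * I.D.width by omega)
  calc ((I.N.size : ℚ) + 1) ^ (8 * I.D.width)
      ≤ (8 * (I.D.width : ℚ)) ^ (8 * I.D.width) * (16 * (I.N : ℚ) ^ 2) := by exact_mod_cast hnat
    _ ≤ (8 * I.ratio) ^ (8 * I.D.width) * (16 * (I.N : ℚ) ^ 2) := by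
      gcongr
      exact width_le_ratio h
    _ = 2 ^ (24 * I.D.width) * I.ratio ^ (8 * I.D.width) * (16 * (I.N : ℚ) ^ 2) := by
      rw [mul_pow, show (8 : ℚ) = 2 ^ 3 by norm_num, ← pow_mul]
      ring_nf

theorem keyBound_le (h : I.isTrivial = false) :
    (I.data.keyBound : ℚ) ≤ 2 ^ 40 * (I.bits : ℚ) ^ 6 * I.ratio ^ (48 * I.D.width) := by
  have hratio := one_le_ratio (I := I)
  have hbits := add_two_le_bits (I := I)
  have hmaxBag : 2 * I.maxBag ≤ 4 * I.D.width := by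
    have := one_le_width h
    have := maxBag_le (I := I)
    omega
  have hN : (I.N : ℚ) + 1 ≤ I.bits := by exact_mod_cast (by omega : I.N + 1 ≤ I.bits)
  have hscale : 1 ≤ 2 * ((I.data.scale : ℚ) + 1) := by
    linarith [Nat.cast_nonneg (α := ℚ) I.data.scale]
  have hpow : (2 * ((I.data.scale : ℚ) + 1)) ^ (2 * I.maxBag) ≤
      2 ^ (36 * I.D.width) * I.ratio ^ (12 * I.D.width) * (16 * (I.N : ℚ) ^ 2) :=
    calc (2 * ((I.data.scale : ℚ) + 1)) ^ (2 * I.maxBag)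
        ≤ (2 * ((I.data.scale : ℚ) + 1)) ^ (4 * I.D.width) := pow_le_pow_right₀ hscale hmaxBag
      _ ≤ (8 * ((I.N.size : ℚ) + 1) ^ 2 * I.ratio) ^ (4 * I.D.width) := by
        exact pow_le_pow_left₀ (by linarith) (two_mul_scale_add_one_le h) _
      _ = 2 ^ (12 * I.D.width) * I.ratio ^ (4 * I.D.width) *
          ((I.N.size : ℚ) + 1) ^ (8 * I.D.width) := by
        rw [mul_pow, mul_pow, show (8 : ℚ) = 2 ^ 3 by norm_num, ← pow_mul, ← pow_mul]
        ring_nf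
      _ ≤ 2 ^ (12 * I.D.width) * I.ratio ^ (4 * I.D.width) *
          (2 ^ (24 * I.D.width) * I.ratio ^ (8 * I.D.width) * (16 * (I.N : ℚ) ^ 2)) := by
        gcongr
        exact size_add_one_pow_mul_width_le h
      _ = 2 ^ (36 * I.D.width) * I.ratio ^ (12 * I.D.width) * (16 * (I.N : ℚ) ^ 2) := by ring
  calc (I.data.keyBound : ℚ)
      = ((I.N : ℚ) + 1) ^ 4 * (2 * ((I.data.scale : ℚ) + 1)) ^ (2 * I.maxBag) := by
        rw [DPData.keyBound, data_N]
        push_cast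
        rfl
    _ ≤ (I.bits : ℚ) ^ 4 * (2 ^ 36 * I.ratio ^ (36 * I.D.width) * I.ratio ^ (12 * I.D.width) *
          (16 * (I.bits : ℚ) ^ 2)) := by
        refine mul_le_mul (by gcongr) (hpow.trans ?_) (by positivity) (by positivity)
        gcongr
        · exact two_pow_mul_width_le h 36
        · linarith
    _ = 2 ^ 40 * (I.bits : ℚ) ^ 6 * I.ratio ^ (48 * I.D.width) := by ring

theorem measure_add_two_le :
    (I.measure : ℚ) + 2 ≤ 2 ^ 41 * (I.bits : ℚ) ^ 6 * I.ratio ^ (48 * I.D.width) := by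
  have hratio := one_le_ratio (I := I)
  have hbits : (1 : ℚ) ≤ I.bits := by
    exact_mod_cast (by have := add_two_le_bits (I := I); omega : 1 ≤ I.bits)
  have hone : 1 ≤ (I.bits : ℚ) ^ 6 * I.ratio ^ (48 * I.D.width) :=
    one_le_mul_of_one_le_of_one_le (one_le_pow₀ hbits) (one_le_pow₀ hratio)
  have hinput : (I.inputSize : ℚ) ≤ 20 * ((I.bits : ℚ) ^ 6 * I.ratio ^ (48 * I.D.width)) :=
    calc (I.inputSize : ℚ) ≤ 20 * (I.bits : ℚ) ^ 3 := by exact_mod_cast inputSize_le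
      _ ≤ 20 * (I.bits : ℚ) ^ 6 := by
        gcongr 20 * ?_
        exact pow_le_pow_right₀ hbits (by norm_num)
      _ ≤ 20 * ((I.bits : ℚ) ^ 6 * I.ratio ^ (48 * I.D.width)) := by
        gcongr
        exact le_mul_of_one_le_right (by positivity) (one_le_pow₀ hratio)
  have hkeys : ((if I.isTrivial then 0 else I.data.keyBound : ℕ) : ℚ) ≤
      2 ^ 40 * (I.bits : ℚ) ^ 6 * I.ratio ^ (48 * I.D.width) := by
    split_ifs with h
    · rw [Nat.cast_zero]
      positivity
    · exact keyBound_le (Bool.eq_false_of_not_eq_true h)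
  rw [measure, Nat.cast_add]
  linarith

theorem exists_measure_add_two_pow_le (c : ℕ) : ∃ c' : ℕ, ∀ I : Instance,
    ((I.measure : ℚ) + 2) ^ c ≤ c' * I.ratio ^ (c' * I.D.width) * (I.bits : ℚ) ^ c' := by
  obtain ⟨A, hA⟩ : ∃ A : ℕ, A = 2 ^ 41 := ⟨_, rfl⟩
  refine ⟨A ^ c + 48 * c + 6 * c, fun I => ?_⟩
  have hratio := one_le_ratio (I := I)
  have hbits : (1 : ℚ) ≤ I.bits := by
    exact_mod_cast (by have := add_two_le_bits (I := I); omega : 1 ≤ I.bits)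
  calc ((I.measure : ℚ) + 2) ^ c
      ≤ (A * (I.bits : ℚ) ^ 6 * I.ratio ^ (48 * I.D.width)) ^ c := by
        gcongr
        rw [hA]
        exact_mod_cast measure_add_two_le
    _ = (A ^ c : ℕ) * I.ratio ^ (48 * c * I.D.width) * (I.bits : ℚ) ^ (6 * c) := by
        push_cast
        rw [mul_pow, mul_pow, ← pow_mul, ← pow_mul]
        ring_nf
    _ ≤ _ := by
        gcongr <;> first | assumption | omega

end Instance

end MinStableCut

theorem theorem4p3 :
    ∃ (p : MinStableCut.Prog) (c : ℕ),
      ∀ (n N : ℕ) (G : SimpleGraph (Fin n)) (w : Sym2 (Fin n) → ℕ)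
        (D : MinStableCut.TreeDecomposition G N) (ε : ℚ), 0 < ε →
        ∃ (side : Fin n → Bool) (t : ℕ),
          MinStableCut.Run p (MinStableCut.encodeInput G w D ε) (MinStableCut.encodeCut side) t ∧
          (t : ℚ) ≤ (c : ℚ) * (max 1 ((D.width : ℚ) / ε)) ^ (c * D.width) *
            ((n : ℚ) + (N : ℚ) + (Nat.log 2 (MinStableCut.maxWeight G w) : ℚ) +
              (MinStableCut.bitLength ε : ℚ)) ^ c ∧
          (∀ v : Fin n, (1 - ε) * (MinStableCut.weightedDegree G w v : ℚ) / 2 ≤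
            (MinStableCut.crossWeight G w side v : ℚ)) ∧
          (∀ side' : Fin n → Bool, MinStableCut.IsStable G w side' →
            MinStableCut.cutWeight G w side ≤ MinStableCut.cutWeight G w side') := by
  obtain ⟨p, T, ⟨c, hT⟩, -, hrun⟩ := MinStableCut.Instance.polyTime_solution
  obtain ⟨c', hc'⟩ := MinStableCut.Instance.exists_measure_add_two_pow_le c
  refine ⟨p, c', fun n N G w D ε hε => ?_⟩
  let I : MinStableCut.Instance := ⟨n, N, G, w, D, ε, hε⟩
  obtain ⟨t, ht, hrun⟩ := hrun I
  have hbits : (I.bits : ℚ) = n + N + Nat.log 2 (MinStableCut.maxWeight G w) +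
      MinStableCut.bitLength ε := by simp [MinStableCut.Instance.bits, I]
  have htime : (t : ℚ) ≤ ((I.measure : ℚ) + 2) ^ c := by exact_mod_cast ht.trans (hT I)
  refine ⟨I.side, t, ?_, hbits ▸ htime.trans (hc' I), I.le_crossWeight_side,
    fun _ => I.cutWeight_side_le⟩
  rw [MinStableCut.Instance.encodeCut_side]
  exact hrun
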